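/- Let $\mathbb{H}$, $\mathbb{U}$ be real Hilbert spaces and let $A$ be the generator of a $C_0$-semigroup $G$ in $\mathbb{H}$ having an exponential dichotomy of finite rank $j\ge 0$: there is a decomposition $\mathbb{H}=\mathbb{H}^s\oplus\mathbb{H}^u$ into closed subspaces, $\dim\mathbb{H}^u=j$, whose projectors commute with $G(t)$ for all $t\ge 0$, such that for some $M,\varepsilon_0>0$ and all $t\ge 0$ we have $|G(t)z|\le Me^{-\varepsilon_0 t}|z|$ for $z\in\mathbb{H}^s$ and $|z|\le Me^{-\varepsilon_0 t}|G(t)z|$ for $z\in\mathbb{H}^u$. Let $B\in\mathcal{L}(\mathbb{U};\mathbb{H})$, $F_1=F_1^*\in\mathcal{L}(\mathbb{H})$, $F_2\in\mathcal{L}(\mathbb{H};\mathbb{U})$, and let $F_3=F_3^*\in\mathcal{L}(\mathbb{U})$ be invertible with $F_3\ge cI$ for some $c>0$. Put $\mathcal{F}(v,\xi)=\langle F_1v,v\rangle+2\langle F_2v,\xi\rangle+\langle F_3\xi,\xi\rangle$ and let $\mathcal{F}^{\mathbb{C}}$ be its Hermitian extension to the complexifications. Assume the frequency condition: for some $\delta>0$,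 $$\mathcal{F}^{\mathbb{C}}\bigl(-(A-i\omega I)^{-1}B\xi,\xi\bigr)\ge\delta|\xi|^2\quad\text{for all }\xi\in\mathbb{U}^{\mathbb{C}},\ \omega\in\mathbb{R}.$$ Consider the Hamiltonian system (with mild solutions, the first equation being understood through the Cauchy formula for $G$ and the second one through the Cauchy formula for the adjoint semigroup in reversed time) $$\dot v=(A-BF_3^{-1}F_2)v+BF_3^{-1}B^*\eta,\qquad \dot\eta=(F_1-F_2^*F_3^{-1}F_2)v-(A-BF_3^{-1}F_2)^*\eta,$$ and let $\mathbb{L}^+_b\subset\mathbb{H}\times\mathbb{H}$ be the set of the initial values $(v(0),\eta(0))$ of its solutions that are bounded on $[0,\infty)$. Suppose that, for some $P=P^*\in\mathcal{L}(\mathbb{H})$, $$\mathbb{L}^+_b=\{(v,-Pv)\mid v\in\mathbb{H}\}.$$ For $v_0\in\mathbb{H}$ let $\mathfrak{M}_{v_0}$ be the set of pairs $(v,\xi)\in L_2(0,\infty;\mathbb{H})\times L_2(0,\infty;\mathbb{U})$ such that $v$ is the mild solution of $\dot v=Av+B\xi$, $v(0)=v_0$, and let $\mathcal{J}_{\mathcal{F}}(v,\xi)=\int_0^\infty\mathcal{F}(v(t),\xi(t))\,dt$.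 Then: 1. For each $v_0\in\mathbb{H}$ the functional $\mathcal{J}_{\mathcal{F}}$ has a unique minimizer $(v^0,\xi^0)$ on $\mathfrak{M}_{v_0}$; its minimum value is $\langle v_0,Pv_0\rangle$, and $\xi^0=Kv^0$, where $K=-F_3^{-1}F_2-F_3^{-1}B^*P$. 2. There exist $\varepsilon>0$ and $P_\varepsilon=P_\varepsilon^*\in\mathcal{L}(\mathbb{H})$ such that for every $T>0$ and all $v\in L_2(0,T;\mathbb{H})$, $\xi\in L_2(0,T;\mathbb{U})$ for which $v$ is a mild solution of $\dot v=Av+B\xi$ on $[0,T]$, $$\langle v(T),P_\varepsilon v(T)\rangle-\langle v(0),P_\varepsilon v(0)\rangle+\int_0^T\mathcal{F}(v(t),\xi(t))\,dt\ \ge\ \varepsilon\int_0^T\bigl(|v(t)|^2+|\xi(t)|^2\bigr)\,dt.$$ -/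

import Mathlib

open MeasureTheory Filter Topology Set
open scoped RealInnerProductSpace

namespace QuadraticRegulator

noncomputable section

variable {H U : Type*} [NormedAddCommGroup H] [InnerProductSpace ℝ H] [CompleteSpace H]
  [NormedAddCommGroup U] [InnerProductSpace ℝ U] [CompleteSpace U]

/-- `G` restricted to `[0, ∞)` is a `C₀`-semigroup of bounded operators in `H`
(the values `G t` for `t < 0` play no role anywhere below). -/
structure IsC0Semigroup (G : ℝ → H →L[ℝ] H) : Prop where
  map_zero : G 0 = ContinuousLinearMap.id ℝ H
  map_add : ∀ s t : ℝ, 0 ≤ s → 0 ≤ t → G (s + t) = (G s).comp (G t)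
  tendsto_zero : ∀ x : H, Tendsto (fun t : ℝ => G t x) (𝓝[>] 0) (𝓝 x)

/-- The unbounded operator `A` is the infinitesimal generator of `G`: its domain consists of those
`x` for which the right derivative of `t ↦ G t x` at `0` exists, and `A x` is this derivative. -/
def IsGenerator (A : H →ₗ.[ℝ] H) (G : ℝ → H →L[ℝ] H) : Prop :=
  ∀ x y : H, (x, y) ∈ A.graph ↔
    Tendsto (fun t : ℝ => t⁻¹ • (G t x - x)) (𝓝[>] 0) (𝓝 y)

/-- Exponential dichotomy of rank `j` of the semigroup `G`. The unstable subspace is the range of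
the bounded projector `Pu`, the stable subspace is its kernel. The last inequality says that the
inverse of `G t` on the (finite-dimensional, invariant) unstable subspace is bounded
by `M * exp (-ε * t)`. -/
def HasExponentialDichotomy (G : ℝ → H →L[ℝ] H) (j : ℕ) : Prop :=
  ∃ Pu : H →L[ℝ] H, Pu.comp Pu = Pu ∧
    FiniteDimensional ℝ (LinearMap.range (Pu : H →ₗ[ℝ] H)) ∧
    Module.finrank ℝ (LinearMap.range (Pu : H →ₗ[ℝ] H)) = j ∧
    (∀ t : ℝ, 0 ≤ t → Pu.comp (G t) = (G t).comp Pu) ∧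
    ∃ ε M : ℝ, 0 < ε ∧ 0 < M ∧
      (∀ t : ℝ, 0 ≤ t → ∀ z : H, Pu z = 0 → ‖G t z‖ ≤ M * Real.exp (-ε * t) * ‖z‖) ∧
      (∀ t : ℝ, 0 ≤ t → ∀ z : H, Pu z = z → ‖z‖ ≤ M * Real.exp (-ε * t) * ‖G t z‖)

/-- The quadratic form `F(v, ξ) = (F₁ v, v) + 2 (F₂ v, ξ) + (F₃ ξ, ξ)`. -/
def quadForm (F₁ : H →L[ℝ] H) (F₂ : H →L[ℝ] U) (F₃ : U ≃L[ℝ] U) (v : H) (ξ : U) : ℝ :=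
  ⟪F₁ v, v⟫ + 2 * ⟪F₂ v, ξ⟫ + ⟪F₃ ξ, ξ⟫

/-- The frequency condition
`F^ℂ(-(A - iωI)⁻¹ B ξ, ξ) ≥ δ |ξ|²` for all `ω ∈ ℝ` and all `ξ ∈ U^ℂ`, with some `δ > 0`.
Elements of the complexifications are written as `v = v₁ + i v₂`, `ξ = ξ₁ + i ξ₂`; the two
equations are the real and imaginary parts of `(A - iω) v = -B ξ`; the Hermitian extension `F^ℂ`
of `F` satisfies `F^ℂ(v, ξ) = F(v₁, ξ₁) + F(v₂, ξ₂)`. -/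
def FrequencyCondition (A : H →ₗ.[ℝ] H) (B : U →L[ℝ] H)
    (F₁ : H →L[ℝ] H) (F₂ : H →L[ℝ] U) (F₃ : U ≃L[ℝ] U) : Prop :=
  ∃ δ : ℝ, 0 < δ ∧ ∀ (ω : ℝ) (ξ₁ ξ₂ : U) (v₁ v₂ : A.domain),
    A v₁ + ω • (v₂ : H) = -B ξ₁ → A v₂ - ω • (v₁ : H) = -B ξ₂ →
    δ * (‖ξ₁‖ ^ 2 + ‖ξ₂‖ ^ 2) ≤
      quadForm F₁ F₂ F₃ (v₁ : H) ξ₁ + quadForm F₁ F₂ F₃ (v₂ : H) ξ₂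

/-- The upper left entry `-B F₃⁻¹ F₂` of the bounded part of the Hamiltonian. -/
def R₁ (B : U →L[ℝ] H) (F₂ : H →L[ℝ] U) (F₃ : U ≃L[ℝ] U) : H →L[ℝ] H :=
  -(B ∘L (F₃.symm : U →L[ℝ] U) ∘L F₂)

/-- The upper right entry `B F₃⁻¹ B*` of the Hamiltonian. -/
def R₃ (B : U →L[ℝ] H) (F₃ : U ≃L[ℝ] U) : H →L[ℝ] H :=
  B ∘L (F₃.symm : U →L[ℝ] U) ∘L ContinuousLinearMap.adjoint B

/-- The lower left entry `F₁ - F₂* F₃⁻¹ F₂` of the Hamiltonian. -/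
def R₂ (F₁ : H →L[ℝ] H) (F₂ : H →L[ℝ] U) (F₃ : U ≃L[ℝ] U) : H →L[ℝ] H :=
  F₁ - ContinuousLinearMap.adjoint F₂ ∘L (F₃.symm : U →L[ℝ] U) ∘L F₂

/-- `(v, η)` is a (continuous) mild solution on `[0, ∞)` of the Hamiltonian system
`v' = (A - B F₃⁻¹ F₂) v + B F₃⁻¹ B* η`,
`η' = (F₁ - F₂* F₃⁻¹ F₂) v - (A - B F₃⁻¹ F₂)* η`.
The first equation `v' = A v + f` is understood through the Cauchy formula for `G`. The second one
`η' = -A* η + g` is governed by `A*`, the generator of the adjoint semigroup `G(t)*`, in reversed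
time, and is understood through the Cauchy formula for the adjoint semigroup run backwards from
any time `t` to any earlier time `s`. -/
structure IsHamiltonianSolution (G : ℝ → H →L[ℝ] H) (B : U →L[ℝ] H)
    (F₁ : H →L[ℝ] H) (F₂ : H →L[ℝ] U) (F₃ : U ≃L[ℝ] U) (v η : ℝ → H) : Prop where
  continuousOn_v : ContinuousOn v (Ici 0)
  continuousOn_η : ContinuousOn η (Ici 0)
  cauchy_v : ∀ t : ℝ, 0 ≤ t →
    v t = G t (v 0) + ∫ τ in (0 : ℝ)..t, G (t - τ) (R₁ B F₂ F₃ (v τ) + R₃ B F₃ (η τ))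
  cauchy_η : ∀ s t : ℝ, 0 ≤ s → s ≤ t →
    η s = ContinuousLinearMap.adjoint (G (t - s)) (η t) -
      ∫ τ in s..t, ContinuousLinearMap.adjoint (G (τ - s))
        (R₂ F₁ F₂ F₃ (v τ) - ContinuousLinearMap.adjoint (R₁ B F₂ F₃) (η τ))

/-- The set `L⁺_b` of initial data `(v₀, η₀)` of bounded solutions on `[0, ∞)` of the Hamiltonian
system. -/
def stableSubspace (G : ℝ → H →L[ℝ] H) (B : U →L[ℝ] H)
    (F₁ : H →L[ℝ] H) (F₂ : H →L[ℝ] U) (F₃ : U ≃L[ℝ] U) : Set (H × H) :=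
  {z | ∃ v η : ℝ → H, IsHamiltonianSolution G B F₁ F₂ F₃ v η ∧ v 0 = z.1 ∧ η 0 = z.2 ∧
    ∃ C : ℝ, ∀ t : ℝ, 0 ≤ t → ‖v t‖ ≤ C ∧ ‖η t‖ ≤ C}

/-- Lebesgue measure on `(0, ∞)`. -/
abbrev halfLine : Measure ℝ := volume.restrict (Ioi 0)

/-- The set `M_{v₀}` of processes through `v₀`: pairs
`(v, ξ) ∈ L₂(0, ∞; H) × L₂(0, ∞; U)` such that `v` is the mild solution of
`v' = A v + B ξ`, `v(0) = v₀`. -/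
def processes (G : ℝ → H →L[ℝ] H) (B : U →L[ℝ] H) (v₀ : H) :
    Set (Lp H 2 halfLine × Lp U 2 halfLine) :=
  {p | ∀ᵐ t ∂halfLine, p.1 t = G t v₀ + ∫ s in (0 : ℝ)..t, G (t - s) (B (p.2 s))}

/-- The integral quadratic functional `J_F(v, ξ) = ∫₀^∞ F(v(t), ξ(t)) dt`. -/
def costFunctional (F₁ : H →L[ℝ] H) (F₂ : H →L[ℝ] U) (F₃ : U ≃L[ℝ] U)
    (p : Lp H 2 halfLine × Lp U 2 halfLine) : ℝ :=
  ∫ t, quadForm F₁ F₂ F₃ (p.1 t) (p.2 t) ∂halfLine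

/-- The feedback operator `K = -F₃⁻¹ F₂ - F₃⁻¹ B* P`. -/
def feedback (B : U →L[ℝ] H) (F₂ : H →L[ℝ] U) (F₃ : U ≃L[ℝ] U) (P : H →L[ℝ] H) : H →L[ℝ] U :=
  -((F₃.symm : U →L[ℝ] U) ∘L F₂) -
    (F₃.symm : U →L[ℝ] U) ∘L ContinuousLinearMap.adjoint B ∘L P

/-- `v` (on `[0, T]`) is the mild solution of `v' = A v + B ξ`, with `v ∈ L₂(0, T; H)` and
`ξ ∈ L₂(0, T; U)`. -/
structure IsControlledOn (G : ℝ → H →L[ℝ] H) (B : U →L[ℝ] H) (T : ℝ)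
    (v : ℝ → H) (ξ : ℝ → U) : Prop where
  memLp_v : MemLp v 2 (volume.restrict (Ioc 0 T))
  memLp_ξ : MemLp ξ 2 (volume.restrict (Ioc 0 T))
  cauchy : ∀ t ∈ Icc (0 : ℝ) T, v t = G t (v 0) + ∫ s in (0 : ℝ)..t, G (t - s) (B (ξ s))

end

end QuadraticRegulator

set_option linter.unusedSectionVars false

/-! On the Fourier side a trajectory with zero initial state is `v̂ = -(A - iω)⁻¹ B ξ̂`, so by
Plancherel the frequency condition makes the cost coercive in the control. The dichotomy bounds the
resolvent uniformly on the imaginary axis (`exists_resolvent_bound`); this controls `v` as well, and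
allows forcing terms (`FrequencyCondition.robust`). A nonzero initial state is traded for a forcing,
and the result is `δ ‖(v, ξ)‖² ≤ J(v, ξ) + C |v₀|²` (`FrequencyCondition.coercive`). All this is
first done with a weight `exp (-a t)`, with constants independent of small `a > 0`: the Fourier
integrals then converge, the induced shift of `A` by `a` is a small forcing, and functions not yet
known to be square integrable are admitted.

The Hamiltonian system is the Euler-Lagrange system of the cost: with `ξ = F₃⁻¹ (B* η - F₂ v)`, the
derivative of `⟨η, w⟩` along any controlled trajectory `(w, ζ)` is the polarized form of `(v, ξ)`
and `(w, ζ)`. For a bounded solution, `⟨η, v⟩` is thus a bounded primitive of `F(v, ξ)`, so the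
Laplace transform of `F(v, ξ)` stays bounded as `a → 0`, and weighted coercivity forces `v, ξ ∈ L₂`
(`IsHamiltonianSolution.memLp`). Time shifts preserve the set of bounded solutions, so `η = -P v`
for all times and `ξ = K v`. Integrating the pairing to infinity shows that the polarized cost of
`(v, ξ)` against a process from `y` is `⟨P x, y⟩` (`exists_stationary_process`). It vanishes for `y
= 0`, so `(v, ξ)` is stationary; coercivity makes it the unique minimizer, of cost `⟨x, P x⟩`.

For the second claim subtract `(δ / 2) (|v|² + |ξ|²)` from the form. The cost remains coercive on
processes from `0`, and its infimum over the processes from `x` is a bounded quadratic form in `x`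
(Lax-Milgram, `exists_fiberwise_infimum`); the optimal processes of the first claim supply the
bounded linear section this needs. Continuing a trajectory on `[0, T]` by a nearly optimal process
from `v(T)` shows that the infimum at `v(0)` is at most the cost on `[0, T]` plus the infimum at
`v(T)`. This is the dissipation inequality. -/

namespace QuadraticRegulator

noncomputable section

variable {H U : Type*} [NormedAddCommGroup H] [InnerProductSpace ℝ H] [CompleteSpace H]
  [NormedAddCommGroup U] [InnerProductSpace ℝ U] [CompleteSpace U]
  {G : ℝ → H →L[ℝ] H}

/-! ### Boundedness and joint continuity of a `C₀`-semigroup. -/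

namespace IsC0Semigroup

/-- A `C₀`-semigroup is bounded near zero. -/
theorem exists_norm_le_near_zero (hG : IsC0Semigroup G) :
    ∃ h M : ℝ, 0 < h ∧ ∀ t ∈ Icc 0 h, ‖G t‖ ≤ M := by
  by_contra! hcon
  have hex : ∀ n : ℕ, ∃ t ∈ Icc (0 : ℝ) (1 / ((n : ℝ) + 1)), (n : ℝ) + 1 < ‖G t‖ := fun n =>
    hcon _ _ (by positivity)
  choose t ht hbig using hex
  have hone : ‖G 0‖ ≤ 1 := by rw [hG.map_zero]; exact ContinuousLinearMap.norm_id_le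
  -- The time `0` is excluded because `‖G 0‖ ≤ 1`; strict positivity lets strong continuity from the
  -- right apply along `t n`.
  have hpos : ∀ n, 0 < t n := by
    intro n
    rcases (ht n).1.eq_or_lt with h | h
    · have := hbig n
      rw [← h] at this
      have : (0 : ℝ) ≤ n := n.cast_nonneg
      linarith
    · exact h
  have hlim : Tendsto t atTop (𝓝[>] 0) := by
    refine tendsto_nhdsWithin_iff.2 ⟨?_, Eventually.of_forall hpos⟩
    exact squeeze_zero (fun n => (ht n).1) (fun n => (ht n).2) tendsto_one_div_add_atTop_nhds_zero_nat
  -- The orbits `G (t n) x` converge, hence are bounded for each `x`; uniform boundedness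
  -- contradicts `‖G (t n)‖ > n + 1`.
  obtain ⟨C, hC⟩ := banach_steinhaus (g := fun n => G (t n)) (fun x => by
    obtain ⟨C, hC⟩ := (((hG.tendsto_zero x).comp hlim).norm).bddAbove_range
    exact ⟨C, fun n => hC ⟨n, rfl⟩⟩)
  obtain ⟨n, hn⟩ := exists_nat_gt C
  have := hbig n
  have := hC n
  linarith

/-- A `C₀`-semigroup is bounded on bounded time intervals. -/
theorem exists_norm_le (hG : IsC0Semigroup G) (T : ℝ) :
    ∃ M : ℝ, 0 < M ∧ ∀ t ∈ Icc 0 T, ‖G t‖ ≤ M := by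
  obtain ⟨h, M, hh, hM⟩ := hG.exists_norm_le_near_zero
  have hM0 : 0 ≤ M := (norm_nonneg _).trans (hM 0 ⟨le_rfl, hh.le⟩)
  have key : ∀ n : ℕ, ∃ K : ℝ, 0 < K ∧ ∀ t ∈ Icc (0 : ℝ) (n * h), ‖G t‖ ≤ K := by
    intro n
    induction n with
    | zero =>
      refine ⟨M + 1, by linarith, fun t ht => ?_⟩
      simp only [Nat.cast_zero, zero_mul] at ht
      have := hM t ⟨ht.1, ht.2.trans hh.le⟩
      linarith
    | succ n ih =>
      obtain ⟨K, hK, hb⟩ := ih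
      refine ⟨max K (M * K), lt_max_of_lt_left hK, fun t ht => ?_⟩
      rcases le_total t (n * h) with h1 | h1
      · exact (hb t ⟨ht.1, h1⟩).trans (le_max_left _ _)
      · have h2 : t - n * h ∈ Icc 0 h := by
          have := ht.2
          push_cast at this
          constructor <;> linarith
        have h3 : (0 : ℝ) ≤ n * h := by positivity
        have : G t = (G (t - n * h)).comp (G (n * h)) := by
          rw [← hG.map_add _ _ h2.1 h3]; ring_nf
        rw [this]
        refine (ContinuousLinearMap.opNorm_comp_le _ _).trans (le_trans ?_ (le_max_right _ _))
        exact mul_le_mul (hM _ h2) (hb _ ⟨h3, le_rfl⟩) (norm_nonneg _) hM0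
  obtain ⟨n, hn⟩ := exists_nat_gt (T / h)
  obtain ⟨K, hK, hb⟩ := key n
  refine ⟨K, hK, fun t ht => hb t ⟨ht.1, ht.2.trans ?_⟩⟩
  rw [div_lt_iff₀ hh] at hn
  exact hn.le

theorem map_add_apply (hG : IsC0Semigroup G) {s t : ℝ} (hs : 0 ≤ s) (ht : 0 ≤ t) (x : H) :
    G (s + t) x = G s (G t x) := by
  rw [hG.map_add s t hs ht]; rfl

theorem map_zero_apply (hG : IsC0Semigroup G) (x : H) : G 0 x = x := by
  rw [hG.map_zero]; rfl

theorem tendsto_zero_Ici (hG : IsC0Semigroup G) (x : H) :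
    Tendsto (fun t => G t x) (𝓝[≥] 0) (𝓝 x) := by
  rw [← Ioi_insert, nhdsWithin_insert, tendsto_sup]
  refine ⟨?_, hG.tendsto_zero x⟩
  rw [tendsto_pure_left]
  intro s hs
  rw [hG.map_zero_apply]
  exact mem_of_mem_nhds hs

/-- The semigroup extended to negative times by the identity, as a function of time and state,
is continuous. -/
theorem continuous_max (hG : IsC0Semigroup G) : Continuous (fun p : ℝ × H => G (max p.1 0) p.2) := by
  -- Since `G t x - G s x = G s (G (t - s) x - x)` for `s ≤ t`, continuity at zero governs
  -- continuity at every time.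
  have hstep : ∀ T : ℝ, ∃ M : ℝ, 0 < M ∧ ∀ s t : ℝ, 0 ≤ s → 0 ≤ t → s ≤ T → t ≤ T → ∀ x : H,
      ‖G t x - G s x‖ ≤ M * ‖G |t - s| x - x‖ := by
    intro T
    obtain ⟨M, hM, hb⟩ := hG.exists_norm_le T
    refine ⟨M, hM, ?_⟩
    have aux : ∀ s t : ℝ, 0 ≤ s → s ≤ t → t ≤ T → ∀ x : H,
        ‖G t x - G s x‖ ≤ M * ‖G |t - s| x - x‖ := by
      intro s t hs hst htT x
      have h1 : G t x = G s (G |t - s| x) := by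
        rw [abs_of_nonneg (sub_nonneg.2 hst), ← hG.map_add_apply hs (sub_nonneg.2 hst)]
        congr 2; ring
      rw [h1, ← map_sub]
      exact (G s).le_of_opNorm_le (hb s ⟨hs, hst.trans htT⟩) _
    intro s t hs ht hsT htT x
    rcases le_total s t with h | h
    · exact aux s t hs h htT x
    · rw [norm_sub_rev, abs_sub_comm]
      exact aux t s ht h hsT x
  rw [continuous_iff_continuousAt]
  rintro ⟨t₀, x₀⟩
  obtain ⟨M, hM, hb⟩ := hG.exists_norm_le (max t₀ 0 + 1)
  obtain ⟨M', hM', hb'⟩ := hstep (max t₀ 0 + 1)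
  rw [ContinuousAt, tendsto_iff_norm_sub_tendsto_zero]
  have hlim : Tendsto (fun p : ℝ × H => M * ‖p.2 - x₀‖ +
      M' * ‖G |max p.1 0 - max t₀ 0| x₀ - x₀‖) (𝓝 (t₀, x₀)) (𝓝 0) := by
    have h1 : Tendsto (fun p : ℝ × H => M * ‖p.2 - x₀‖) (𝓝 (t₀, x₀)) (𝓝 0) := by
      have : Continuous (fun p : ℝ × H => M * ‖p.2 - x₀‖) := by fun_prop
      simpa using this.tendsto (t₀, x₀)
    have h2 : Tendsto (fun p : ℝ × H => |max p.1 0 - max t₀ 0|) (𝓝 (t₀, x₀)) (𝓝[≥] 0) := by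
      refine tendsto_nhdsWithin_iff.2 ⟨?_, Eventually.of_forall fun p => mem_Ici.2 (abs_nonneg _)⟩
      have : Continuous (fun p : ℝ × H => |max p.1 0 - max t₀ 0|) := by fun_prop
      simpa using this.tendsto (t₀, x₀)
    have h3 := (((hG.tendsto_zero_Ici x₀).comp h2).sub_const x₀).norm.const_mul M'
    simpa using h1.add h3
  refine squeeze_zero' (Eventually.of_forall fun p => norm_nonneg _) ?_ hlim
  have hev : ∀ᶠ p : ℝ × H in 𝓝 (t₀, x₀), max p.1 0 < max t₀ 0 + 1 := by
    have : Continuous (fun p : ℝ × H => max p.1 0) := by fun_prop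
    exact this.tendsto (t₀, x₀) (gt_mem_nhds (lt_add_one _))
  filter_upwards [hev] with p hp
  have hp0 : 0 ≤ max p.1 0 := le_max_right _ _
  calc ‖G (max p.1 0) p.2 - G (max t₀ 0) x₀‖
      = ‖G (max p.1 0) (p.2 - x₀) + (G (max p.1 0) x₀ - G (max t₀ 0) x₀)‖ := by
        rw [map_sub]; congr 1; abel
    _ ≤ _ := (norm_add_le _ _).trans (add_le_add
        ((G _).le_of_opNorm_le (hb _ ⟨hp0, hp.le⟩) _)
        (hb' _ _ (le_max_right _ _) hp0 (by linarith) hp.le _))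

theorem continuous_max_apply (hG : IsC0Semigroup G) (x : H) :
    Continuous (fun t : ℝ => G (max t 0) x) :=
  hG.continuous_max.comp (by fun_prop : Continuous fun t : ℝ => (t, x))

theorem continuousOn_apply (hG : IsC0Semigroup G) (x : H) :
    ContinuousOn (fun t : ℝ => G t x) (Ici 0) :=
  (hG.continuous_max_apply x).continuousOn.congr fun t ht => by
    simp only [max_eq_left (mem_Ici.1 ht)]

theorem intervalIntegrable_smul (hG : IsC0Semigroup G) {c : ℝ → ℝ} (hc : Continuous c)
    {T : ℝ} (hT : 0 ≤ T) (x : H) :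
    IntervalIntegrable (fun s => c s • G s x) volume 0 T := by
  apply ContinuousOn.intervalIntegrable
  rw [uIcc_of_le hT]
  exact hc.continuousOn.smul ((hG.continuousOn_apply x).mono Icc_subset_Ici_self)

/-- `x ↦ ∫₀ᵀ c(s) G(s) x ds` as a bounded operator. -/
def weightedIntegral (hG : IsC0Semigroup G) {c : ℝ → ℝ} (hc : Continuous c)
    {T : ℝ} (hT : 0 ≤ T) : H →L[ℝ] H :=
  LinearMap.mkContinuousOfExistsBound
    { toFun := fun x => ∫ s in (0 : ℝ)..T, c s • G s x
      map_add' := fun x y => by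
        rw [← intervalIntegral.integral_add (hG.intervalIntegrable_smul hc hT x)
          (hG.intervalIntegrable_smul hc hT y)]
        congr 1; ext s; rw [_root_.map_add, smul_add]
      map_smul' := fun r x => by
        rw [RingHom.id_apply, ← intervalIntegral.integral_smul]
        congr 1; ext s; rw [map_smul, smul_comm] }
    (by
      obtain ⟨M, hM, hb⟩ := hG.exists_norm_le T
      obtain ⟨K, hK⟩ := (isCompact_Icc (a := (0 : ℝ)) (b := T)).exists_bound_of_continuousOn
        hc.continuousOn
      have hK0 : 0 ≤ K := (norm_nonneg _).trans (hK 0 ⟨le_rfl, hT⟩)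
      refine ⟨K * M * |T - 0|, fun x => ?_⟩
      have := intervalIntegral.norm_integral_le_of_norm_le_const
        (f := fun s => c s • G s x) (a := 0) (b := T) (C := K * M * ‖x‖) (fun s hs => by
          rw [uIoc_of_le hT] at hs
          rw [norm_smul, mul_assoc]
          exact mul_le_mul (hK s ⟨hs.1.le, hs.2⟩)
            ((G s).le_of_opNorm_le (hb s ⟨hs.1.le, hs.2⟩) x) (norm_nonneg _) hK0)
      calc _ ≤ _ := this
        _ = _ := by ring)

theorem weightedIntegral_apply (hG : IsC0Semigroup G) {c : ℝ → ℝ} (hc : Continuous c)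
    {T : ℝ} (hT : 0 ≤ T) (x : H) :
    hG.weightedIntegral hc hT x = ∫ s in (0 : ℝ)..T, c s • G s x := rfl

theorem norm_weightedIntegral_le (hG : IsC0Semigroup G) {c : ℝ → ℝ} (hc : Continuous c)
    {T : ℝ} (hT : 0 ≤ T) {M : ℝ} (hM : ∀ t ∈ Icc 0 T, ‖G t‖ ≤ M) (h1 : ∀ t, |c t| ≤ 1) (x : H) :
    ‖hG.weightedIntegral hc hT x‖ ≤ M * T * ‖x‖ := by
  have := intervalIntegral.norm_integral_le_of_norm_le_const
    (f := fun s => c s • G s x) (a := 0) (b := T) (C := M * ‖x‖) (fun s hs => by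
      rw [uIoc_of_le hT] at hs
      have hx := (G s).le_of_opNorm_le (hM s ⟨hs.1.le, hs.2⟩) x
      rw [norm_smul, Real.norm_eq_abs]
      calc |c s| * ‖G s x‖ ≤ 1 * ‖G s x‖ := by gcongr; exact h1 s
        _ ≤ _ := by rw [one_mul]; exact hx)
  rw [weightedIntegral_apply]
  calc _ ≤ _ := this
    _ = _ := by rw [sub_zero, abs_of_nonneg hT]; ring

theorem intervalIntegrable_apply (hG : IsC0Semigroup G) {a b : ℝ} (ha : 0 ≤ a) (hb : 0 ≤ b)
    (x : H) : IntervalIntegrable (fun s => G s x) volume a b := by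
  apply ContinuousOn.intervalIntegrable
  exact (hG.continuousOn_apply x).mono fun t ht => (le_min ha hb).trans ht.1

/-! ### The generator in integrated form, and integration by parts. -/

/-- The orbit of `x` is absolutely continuous with density `G(s) y` as soon as its right
derivative at zero is `y`. -/
theorem sub_eq_integral_of_tendsto (hG : IsC0Semigroup G) {x y : H}
    (h : Tendsto (fun t : ℝ => t⁻¹ • (G t x - x)) (𝓝[>] 0) (𝓝 y)) {t : ℝ} (ht : 0 ≤ t) :
    G t x - x = ∫ s in (0 : ℝ)..t, G s y := by
  have hcy := hG.continuous_max_apply y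
  set f : ℝ → H := fun u => G (max u 0) x - ∫ s in (0 : ℝ)..u, G (max s 0) y with hf
  have hint : ∀ u, HasDerivAt (fun u => ∫ s in (0 : ℝ)..u, G (max s 0) y) (G (max u 0) y) u :=
    fun u => hcy.integral_hasStrictDerivAt 0 u |>.hasDerivAt
  have hcont : ContinuousOn f (Icc 0 t) := by
    refine ((hG.continuous_max_apply x).sub ?_).continuousOn
    exact continuous_iff_continuousAt.2 fun u => (hint u).continuousAt
  -- The definition of the generator yields only a right derivative of the orbit; a continuous
  -- function with zero right derivative is still constant.
  have hderiv : ∀ u ∈ Ico 0 t, HasDerivWithinAt f 0 (Ici u) u := by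
    intro u hu
    have h1 : HasDerivWithinAt (fun u => G (max u 0) x) (G u y) (Ici u) u := by
      rw [← hasDerivWithinAt_Ioi_iff_Ici, hasDerivWithinAt_iff_tendsto_slope' self_notMem_Ioi]
      have hsub : Tendsto (fun r : ℝ => r - u) (𝓝[>] u) (𝓝[>] 0) := by
        refine tendsto_nhdsWithin_iff.2 ⟨?_, ?_⟩
        · have : Tendsto (fun r : ℝ => r - u) (𝓝 u) (𝓝 (u - u)) :=
            (continuous_id.sub continuous_const).tendsto u
          rw [sub_self] at this
          exact this.mono_left nhdsWithin_le_nhds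
        · filter_upwards [self_mem_nhdsWithin] with r hr
          exact mem_Ioi.2 (sub_pos.2 (mem_Ioi.1 hr))
      refine (((G u).continuous.tendsto y).comp (h.comp hsub)).congr' ?_
      filter_upwards [self_mem_nhdsWithin] with r hr
      have hr' : u < r := hr
      simp only [Function.comp, slope_def_module, map_smul, map_sub]
      rw [← hG.map_add_apply hu.1 (sub_nonneg.2 hr'.le), max_eq_left hu.1,
        max_eq_left (hu.1.trans hr'.le)]
      congr 3; ring_nf
    have h2 := h1.sub (hint u).hasDerivWithinAt
    rw [max_eq_left hu.1, sub_self] at h2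
    exact h2
  have := constant_of_has_deriv_right_zero hcont hderiv t ⟨ht, le_rfl⟩
  simp only [hf, max_eq_left ht, max_self, hG.map_zero_apply, intervalIntegral.integral_same,
    sub_zero] at this
  rw [intervalIntegral.integral_congr (g := fun s => G (max s 0) y)]
  · nth_rewrite 2 [← this]
    abel
  · intro s hs
    rw [uIcc_of_le ht] at hs
    simp only [max_eq_left hs.1]

/-- The generator in integrated form. -/
theorem mem_graph_iff (hG : IsC0Semigroup G) {A : H →ₗ.[ℝ] H} (hA : IsGenerator A G) (x y : H) :
    (x, y) ∈ A.graph ↔ ∀ t : ℝ, 0 ≤ t → G t x - x = ∫ s in (0 : ℝ)..t, G s y := by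
  rw [hA x y]
  refine ⟨fun h t ht => hG.sub_eq_integral_of_tendsto h ht, fun h => ?_⟩
  have hd : HasDerivAt (fun u => ∫ s in (0 : ℝ)..u, G (max s 0) y) y 0 := by
    have := ((hG.continuous_max_apply y).integral_hasStrictDerivAt 0 0).hasDerivAt
    rwa [max_self, hG.map_zero_apply] at this
  have h1 := (hasDerivWithinAt_iff_tendsto_slope' self_notMem_Ioi).1
    (hd.hasDerivWithinAt (s := Ioi (0 : ℝ)))
  refine h1.congr' ?_
  filter_upwards [self_mem_nhdsWithin] with t ht
  have ht' : (0 : ℝ) ≤ t := le_of_lt ht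
  rw [slope_def_module, intervalIntegral.integral_same, sub_zero, sub_zero, h t ht']
  congr 1
  refine intervalIntegral.integral_congr fun s hs => ?_
  rw [uIcc_of_le ht'] at hs
  simp only [max_eq_left hs.1]

/-- The generator in integrated form, through bounded operators. -/
theorem mem_graph_iff_clm (hG : IsC0Semigroup G) {A : H →ₗ.[ℝ] H} (hA : IsGenerator A G)
    (x y : H) : (x, y) ∈ A.graph ↔ ∀ (t : ℝ) (ht : 0 ≤ t),
      G t x - x = hG.weightedIntegral (continuous_const (y := (1 : ℝ))) ht y := by
  rw [hG.mem_graph_iff hA]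
  simp only [weightedIntegral_apply, one_smul]

/-- The integrated description of the graph consists of linear equations between bounded operators,
and these commute with the Bochner integral. -/
theorem integral_mem_graph (hG : IsC0Semigroup G) {A : H →ₗ.[ℝ] H} (hA : IsGenerator A G)
    {α : Type*} [MeasurableSpace α] {μ : Measure α} {f g : α → H} (hf : Integrable f μ)
    (hg : Integrable g μ) (h : ∀ᵐ a ∂μ, (f a, g a) ∈ A.graph) :
    (∫ a, f a ∂μ, ∫ a, g a ∂μ) ∈ A.graph := by
  rw [hG.mem_graph_iff_clm hA]
  intro t ht
  rw [← ContinuousLinearMap.integral_comp_comm _ hf, ← ContinuousLinearMap.integral_comp_comm _ hg,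
    ← integral_sub ((G t).integrable_comp hf) hf]
  refine integral_congr_ae ?_
  filter_upwards [h] with a ha
  exact (hG.mem_graph_iff_clm hA _ _).1 ha t ht

theorem intervalIntegral_mem_graph (hG : IsC0Semigroup G) {A : H →ₗ.[ℝ] H} (hA : IsGenerator A G)
    {a b : ℝ} (hab : a ≤ b) {f g : ℝ → H} (hf : IntervalIntegrable f volume a b)
    (hg : IntervalIntegrable g volume a b) (h : ∀ s ∈ Ioc a b, (f s, g s) ∈ A.graph) :
    (∫ s in a..b, f s, ∫ s in a..b, g s) ∈ A.graph := by
  rw [intervalIntegral.integral_of_le hab, intervalIntegral.integral_of_le hab]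
  exact hG.integral_mem_graph hA hf.1 hg.1
    ((ae_restrict_iff' measurableSet_Ioc).2 (Eventually.of_forall h))

/-- The generator is closed, because its graph is cut out by equations between bounded operators. -/
theorem mem_graph_of_tendsto (hG : IsC0Semigroup G) {A : H →ₗ.[ℝ] H} (hA : IsGenerator A G)
    {α : Type*} {l : Filter α} [l.NeBot] {f g : α → H} {x y : H} (hf : Tendsto f l (𝓝 x))
    (hg : Tendsto g l (𝓝 y)) (h : ∀ᶠ a in l, (f a, g a) ∈ A.graph) : (x, y) ∈ A.graph := by
  rw [hG.mem_graph_iff_clm hA]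
  intro t ht
  refine tendsto_nhds_unique ((((G t).continuous.tendsto x).comp hf).sub hf)
    ((((hG.weightedIntegral continuous_const ht).continuous.tendsto y).comp hg).congr' ?_)
  filter_upwards [h] with a ha
  exact ((hG.mem_graph_iff_clm hA _ _).1 ha t ht).symm

/-- Shifting the window of integration by `h` changes only its two ends, each of length `h`. This
gives both the generator on time averages and the Lipschitz bound behind the adjoint semigroup. -/
theorem integral_apply_sub (hG : IsC0Semigroup G) {h t : ℝ} (hh : 0 ≤ h) (ht : 0 ≤ t) (x : H) :
    (∫ s in (0 : ℝ)..t, G (h + s) x) - ∫ s in (0 : ℝ)..t, G s x =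
      (∫ s in t..(h + t), G s x) - ∫ s in (0 : ℝ)..h, G s x := by
  rw [intervalIntegral.integral_comp_add_left (fun s => G s x), add_zero]
  exact intervalIntegral.integral_interval_sub_interval_comm'
    (hG.intervalIntegrable_apply hh (add_nonneg hh ht) x) (hG.intervalIntegrable_apply le_rfl ht x)
    (hG.intervalIntegrable_apply hh le_rfl x)

theorem apply_mem_graph (hG : IsC0Semigroup G) {A : H →ₗ.[ℝ] H} (hA : IsGenerator A G)
    {x y : H} (h : (x, y) ∈ A.graph) {t : ℝ} (ht : 0 ≤ t) : (G t x, G t y) ∈ A.graph := by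
  rw [hA] at h ⊢
  refine (((G t).continuous.tendsto y).comp h).congr' ?_
  filter_upwards [self_mem_nhdsWithin] with s hs
  simp only [Function.comp, map_smul, map_sub]
  rw [← hG.map_add_apply ht (le_of_lt hs), ← hG.map_add_apply (le_of_lt hs) ht, add_comm]

theorem integral_mem_graph_self (hG : IsC0Semigroup G) {A : H →ₗ.[ℝ] H} (hA : IsGenerator A G)
    (x : H) {t : ℝ} (ht : 0 ≤ t) : (∫ s in (0 : ℝ)..t, G s x, G t x - x) ∈ A.graph := by
  rw [hG.mem_graph_iff hA]
  intro h hh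
  have e1 : G h (∫ s in (0 : ℝ)..t, G s x) = ∫ s in (0 : ℝ)..t, G (h + s) x := by
    rw [← ContinuousLinearMap.intervalIntegral_comp_comm _
      (hG.intervalIntegrable_apply le_rfl ht x)]
    refine intervalIntegral.integral_congr fun s hs => ?_
    rw [uIcc_of_le ht] at hs
    exact (hG.map_add_apply hh hs.1 x).symm
  have e2 : ∫ s in (0 : ℝ)..h, G s (G t x - x) =
      (∫ s in (0 : ℝ)..h, G (t + s) x) - ∫ s in (0 : ℝ)..h, G s x := by
    rw [← intervalIntegral.integral_sub _ (hG.intervalIntegrable_apply le_rfl hh x)]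
    · refine intervalIntegral.integral_congr fun s hs => ?_
      rw [uIcc_of_le hh] at hs
      simp only [map_sub]
      rw [← hG.map_add_apply hs.1 ht x, add_comm]
    · apply ContinuousOn.intervalIntegrable
      refine (hG.continuousOn_apply x).comp (by fun_prop) fun s hs => ?_
      rw [uIcc_of_le hh] at hs
      exact add_nonneg ht hs.1
  rw [e1, e2, hG.integral_apply_sub hh ht,
    intervalIntegral.integral_comp_add_left (fun s => G s x), add_zero, add_comm t h]

/-- Integration by parts for the orbit of an arbitrary vector. -/
theorem weightedIntegral_mem_graph (hG : IsC0Semigroup G) {A : H →ₗ.[ℝ] H} (hA : IsGenerator A G)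
    {c c' : ℝ → ℝ} (hc : ∀ t, HasDerivAt c (c' t) t) (hc' : Continuous c') (x : H) {T : ℝ}
    (hT : 0 ≤ T) :
    (∫ s in (0 : ℝ)..T, c s • G s x,
      c T • G T x - c 0 • x - ∫ s in (0 : ℝ)..T, c' s • G s x) ∈ A.graph := by
  -- The orbit of `x` may leave the domain, but its primitive `y` stays in it, with `A (y t) = G t x
  -- - x`. Moving the derivative onto the weight expresses the integral through values of `y` only.
  set y : ℝ → H := fun t => ∫ s in (0 : ℝ)..t, G (max s 0) x with hy
  have hyd : ∀ t, HasDerivAt y (G (max t 0) x) t := fun t =>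
    ((hG.continuous_max_apply x).integral_hasStrictDerivAt 0 t).hasDerivAt
  have hycont : Continuous y := continuous_iff_continuousAt.2 fun t => (hyd t).continuousAt
  have hmem : ∀ t, 0 ≤ t → (y t, G t x - x) ∈ A.graph := by
    intro t ht
    have := hG.integral_mem_graph_self hA x ht
    rwa [intervalIntegral.integral_congr (g := fun s => G (max s 0) x)] at this
    intro s hs
    rw [uIcc_of_le ht] at hs
    simp only [max_eq_left hs.1]
  have hcc : Continuous c := continuous_iff_continuousAt.2 fun t => (hc t).continuousAt
  have i1 : IntervalIntegrable (fun s => c' s • y s) volume 0 T :=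
    (hc'.smul hycont).intervalIntegrable _ _
  have i3 := hG.intervalIntegrable_smul hc' hT x
  have i4 : IntervalIntegrable (fun s => c' s • x) volume 0 T :=
    (hc'.smul continuous_const).intervalIntegrable _ _
  have i2 : IntervalIntegrable (fun s => c' s • (G s x - x)) volume 0 T := by
    simp only [smul_sub]
    exact i3.sub i4
  have h1 := hG.intervalIntegral_mem_graph hA hT i1 i2 fun s hs =>
    A.graph.smul_mem (c' s) (hmem s hs.1.le)
  have h2 := A.graph.sub_mem (A.graph.smul_mem (c T) (hmem T hT)) h1
  have parts := intervalIntegral.integral_smul_deriv_eq_deriv_smul (a := 0) (b := T)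
    (fun t _ => hc t) (fun t _ => hyd t) (hc'.intervalIntegrable _ _)
    ((hG.continuous_max_apply x).intervalIntegrable _ _)
  have y0 : y 0 = 0 := by simp [hy]
  rw [y0, smul_zero, sub_zero] at parts
  have e1 : ∫ s in (0 : ℝ)..T, c s • G s x = ∫ s in (0 : ℝ)..T, c s • G (max s 0) x := by
    refine intervalIntegral.integral_congr fun s hs => ?_
    rw [uIcc_of_le hT] at hs
    simp only [max_eq_left hs.1]
  have e2 : ∫ s in (0 : ℝ)..T, c' s • (G s x - x) =
      (∫ s in (0 : ℝ)..T, c' s • G s x) - (c T - c 0) • x := by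
    simp only [smul_sub]
    rw [intervalIntegral.integral_sub i3 i4, intervalIntegral.integral_smul_const,
      intervalIntegral.integral_eq_sub_of_hasDerivAt (fun t _ => hc t)
        (hc'.intervalIntegrable _ _)]
  rw [e1, parts]
  convert h2 using 1
  rw [e2]
  simp only [Prod.smul_mk, Prod.mk_sub_mk, smul_sub, sub_smul]
  congr 1
  abel

/-- Integration by parts for the orbit of a vector in the domain of the generator. -/
theorem weightedIntegral_of_mem_graph (hG : IsC0Semigroup G) {A : H →ₗ.[ℝ] H}
    (hA : IsGenerator A G) {c c' : ℝ → ℝ} (hc : ∀ t, HasDerivAt c (c' t) t) (hc' : Continuous c')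
    {x y : H} (h : (x, y) ∈ A.graph) {T : ℝ} (hT : 0 ≤ T) :
    c T • G T x - c 0 • x - ∫ s in (0 : ℝ)..T, c' s • G s x =
      ∫ s in (0 : ℝ)..T, c s • G s y := by
  have hcc : Continuous c := continuous_iff_continuousAt.2 fun t => (hc t).continuousAt
  -- The value of `A` at `∫ c(s) G(s) x ds` is computed in two ways: by parts, and by taking `A`
  -- inside the integral. As `A` is single-valued, the results agree.
  refine A.mem_graph_snd_inj (hG.weightedIntegral_mem_graph hA hc hc' x hT) (?_ : _ ∈ A.graph) rfl
  exact hG.intervalIntegral_mem_graph hA hT (hG.intervalIntegrable_smul hcc hT x)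
    (hG.intervalIntegrable_smul hcc hT y) fun s hs =>
      A.graph.smul_mem (c s) (hG.apply_mem_graph hA h hs.1.le)

/-! ### The adjoint semigroup. -/

/-- The subspace of strong continuity of the adjoint semigroup. -/
theorem tendsto_adjoint_of_mem_closure (hG : IsC0Semigroup G) {S : Submodule ℝ H}
    (hS : ∀ y ∈ S, Tendsto (fun t : ℝ => ContinuousLinearMap.adjoint (G t) y) (𝓝[>] 0) (𝓝 y))
    {y : H} (hy : y ∈ S.topologicalClosure) :
    Tendsto (fun t : ℝ => ContinuousLinearMap.adjoint (G t) y) (𝓝[>] 0) (𝓝 y) := by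
  obtain ⟨M, hM, hb⟩ := hG.exists_norm_le 1
  rw [Metric.tendsto_nhds]
  intro ε hε
  have hδ : 0 < ε / (2 * (M + 1)) := by positivity
  obtain ⟨z, hz, hyz⟩ := Metric.mem_closure_iff.1 hy _ hδ
  have h1 := Metric.tendsto_nhds.1 (hS z hz) (ε / 2) (by positivity)
  have h2 : ∀ᶠ t : ℝ in 𝓝[>] 0, t ∈ Ioc (0 : ℝ) 1 := Ioc_mem_nhdsGT one_pos
  filter_upwards [h1, h2] with t ht1 ht2
  rw [dist_eq_norm] at ht1 hyz ⊢
  have h3 : ‖ContinuousLinearMap.adjoint (G t) (y - z)‖ ≤ M * ‖y - z‖ :=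
    (ContinuousLinearMap.adjoint (G t)).le_of_opNorm_le
      (by rw [LinearIsometryEquiv.norm_map]; exact hb t ⟨ht2.1.le, ht2.2⟩) _
  have h4 : ContinuousLinearMap.adjoint (G t) y - y =
      ContinuousLinearMap.adjoint (G t) (y - z) + (ContinuousLinearMap.adjoint (G t) z - z)
        - (y - z) := by
    rw [map_sub]; abel
  rw [h4]
  calc _ ≤ ‖ContinuousLinearMap.adjoint (G t) (y - z)‖ +
        ‖ContinuousLinearMap.adjoint (G t) z - z‖ + ‖y - z‖ :=
        (norm_sub_le _ _).trans (by gcongr; exact norm_add_le _ _)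
    _ < M * (ε / (2 * (M + 1))) + ε / 2 + ε / (2 * (M + 1)) := by
        have : M * ‖y - z‖ ≤ M * (ε / (2 * (M + 1))) := by gcongr
        linarith
    _ = ε := by field_simp; ring

/-- The adjoint semigroup of a `C₀`-semigroup in a Hilbert space is a `C₀`-semigroup. -/
theorem adjoint (hG : IsC0Semigroup G) :
    IsC0Semigroup (fun t => ContinuousLinearMap.adjoint (G t)) where
  map_zero := by rw [hG.map_zero]; exact ContinuousLinearMap.adjoint_id
  map_add s t hs ht := by
    rw [add_comm, hG.map_add t s ht hs, ContinuousLinearMap.adjoint_comp]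
  tendsto_zero := by
    have hone : Continuous fun _ : ℝ => (1 : ℝ) := continuous_const
    -- `S` is spanned by the ranges of `W*`, where `W = ∫₀ʰ G`. It is dense, for a vector orthogonal
    -- to it has `∫₀ʰ G(s) z ds = 0` for every `h`, and differentiating at `h = 0` gives `z = 0`.
    set S : Submodule ℝ H := ⨆ h : Ici (0 : ℝ),
      LinearMap.range (ContinuousLinearMap.adjoint (hG.weightedIntegral hone h.2) : H →ₗ[ℝ] H)
    have hS : S.topologicalClosure = ⊤ := by
      rw [Submodule.topologicalClosure_eq_top_iff, Submodule.eq_bot_iff]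
      intro z hz
      have hzero : ∀ h : ℝ, 0 ≤ h → ∫ s in (0 : ℝ)..h, G s z = 0 := by
        intro h hh
        refine ext_inner_right ℝ fun y => ?_
        have := (Submodule.mem_orthogonal' _ _).1 hz
          (ContinuousLinearMap.adjoint (hG.weightedIntegral hone hh) y)
          (Submodule.mem_iSup_of_mem (⟨h, hh⟩ : Ici (0 : ℝ)) ⟨y, rfl⟩)
        rw [ContinuousLinearMap.adjoint_inner_right, weightedIntegral_apply] at this
        simpa using this
      have hd := ((hG.continuous_max_apply z).integral_hasStrictDerivAt 0 0).hasDerivAt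
      have hd0 : HasDerivWithinAt (fun u => ∫ s in (0 : ℝ)..u, G (max s 0) z) 0 (Ici 0) 0 := by
        refine (hasDerivWithinAt_const (0 : ℝ) (Ici 0) (0 : H)).congr (fun u hu => ?_) (by simp)
        rw [← hzero u hu]
        refine intervalIntegral.integral_congr fun s hs => ?_
        rw [uIcc_of_le hu] at hs
        simp only [max_eq_left hs.1]
      have := (uniqueDiffWithinAt_Ici (0 : ℝ)).eq_deriv _ (hd.hasDerivWithinAt) hd0
      rwa [max_self, hG.map_zero_apply] at this
    have hmem : ∀ y ∈ S, Tendsto (fun t : ℝ => ContinuousLinearMap.adjoint (G t) y)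
        (𝓝[>] 0) (𝓝 y) := by
      intro y hy
      induction hy using Submodule.iSup_induction' with
      | zero => simp
      | add x y _ _ hx hy => simpa only [_root_.map_add] using hx.add hy
      | mem h y hy =>
        obtain ⟨y, rfl⟩ := hy
        have hh : (0 : ℝ) ≤ h := h.2
        set W := hG.weightedIntegral hone hh
        obtain ⟨M, hM, hb⟩ := hG.exists_norm_le (h + 1)
        -- An operator-norm bound is needed, since only the norm passes to the adjoint `G(t)* W* -
        -- W*`.
        have hbound : ∀ t ∈ Ioc (0 : ℝ) 1, ‖W ∘L G t - W‖ ≤ 2 * M * t := by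
          intro t ht
          refine ContinuousLinearMap.opNorm_le_bound _ (by have := ht.1; positivity) fun x => ?_
          have e : (W ∘L G t - W) x =
              (∫ s in (h : ℝ)..(t + h), G s x) - ∫ s in (0 : ℝ)..t, G s x := by
            rw [← hG.integral_apply_sub ht.1.le hh]
            simp only [sub_apply, ContinuousLinearMap.comp_apply, W,
              weightedIntegral_apply, one_smul]
            congr 1
            refine intervalIntegral.integral_congr fun s hs => ?_
            rw [uIcc_of_le hh] at hs
            rw [← hG.map_add_apply hs.1 ht.1.le, add_comm]
          have b : ∀ u v : ℝ, 0 ≤ u → u ≤ v → v ≤ h + 1 →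
              ‖∫ s in u..v, G s x‖ ≤ M * ‖x‖ * (v - u) := by
            intro u v hu huv hv
            have := intervalIntegral.norm_integral_le_of_norm_le_const
              (f := fun s => G s x) (a := u) (b := v) (C := M * ‖x‖) (fun s hs => by
                rw [uIoc_of_le huv] at hs
                exact (G s).le_of_opNorm_le (hb s ⟨hu.trans hs.1.le, hs.2.trans hv⟩) x)
            rwa [abs_of_nonneg (sub_nonneg.2 huv)] at this
          rw [e]
          refine (norm_sub_le _ _).trans ?_
          have b1 := b h (t + h) hh (by linarith [ht.1]) (by linarith [ht.2])
          have b2 := b 0 t le_rfl ht.1.le (by linarith [ht.2])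
          calc _ ≤ _ := add_le_add b1 b2
            _ = _ := by ring
        rw [tendsto_iff_norm_sub_tendsto_zero]
        have hlim : Tendsto (fun t : ℝ => 2 * M * t * ‖y‖) (𝓝[>] 0) (𝓝 0) := by
          have : Continuous fun t : ℝ => 2 * M * t * ‖y‖ := by fun_prop
          simpa using (this.tendsto 0).mono_left nhdsWithin_le_nhds
        refine squeeze_zero' (Eventually.of_forall fun t => norm_nonneg _) ?_ hlim
        filter_upwards [Ioc_mem_nhdsGT one_pos] with t ht
        have e : ContinuousLinearMap.adjoint (G t) (ContinuousLinearMap.adjoint W y) -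
            ContinuousLinearMap.adjoint W y = ContinuousLinearMap.adjoint (W ∘L G t - W) y := by
          rw [map_sub, ContinuousLinearMap.adjoint_comp]; rfl
        change ‖ContinuousLinearMap.adjoint (G t) (ContinuousLinearMap.adjoint W y) -
            ContinuousLinearMap.adjoint W y‖ ≤ _
        rw [e]
        exact (ContinuousLinearMap.adjoint (W ∘L G t - W)).le_of_opNorm_le
          (by rw [LinearIsometryEquiv.norm_map]; exact hbound t ht) _
    intro y
    exact hG.tendsto_adjoint_of_mem_closure hmem (hS ▸ Submodule.mem_top)

end IsC0Semigroup
-- The resolvent of the generator on the imaginary axis, by real pairs.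
/-- The operator `exp (-iθ) g` on the complexification, with `c = cos θ`, `s = sin θ`. -/
def rotated (g : H →L[ℝ] H) (c s : ℝ) : H × H →L[ℝ] H × H :=
  ((c • g).comp (ContinuousLinearMap.fst ℝ H H) + (s • g).comp (ContinuousLinearMap.snd ℝ H H)).prod
    ((c • g).comp (ContinuousLinearMap.snd ℝ H H) - (s • g).comp (ContinuousLinearMap.fst ℝ H H))

theorem rotated_apply (g : H →L[ℝ] H) (c s : ℝ) (z : H × H) :
    rotated g c s z = (c • g z.1 + s • g z.2, c • g z.2 - s • g z.1) := rfl

/-- The product carries the sup norm, for which a rotation is not isometric: each direction loses a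
factor `2`. The thresholds `1 / 4` and `4` used below leave room for it. -/
theorem norm_rotated_le (g : H →L[ℝ] H) {c s : ℝ} (hc : |c| ≤ 1) (hs : |s| ≤ 1) {z : H × H}
    {r : ℝ} (h1 : ‖g z.1‖ ≤ r) (h2 : ‖g z.2‖ ≤ r) : ‖rotated g c s z‖ ≤ 2 * r := by
  have aux : ∀ (a : ℝ) (y : H), |a| ≤ 1 → ‖y‖ ≤ r → ‖a • y‖ ≤ r := fun a y ha hy => by
    rw [norm_smul, Real.norm_eq_abs]
    exact (mul_le_of_le_one_left (norm_nonneg _) ha).trans hy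
  rw [rotated_apply, Prod.norm_def]
  refine max_le ((norm_add_le _ _).trans ?_) ((norm_sub_le _ _).trans ?_)
  · linarith [aux c _ hc h1, aux s _ hs h2]
  · linarith [aux c _ hc h2, aux s _ hs h1]

theorem le_norm_rotated (g : H →L[ℝ] H) {c s : ℝ} (hcs : c ^ 2 + s ^ 2 = 1) (z : H × H) :
    ‖g z.1‖ ≤ 2 * ‖rotated g c s z‖ ∧ ‖g z.2‖ ≤ 2 * ‖rotated g c s z‖ := by
  have hc : |c| ≤ 1 := abs_le_one_iff_mul_self_le_one.2 (by nlinarith)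
  have hs : |s| ≤ 1 := abs_le_one_iff_mul_self_le_one.2 (by nlinarith)
  set w := rotated g c s z
  have aux : ∀ (a : ℝ) (y : H), |a| ≤ 1 → ‖y‖ ≤ ‖w‖ → ‖a • y‖ ≤ ‖w‖ := fun a y ha hy => by
    rw [norm_smul, Real.norm_eq_abs]
    exact (mul_le_of_le_one_left (norm_nonneg _) ha).trans hy
  have e1 : g z.1 = c • w.1 - s • w.2 := by
    have : c • w.1 - s • w.2 = (c ^ 2 + s ^ 2) • g z.1 := by
      simp only [w, rotated_apply]; module
    rw [this, hcs, one_smul]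
  have e2 : g z.2 = s • w.1 + c • w.2 := by
    have : s • w.1 + c • w.2 = (c ^ 2 + s ^ 2) • g z.2 := by
      simp only [w, rotated_apply]; module
    rw [this, hcs, one_smul]
  rw [e1, e2]
  refine ⟨(norm_sub_le _ _).trans ?_, (norm_add_le _ _).trans ?_⟩
  · linarith [aux c _ hc (norm_fst_le w), aux s _ hs (norm_snd_le w)]
  · linarith [aux s _ hs (norm_fst_le w), aux c _ hc (norm_snd_le w)]

/-- If `g` is a contraction on `ker p` and an expansion on the finite-dimensional `range p`, then
`exp (-iθ) g - 1` is boundedly invertible, uniformly in `θ`. -/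
theorem rotated_sub_one_invertible {g p : H →L[ℝ] H} (hp : p.comp p = p)
    (hfin : FiniteDimensional ℝ (LinearMap.range (p : H →ₗ[ℝ] H))) (hpg : p.comp g = g.comp p)
    (hst : ∀ z, ‖g (z - p z)‖ ≤ 1 / 4 * ‖z‖) (hun : ∀ z, p z = z → 4 * ‖z‖ ≤ ‖g z‖)
    {c s : ℝ} (hcs : c ^ 2 + s ^ 2 = 1) :
    (∀ z, ‖z‖ ≤ (3 * ‖p‖ + 2) * ‖rotated g c s z - z‖) ∧
      ∀ x, ∃ z, rotated g c s z - z = x := by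
  have hc : |c| ≤ 1 := abs_le_one_iff_mul_self_le_one.2 (by nlinarith)
  have hs : |s| ≤ 1 := abs_le_one_iff_mul_self_le_one.2 (by nlinarith)
  set R := rotated g c s with hR
  set Q : H × H →L[ℝ] H × H := p.prodMap p with hQ
  have hQa : ∀ z, Q z = (p z.1, p z.2) := fun _ => rfl
  have hpp : ∀ z, p (p z) = p z := fun z => DFunLike.congr_fun hp z
  have hpg' : ∀ z, p (g z) = g (p z) := fun z => DFunLike.congr_fun hpg z
  have hQQ : ∀ z, Q (Q z) = Q z := fun z => by
    simp only [hQa, hpp]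
  have hQR : ∀ z, Q (R z) = R (Q z) := fun z => by
    simp only [hQa, hR, rotated_apply, map_add, map_sub, map_smul, hpg']
  have hQn : ∀ z, ‖Q z‖ ≤ ‖p‖ * ‖z‖ := fun z => by
    rw [hQa, Prod.norm_def]
    refine max_le ?_ ?_
    · exact (p.le_opNorm _).trans (by gcongr; exact norm_fst_le z)
    · exact (p.le_opNorm _).trans (by gcongr; exact norm_snd_le z)
  have hstab : ∀ z, ‖R (z - Q z)‖ ≤ 1 / 2 * ‖z‖ := by
    intro z
    have := norm_rotated_le g hc hs (z := z - Q z) (r := 1 / 4 * ‖z‖)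
      ((hst z.1).trans (by gcongr; exact norm_fst_le z))
      ((hst z.2).trans (by gcongr; exact norm_snd_le z))
    linarith
  have hstab' : ∀ z, Q z = 0 → ‖z‖ ≤ 2 * ‖R z - z‖ := by
    intro z hz
    have h1 := hstab z
    rw [hz, sub_zero] at h1
    have h2 := norm_sub_norm_le z (R z)
    rw [norm_sub_rev] at h2
    linarith
  have hunst : ∀ z, Q z = z → ‖z‖ ≤ ‖R z - z‖ := by
    intro z hz
    have h := le_norm_rotated g hcs z
    have z1 := hun z.1 (congrArg Prod.fst hz)
    have z2 := hun z.2 (congrArg Prod.snd hz)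
    have : ‖z‖ ≤ ‖R z‖ / 2 := by
      rw [Prod.norm_def]; exact max_le (by linarith [h.1]) (by linarith [h.2])
    have h2 := norm_sub_norm_le (R z) z
    linarith
  refine ⟨fun z => ?_, fun x => ?_⟩
  -- With `r = ‖R z - z‖`, the unstable part is at most `‖p‖ r` and the stable part at most `2 (1 +
  -- ‖p‖) r`; the sum is `(3 ‖p‖ + 2) r`.
  · have h1 := hunst (Q z) (hQQ z)
    have h2 := hstab' (z - Q z) (by rw [map_sub, hQQ, sub_self])
    have e1 : R (Q z) - Q z = Q (R z - z) := by rw [map_sub, hQR]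
    have e2 : R (z - Q z) - (z - Q z) = (R z - z) - Q (R z - z) := by
      rw [map_sub, map_sub, hQR]; abel
    rw [e1] at h1
    rw [e2] at h2
    have h3 := hQn (R z - z)
    have h4 := norm_sub_le (R z - z) (Q (R z - z))
    have h5 := norm_add_le (Q z) (z - Q z)
    rw [add_sub_cancel] at h5
    linarith
  · have hstable : ∃ z, R z - z = x - Q x := by
      -- On the stable part `R` has norm at most `1 / 2`, so a Neumann series inverts `1 - N`;
      -- applying `Q` to the equation shows that the solution lies in `ker Q`, where `N` is `R`.
      set N : H × H →L[ℝ] H × H := R ∘L (1 - Q)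
      have hN : ‖N‖ < 1 := lt_of_le_of_lt
        (ContinuousLinearMap.opNorm_le_bound _ (by norm_num) hstab) (by norm_num : (1 / 2 : ℝ) < 1)
      obtain ⟨u, hu⟩ := isUnit_one_sub_of_norm_lt_one (R := H × H →L[ℝ] H × H) hN
      set z := (↑u⁻¹ : H × H →L[ℝ] H × H) (-(x - Q x))
      have hz : z - R (z - Q z) = -(x - Q x) := by
        have : (u : H × H →L[ℝ] H × H) ((↑u⁻¹ : H × H →L[ℝ] H × H) (-(x - Q x))) =
            -(x - Q x) := by
          rw [← mul_apply_eq_comp, Units.mul_inv]; rfl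
        rw [hu] at this
        exact this
      have hQz : Q z = 0 := by
        have := congrArg Q hz
        rwa [map_sub, hQR, map_sub, hQQ, sub_self, map_zero, sub_zero, map_neg, map_sub, hQQ,
          sub_self, neg_zero] at this
      refine ⟨z, ?_⟩
      rw [hQz, sub_zero] at hz
      rw [← neg_sub, hz, neg_neg]
    have hunstable : ∃ z, R z - z = Q x := by
      -- On the unstable part `R - 1` is injective by expansion, and finite dimension turns this
      -- into surjectivity without constructing a backward semigroup.
      set W := LinearMap.range (Q : H × H →ₗ[ℝ] H × H)
      have hWfin : FiniteDimensional ℝ W := by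
        have : W = (LinearMap.range (p : H →ₗ[ℝ] H)).prod (LinearMap.range (p : H →ₗ[ℝ] H)) :=
          LinearMap.range_prodMap _ _
        rw [this]
        exact Module.Finite.iff_fg.2 ((Module.Finite.iff_fg.1 hfin).prod (Module.Finite.iff_fg.1 hfin))
      have hmap : ∀ z ∈ W, ((R - 1 : H × H →L[ℝ] H × H) : H × H →ₗ[ℝ] H × H) z ∈ W := by
        rintro _ ⟨z, rfl⟩
        refine ⟨R z - z, ?_⟩
        change Q (R z - z) = R (Q z) - Q z
        rw [map_sub, hQR]
      set f := LinearMap.restrict _ hmap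
      have hinj : Function.Injective f := by
        rw [injective_iff_map_eq_zero]
        rintro ⟨_, ⟨z, rfl⟩⟩ hz
        have hz' : R (Q z) - Q z = 0 := congrArg Subtype.val hz
        have := hunst (Q z) (hQQ z)
        rw [hz', norm_zero] at this
        exact Subtype.ext (norm_le_zero_iff.1 this)
      obtain ⟨z, hz⟩ := LinearMap.injective_iff_surjective.1 hinj ⟨Q x, ⟨x, rfl⟩⟩
      exact ⟨z, congrArg Subtype.val hz⟩
    obtain ⟨z1, h1⟩ := hstable
    obtain ⟨z2, h2⟩ := hunstable
    refine ⟨z1 + z2, ?_⟩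
    rw [map_add, add_sub_add_comm, h1, h2, sub_add_cancel]

/-- Under an exponential dichotomy, some time-`T` operator of the semigroup contracts the stable
part and expands the unstable part by the factor `4`. -/
theorem HasExponentialDichotomy.exists_time {j : ℕ}
    (hd : HasExponentialDichotomy G j) :
    ∃ (p : H →L[ℝ] H) (T : ℝ), 0 ≤ T ∧ p.comp p = p ∧
      FiniteDimensional ℝ (LinearMap.range (p : H →ₗ[ℝ] H)) ∧ p.comp (G T) = (G T).comp p ∧
      (∀ z, ‖G T (z - p z)‖ ≤ 1 / 4 * ‖z‖) ∧ ∀ z, p z = z → 4 * ‖z‖ ≤ ‖G T z‖ := by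
  obtain ⟨p, hp, hfin, -, hcomm, ε, M, hε, hM, hs, hu⟩ := hd
  have hlim : Tendsto (fun t : ℝ => M * Real.exp (-ε * t)) atTop (𝓝 (M * 0)) := by
    refine (Real.tendsto_exp_neg_atTop_nhds_zero.comp
      (tendsto_id.const_mul_atTop hε)).const_mul M |>.congr fun t => ?_
    simp [neg_mul]
  rw [mul_zero] at hlim
  have hpos : (0 : ℝ) < 1 / (4 * (1 + ‖p‖)) := by positivity
  obtain ⟨T, hT, hT0⟩ := ((hlim.eventually (gt_mem_nhds hpos)).and (eventually_ge_atTop 0)).exists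
  have hpp : ∀ z, p (p z) = p z := fun z => DFunLike.congr_fun hp z
  refine ⟨p, T, hT0, hp, hfin, hcomm T hT0, fun z => ?_, fun z hz => ?_⟩
  · refine (hs T hT0 (z - p z) (by rw [map_sub, hpp, sub_self])).trans ?_
    have h1 : ‖z - p z‖ ≤ (1 + ‖p‖) * ‖z‖ := by
      refine (norm_sub_le _ _).trans ?_
      have := p.le_opNorm z
      linarith
    calc _ ≤ 1 / (4 * (1 + ‖p‖)) * ((1 + ‖p‖) * ‖z‖) := by gcongr
      _ = _ := by field_simp
  · have h1 := hu T hT0 z hz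
    have h2 : 1 / (4 * (1 + ‖p‖)) ≤ 1 / 4 := by
      gcongr
      linarith [norm_nonneg p]
    have h3 : M * Real.exp (-ε * T) * ‖G T z‖ ≤ 1 / 4 * ‖G T z‖ := by
      gcongr; exact hT.le.trans h2
    linarith

/-- The imaginary axis lies in the resolvent set of `A`, and the resolvent is bounded there. -/
theorem exists_resolvent_bound (hG : IsC0Semigroup G) {A : H →ₗ.[ℝ] H} (hA : IsGenerator A G)
    {j : ℕ} (hd : HasExponentialDichotomy G j) :
    ∃ C : ℝ, 0 < C ∧ ∀ ω : ℝ,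
      (∀ v₁ v₂ a₁ a₂ : H, (v₁, a₁) ∈ A.graph → (v₂, a₂) ∈ A.graph →
        ‖(v₁, v₂)‖ ≤ C * ‖(a₁ + ω • v₂, a₂ - ω • v₁)‖) ∧
      ∀ x₁ x₂ : H, ∃ v₁ v₂ a₁ a₂ : H, (v₁, a₁) ∈ A.graph ∧ (v₂, a₂) ∈ A.graph ∧
        a₁ + ω • v₂ = x₁ ∧ a₂ - ω • v₁ = x₂ := by
  obtain ⟨p, T, hT, hp, hfin, hpg, hst, hun⟩ := hd.exists_time
  obtain ⟨M, hM, hb⟩ := hG.exists_norm_le T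
  -- The `+ 1` keeps the constant positive when `T = 0`.
  refine ⟨(3 * ‖p‖ + 2) * (2 * (M * T)) + 1, by positivity, fun ω => ?_⟩
  have hcos : ∀ t, HasDerivAt (fun t => Real.cos (ω * t)) (-ω * Real.sin (ω * t)) t := fun t => by
    have := ((hasDerivAt_id t).const_mul ω).cos
    convert! this using 1
    simp; ring
  have hsin : ∀ t, HasDerivAt (fun t => Real.sin (ω * t)) (ω * Real.cos (ω * t)) t := fun t => by
    have := ((hasDerivAt_id t).const_mul ω).sin
    convert! this using 1
    simp; ring
  have hcos' : Continuous fun t => -ω * Real.sin (ω * t) := by fun_prop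
  have hsin' : Continuous fun t => ω * Real.cos (ω * t) := by fun_prop
  have cc : Continuous fun t => Real.cos (ω * t) := by fun_prop
  have cs : Continuous fun t => Real.sin (ω * t) := by fun_prop
  -- `Cw - i Sw` is `∫₀ᵀ exp (-iωs) G(s) ds`. Composed with `A - iω` on either side it gives `exp
  -- (-iωT) G(T) - 1`, so inverting the latter inverts `A - iω`. `gC`, `gS` are the real parts of
  -- one composition (for existence), `eC`, `eS` of the other (for the bound).
  set Cw := hG.weightedIntegral cc hT with hCw
  set Sw := hG.weightedIntegral cs hT with hSw
  have dcos : ∀ x, ∫ s in (0 : ℝ)..T, (-ω * Real.sin (ω * s)) • G s x = -(ω • Sw x) := by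
    intro x
    rw [hSw, hG.weightedIntegral_apply, ← intervalIntegral.integral_smul,
      ← intervalIntegral.integral_neg]
    congr 1; ext s; rw [neg_mul, neg_smul, mul_smul]
  have dsin : ∀ x, ∫ s in (0 : ℝ)..T, (ω * Real.cos (ω * s)) • G s x = ω • Cw x := by
    intro x
    rw [hCw, hG.weightedIntegral_apply, ← intervalIntegral.integral_smul]
    congr 1; ext s; rw [mul_smul]
  have gC : ∀ x, (Cw x, Real.cos (ω * T) • G T x - x + ω • Sw x) ∈ A.graph := by
    intro x
    have := hG.weightedIntegral_mem_graph hA hcos hcos' x hT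
    rw [dcos, ← hG.weightedIntegral_apply cc hT] at this
    simpa using this
  have gS : ∀ x, (Sw x, Real.sin (ω * T) • G T x - ω • Cw x) ∈ A.graph := by
    intro x
    have := hG.weightedIntegral_mem_graph hA hsin hsin' x hT
    rw [dsin, ← hG.weightedIntegral_apply cs hT] at this
    simpa using this
  have eC : ∀ x y, (x, y) ∈ A.graph → Real.cos (ω * T) • G T x - x + ω • Sw x = Cw y := by
    intro x y h
    have := hG.weightedIntegral_of_mem_graph hA hcos hcos' h hT
    rw [dcos, ← hG.weightedIntegral_apply cc hT] at this
    simpa using this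
  have eS : ∀ x y, (x, y) ∈ A.graph → Real.sin (ω * T) • G T x - ω • Cw x = Sw y := by
    intro x y h
    have := hG.weightedIntegral_of_mem_graph hA hsin hsin' h hT
    rw [dsin, ← hG.weightedIntegral_apply cs hT] at this
    simpa using this
  obtain ⟨hco, hsurj⟩ := rotated_sub_one_invertible hp hfin hpg hst hun
    (Real.cos_sq_add_sin_sq (ω * T))
  constructor
  · intro v₁ v₂ a₁ a₂ h1 h2
    set x₁ := a₁ + ω • v₂ with hx₁
    set x₂ := a₂ - ω • v₁ with hx₂
    have key : rotated (G T) (Real.cos (ω * T)) (Real.sin (ω * T)) (v₁, v₂) - (v₁, v₂) =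
        (Cw x₁ + Sw x₂, Cw x₂ - Sw x₁) := by
      rw [rotated_apply, hx₁, hx₂, Prod.mk_sub_mk]
      simp only [map_add, map_sub, map_smul, ← eC _ _ h1, ← eC _ _ h2, ← eS _ _ h1, ← eS _ _ h2]
      congr 1 <;> abel
    have hcb := hG.norm_weightedIntegral_le cc hT hb (fun t => Real.abs_cos_le_one _)
    have hsb := hG.norm_weightedIntegral_le cs hT hb (fun t => Real.abs_sin_le_one _)
    have b1 : ‖x₁‖ ≤ ‖(x₁, x₂)‖ := norm_fst_le (x₁, x₂)
    have b2 : ‖x₂‖ ≤ ‖(x₁, x₂)‖ := norm_snd_le (x₁, x₂)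
    have hMT : 0 ≤ M * T := by positivity
    have hsum : ‖(Cw x₁ + Sw x₂, Cw x₂ - Sw x₁)‖ ≤ 2 * (M * T) * ‖(x₁, x₂)‖ := by
      rw [Prod.norm_def]
      have c1 := (hcb x₁).trans (mul_le_mul_of_nonneg_left b1 hMT)
      have c2 := (hcb x₂).trans (mul_le_mul_of_nonneg_left b2 hMT)
      have s1 := (hsb x₁).trans (mul_le_mul_of_nonneg_left b1 hMT)
      have s2 := (hsb x₂).trans (mul_le_mul_of_nonneg_left b2 hMT)
      refine max_le ((norm_add_le _ _).trans ?_) ((norm_sub_le _ _).trans ?_) <;> linarith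
    have h := hco (v₁, v₂)
    rw [key] at h
    calc _ ≤ _ := h
      _ ≤ (3 * ‖p‖ + 2) * (2 * (M * T) * ‖(x₁, x₂)‖) := by gcongr
      _ ≤ _ := by nlinarith [norm_nonneg (x₁, x₂)]
  · intro x₁ x₂
    obtain ⟨⟨y₁, y₂⟩, hy⟩ := hsurj (x₁, x₂)
    rw [rotated_apply, Prod.mk_sub_mk, Prod.mk.injEq] at hy
    refine ⟨_, _, _, _, A.graph.add_mem (gC y₁) (gS y₂), A.graph.sub_mem (gC y₂) (gS y₁), ?_, ?_⟩
    · rw [← hy.1]; simp only [smul_sub]; abel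
    · rw [← hy.2]; simp only [smul_add]; abel

/-! ### Bounds for the quadratic form and the robust frequency inequality. -/

variable {B : U →L[ℝ] H} {F₁ : H →L[ℝ] H} {F₂ : H →L[ℝ] U} {F₃ : U ≃L[ℝ] U}

/-- A bound for the norms of the three operators of the quadratic form. -/
def formBound (F₁ : H →L[ℝ] H) (F₂ : H →L[ℝ] U) (F₃ : U ≃L[ℝ] U) : ℝ :=
  1 + ‖F₁‖ + ‖F₂‖ + ‖(F₃ : U →L[ℝ] U)‖

theorem formBound_pos : 0 < formBound F₁ F₂ F₃ := by
  unfold formBound; positivity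

theorem abs_inner_le_opNorm {E F : Type*} [NormedAddCommGroup E] [InnerProductSpace ℝ E]
    [NormedAddCommGroup F] [InnerProductSpace ℝ F] (L : E →L[ℝ] F) (x : E) (y : F) :
    |⟪L x, y⟫| ≤ ‖L‖ * ‖x‖ * ‖y‖ :=
  (abs_real_inner_le_norm _ _).trans (by gcongr; exact L.le_opNorm x)

theorem abs_quadForm_le (v : H) (ξ : U) :
    |quadForm F₁ F₂ F₃ v ξ| ≤ formBound F₁ F₂ F₃ * (‖v‖ + ‖ξ‖) ^ 2 := by
  have h1 := abs_inner_le_opNorm F₁ v v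
  have h2 := abs_inner_le_opNorm F₂ v ξ
  have h3 := abs_inner_le_opNorm (F₃ : U →L[ℝ] U) ξ ξ
  have b1 : 0 ≤ ‖F₁‖ := norm_nonneg _
  have b2 : 0 ≤ ‖F₂‖ := norm_nonneg _
  have b3 : 0 ≤ ‖(F₃ : U →L[ℝ] U)‖ := norm_nonneg _
  have n1 := norm_nonneg v
  have n2 := norm_nonneg ξ
  have h3' : |⟪F₃ ξ, ξ⟫| ≤ ‖(F₃ : U →L[ℝ] U)‖ * ‖ξ‖ * ‖ξ‖ := h3
  have ht : |quadForm F₁ F₂ F₃ v ξ| ≤ |⟪F₁ v, v⟫| + 2 * |⟪F₂ v, ξ⟫| + |⟪F₃ ξ, ξ⟫| := by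
    unfold quadForm
    refine (abs_add_le _ _).trans ?_
    gcongr
    refine (abs_add_le _ _).trans ?_
    rw [abs_mul, abs_two]
  have e : formBound F₁ F₂ F₃ * (‖v‖ + ‖ξ‖) ^ 2 - (‖F₁‖ * ‖v‖ * ‖v‖ + 2 * (‖F₂‖ * ‖v‖ * ‖ξ‖) +
      ‖(F₃ : U →L[ℝ] U)‖ * ‖ξ‖ * ‖ξ‖) = (‖v‖ + ‖ξ‖) ^ 2 + ‖F₁‖ * (2 * (‖v‖ * ‖ξ‖) + ‖ξ‖ ^ 2) +
      ‖F₂‖ * (‖v‖ ^ 2 + ‖ξ‖ ^ 2) + ‖(F₃ : U →L[ℝ] U)‖ * (2 * (‖v‖ * ‖ξ‖) + ‖v‖ ^ 2) := by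
    unfold formBound; ring
  have : 0 ≤ (‖v‖ + ‖ξ‖) ^ 2 + ‖F₁‖ * (2 * (‖v‖ * ‖ξ‖) + ‖ξ‖ ^ 2) +
      ‖F₂‖ * (‖v‖ ^ 2 + ‖ξ‖ ^ 2) + ‖(F₃ : U →L[ℝ] U)‖ * (2 * (‖v‖ * ‖ξ‖) + ‖v‖ ^ 2) := by
    positivity
  linarith

/-- Perturbing the state argument of the quadratic form. -/
theorem abs_quadForm_add_sub_le (v h : H) (ξ : U) :
    |quadForm F₁ F₂ F₃ (v + h) ξ - quadForm F₁ F₂ F₃ v ξ| ≤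
      2 * formBound F₁ F₂ F₃ * (‖h‖ * (‖v‖ + ‖ξ‖ + ‖h‖)) := by
  have e : quadForm F₁ F₂ F₃ (v + h) ξ - quadForm F₁ F₂ F₃ v ξ =
      ⟪F₁ v, h⟫ + ⟪F₁ h, v⟫ + ⟪F₁ h, h⟫ + 2 * ⟪F₂ h, ξ⟫ := by
    unfold quadForm
    simp only [map_add, inner_add_left, inner_add_right]; ring
  rw [e]
  have h1 := abs_inner_le_opNorm F₁ v h
  have h2 := abs_inner_le_opNorm F₁ h v
  have h3 := abs_inner_le_opNorm F₁ h h
  have h4 := abs_inner_le_opNorm F₂ h ξ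
  have ht := abs_add_le (⟪F₁ v, h⟫ + ⟪F₁ h, v⟫ + ⟪F₁ h, h⟫) (2 * ⟪F₂ h, ξ⟫)
  have ht' := abs_add_three ⟪F₁ v, h⟫ ⟪F₁ h, v⟫ ⟪F₁ h, h⟫
  rw [abs_mul, abs_two] at ht
  have e2 : 2 * formBound F₁ F₂ F₃ * (‖h‖ * (‖v‖ + ‖ξ‖ + ‖h‖)) -
      (‖F₁‖ * ‖v‖ * ‖h‖ + ‖F₁‖ * ‖h‖ * ‖v‖ + ‖F₁‖ * ‖h‖ * ‖h‖ + 2 * (‖F₂‖ * ‖h‖ * ‖ξ‖)) =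
      2 * (‖h‖ * (‖v‖ + ‖ξ‖ + ‖h‖)) + ‖F₁‖ * (2 * (‖h‖ * ‖ξ‖) + ‖h‖ ^ 2) +
      2 * ‖F₂‖ * (‖h‖ * (‖v‖ + ‖h‖)) + 2 * ‖(F₃ : U →L[ℝ] U)‖ * (‖h‖ * (‖v‖ + ‖ξ‖ + ‖h‖)) := by
    unfold formBound; ring
  have : 0 ≤ 2 * (‖h‖ * (‖v‖ + ‖ξ‖ + ‖h‖)) + ‖F₁‖ * (2 * (‖h‖ * ‖ξ‖) + ‖h‖ ^ 2) +
      2 * ‖F₂‖ * (‖h‖ * (‖v‖ + ‖h‖)) +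
      2 * ‖(F₃ : U →L[ℝ] U)‖ * (‖h‖ * (‖v‖ + ‖ξ‖ + ‖h‖)) := by positivity
  linarith

/-- Young's inequality with a free parameter: a small `η` absorbs the cross terms into coercivity,
at a price `1 / η` paid only by the perturbation `w`. -/
theorem quadForm_perturb {η : ℝ} (hη : 0 < η) {u w v : H} (ξ : U) (hu : u = v - w) :
    quadForm F₁ F₂ F₃ u ξ - 2 * formBound F₁ F₂ F₃ *
        (η * (‖u‖ ^ 2 + ‖ξ‖ ^ 2) + (1 + 1 / (2 * η)) * ‖w‖ ^ 2) ≤ quadForm F₁ F₂ F₃ v ξ ∧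
      ‖v‖ ^ 2 ≤ 2 * ‖u‖ ^ 2 + 2 * ‖w‖ ^ 2 := by
  have hv : v = u + w := by rw [hu]; abel
  subst hv
  have hL := formBound_pos (F₁ := F₁) (F₂ := F₂) (F₃ := F₃)
  have h1 := (abs_le.1 (abs_quadForm_add_sub_le (F₁ := F₁) (F₂ := F₂) (F₃ := F₃) u w ξ)).1
  have young : ∀ x y : ℝ, x * y ≤ η * y ^ 2 + 1 / (4 * η) * x ^ 2 := by
    intro x y
    have : η * y ^ 2 + 1 / (4 * η) * x ^ 2 - x * y = (2 * η * y - x) ^ 2 / (4 * η) := by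
      field_simp; ring
    have h0 : 0 ≤ (2 * η * y - x) ^ 2 / (4 * η) := by positivity
    linarith
  have h2 := young ‖w‖ ‖u‖
  have h3 := young ‖w‖ ‖ξ‖
  have h4 : ‖w‖ * (‖u‖ + ‖ξ‖ + ‖w‖) ≤
      η * (‖u‖ ^ 2 + ‖ξ‖ ^ 2) + (1 + 1 / (2 * η)) * ‖w‖ ^ 2 := by
    have : (1 + 1 / (2 * η)) * ‖w‖ ^ 2 = ‖w‖ ^ 2 + 2 * (1 / (4 * η) * ‖w‖ ^ 2) := by
      field_simp; ring
    rw [this]; linarith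
  have h5 := mul_le_mul_of_nonneg_left h4 (by positivity : 0 ≤ 2 * formBound F₁ F₂ F₃)
  refine ⟨by linarith, ?_⟩
  have h6 : ‖u + w‖ ^ 2 ≤ (‖u‖ + ‖w‖) ^ 2 := by gcongr; exact norm_add_le u w
  linarith [sq_nonneg (‖u‖ - ‖w‖)]

theorem sq_norm_le_of_le_max {E : Type*} [NormedAddCommGroup E] {x : E} {c p q : ℝ}
    (h : ‖x‖ ≤ c * max p q) : ‖x‖ ^ 2 ≤ c ^ 2 * (p ^ 2 + q ^ 2) := by
  have : max p q ^ 2 ≤ p ^ 2 + q ^ 2 := by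
    rcases max_choice p q with h' | h' <;> rw [h']
    · linarith [sq_nonneg q]
    · linarith [sq_nonneg p]
  calc ‖x‖ ^ 2 ≤ (c * max p q) ^ 2 := by gcongr
    _ = c ^ 2 * max p q ^ 2 := by ring
    _ ≤ _ := by gcongr

/-- The frequency condition is robust: it extends to forced equations, and gives a bound of the
state. -/
theorem FrequencyCondition.robust (hG : IsC0Semigroup G) {A : H →ₗ.[ℝ] H} (hA : IsGenerator A G)
    {j : ℕ} (hd : HasExponentialDichotomy G j) (hfreq : FrequencyCondition A B F₁ F₂ F₃) :
    ∃ δ C : ℝ, 0 < δ ∧ 0 < C ∧ ∀ (ω : ℝ) (ξ₁ ξ₂ : U) (f₁ f₂ v₁ v₂ a₁ a₂ : H),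
      (v₁, a₁) ∈ A.graph → (v₂, a₂) ∈ A.graph →
      a₁ + ω • v₂ = -(B ξ₁ + f₁) → a₂ - ω • v₁ = -(B ξ₂ + f₂) →
      δ * (‖v₁‖ ^ 2 + ‖v₂‖ ^ 2 + ‖ξ₁‖ ^ 2 + ‖ξ₂‖ ^ 2) ≤
        quadForm F₁ F₂ F₃ v₁ ξ₁ + quadForm F₁ F₂ F₃ v₂ ξ₂ + C * (‖f₁‖ ^ 2 + ‖f₂‖ ^ 2) := by
  obtain ⟨δ, hδ, hF⟩ := hfreq
  obtain ⟨K, hK, hres⟩ := exists_resolvent_bound hG hA hd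
  set L := formBound F₁ F₂ F₃ with hL
  have hLpos : 0 < L := formBound_pos
  set k := 2 * (K * ‖B‖) ^ 2 with hk
  have hk0 : 0 ≤ k := by positivity
  -- `k` bounds the squared unforced response by the squared control. The choice of `η` makes the
  -- cross terms cost at most `δ / 2`; `δ'` spreads the remaining half over state and control.
  set η := δ / (4 * L * (k + 1)) with hη
  have hηpos : 0 < η := by positivity
  set C₁ := 2 * L * (1 + 1 / (2 * η)) with hC₁
  have hC₁pos : 0 < C₁ := by positivity
  set δ' := δ / (2 * (2 * k + 1)) with hδ'
  have hδ'pos : 0 < δ' := by positivity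
  refine ⟨δ', C₁ * (2 * K ^ 2) + δ' * (4 * K ^ 2), hδ'pos, by positivity, ?_⟩
  intro ω ξ₁ ξ₂ f₁ f₂ v₁ v₂ a₁ a₂ hv₁ hv₂ e₁ e₂
  -- `w` is the response to the forcing `f` alone. Then `u = v - w` is the response to `B ξ`, and
  -- the frequency condition applies to `(u, ξ)`.
  obtain ⟨w₁, w₂, b₁, b₂, hw₁, hw₂, g₁, g₂⟩ := (hres ω).2 (-f₁) (-f₂)
  have hW := (hres ω).1 _ _ _ _ hw₁ hw₂
  rw [g₁, g₂, Prod.norm_def (x := (-f₁, -f₂)), norm_neg, norm_neg] at hW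
  have hw1 := sq_norm_le_of_le_max ((norm_fst_le (w₁, w₂)).trans hW)
  have hw2 := sq_norm_le_of_le_max ((norm_snd_le (w₁, w₂)).trans hW)
  have hu₁ := A.graph.sub_mem hv₁ hw₁
  have hu₂ := A.graph.sub_mem hv₂ hw₂
  rw [Prod.mk_sub_mk] at hu₁ hu₂
  have i₁ : (a₁ - b₁) + ω • (v₂ - w₂) = -B ξ₁ := by
    have : (a₁ - b₁) + ω • (v₂ - w₂) = (a₁ + ω • v₂) - (b₁ + ω • w₂) := by module
    rw [this, e₁, g₁]; abel
  have i₂ : (a₂ - b₂) - ω • (v₁ - w₁) = -B ξ₂ := by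
    have : (a₂ - b₂) - ω • (v₁ - w₁) = (a₂ - ω • v₁) - (b₂ - ω • w₁) := by module
    rw [this, e₂, g₂]; abel
  have hUb := (hres ω).1 _ _ _ _ hu₁ hu₂
  have hBmax : ‖(-B ξ₁, -B ξ₂)‖ ≤ ‖B‖ * max ‖ξ₁‖ ‖ξ₂‖ := by
    rw [Prod.norm_def, norm_neg, norm_neg]
    exact max_le ((B.le_opNorm _).trans (by gcongr; exact le_max_left _ _))
      ((B.le_opNorm _).trans (by gcongr; exact le_max_right _ _))
  rw [i₁, i₂] at hUb
  have hUb' : ‖(v₁ - w₁, v₂ - w₂)‖ ≤ K * ‖B‖ * max ‖ξ₁‖ ‖ξ₂‖ := by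
    refine hUb.trans ?_
    rw [mul_assoc]
    gcongr
  have hu1 := sq_norm_le_of_le_max ((norm_fst_le (v₁ - w₁, v₂ - w₂)).trans hUb')
  have hu2 := sq_norm_le_of_le_max ((norm_snd_le (v₁ - w₁, v₂ - w₂)).trans hUb')
  set u₁ := v₁ - w₁ with hu₁d
  set u₂ := v₂ - w₂ with hu₂d
  have hfr : δ * (‖ξ₁‖ ^ 2 + ‖ξ₂‖ ^ 2) ≤ quadForm F₁ F₂ F₃ u₁ ξ₁ + quadForm F₁ F₂ F₃ u₂ ξ₂ := by
    obtain ⟨y₁, hy₁, hz₁⟩ := (LinearPMap.mem_graph_iff A).1 hu₁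
    obtain ⟨y₂, hy₂, hz₂⟩ := (LinearPMap.mem_graph_iff A).1 hu₂
    simp only at hy₁ hz₁ hy₂ hz₂
    have := hF ω ξ₁ ξ₂ y₁ y₂ (by rw [hz₁, hy₂]; exact i₁) (by rw [hz₂, hy₁]; exact i₂)
    rwa [hy₁, hy₂] at this
  obtain ⟨p₁, q₁⟩ := quadForm_perturb (F₁ := F₁) (F₂ := F₂) (F₃ := F₃) hηpos ξ₁ hu₁d
  obtain ⟨p₂, q₂⟩ := quadForm_perturb (F₁ := F₁) (F₂ := F₂) (F₃ := F₃) hηpos ξ₂ hu₂d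
  rw [← hL] at p₁ p₂
  set n := ‖ξ₁‖ ^ 2 + ‖ξ₂‖ ^ 2 with hn
  set m := ‖f₁‖ ^ 2 + ‖f₂‖ ^ 2 with hm
  have hUn : ‖u₁‖ ^ 2 + ‖u₂‖ ^ 2 ≤ k * n := by rw [hk]; linarith
  have hWm : ‖w₁‖ ^ 2 + ‖w₂‖ ^ 2 ≤ 2 * K ^ 2 * m := by linarith
  have c1 : 2 * L * (η * (‖u₁‖ ^ 2 + ‖u₂‖ ^ 2 + n)) ≤ δ / 2 * n := by
    have : 2 * L * (η * (k * n + n)) = δ / 2 * n := by rw [hη]; field_simp; ring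
    rw [← this]; gcongr
  have c2 : C₁ * (‖w₁‖ ^ 2 + ‖w₂‖ ^ 2) ≤ C₁ * (2 * K ^ 2 * m) := by gcongr
  have c3 : δ' * (‖v₁‖ ^ 2 + ‖v₂‖ ^ 2 + n) ≤ δ' * ((2 * k + 1) * n + 4 * K ^ 2 * m) :=
    mul_le_mul_of_nonneg_left (by linarith) hδ'pos.le
  have c4 : δ' * ((2 * k + 1) * n) = δ / 2 * n := by rw [hδ']; field_simp
  have c5 : C₁ * (‖w₁‖ ^ 2 + ‖w₂‖ ^ 2) = 2 * L * ((1 + 1 / (2 * η)) * ‖w₁‖ ^ 2) +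
    2 * L * ((1 + 1 / (2 * η)) * ‖w₂‖ ^ 2) := by rw [hC₁]; ring
  have c6 : ‖v₁‖ ^ 2 + ‖v₂‖ ^ 2 + ‖ξ₁‖ ^ 2 + ‖ξ₂‖ ^ 2 = ‖v₁‖ ^ 2 + ‖v₂‖ ^ 2 + n := by
    rw [hn]; ring
  rw [c6]
  linarith

/-! ### Plancherel's theorem, complex and real. -/

section Plancherel

open FourierTransform SchwartzMap
open scoped ContDiff

/-- On `L¹ ∩ L²` the `L²`-Fourier transform is given by the Fourier integral. -/
theorem fourier_toLp_ae_eq {E : Type*} [NormedAddCommGroup E] [InnerProductSpace ℂ E]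
    [CompleteSpace E] {f : ℝ → E} (hf : Integrable f) (hf2 : MemLp f 2) :
    (𝓕 (hf2.toLp f) : Lp E 2 (volume : Measure ℝ)) =ᵐ[volume] 𝓕 f := by
  have hcont : Continuous (𝓕 f) :=
    VectorFourier.fourierIntegral_continuous (L := innerₗ ℝ) Real.continuous_fourierChar
      continuous_inner hf
  -- Both functions are tested against smooth compactly supported `g`. The `L²` transform acts by
  -- duality on tempered distributions, and the Fourier integral moves onto the test function
  -- because `f` is integrable.
  refine ae_eq_of_integral_contDiff_smul_eq ((Lp.memLp _).locallyIntegrable (by norm_num))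
    hcont.locallyIntegrable fun g g_smooth g_cpt => ?_
  have hg₁ : HasCompactSupport (Complex.ofRealCLM ∘ g) := g_cpt.comp_left rfl
  have hg₂ : ContDiff ℝ ∞ (Complex.ofRealCLM ∘ g) := by fun_prop
  set φ : 𝓢(ℝ, ℂ) := hg₁.toSchwartzMap hg₂ with hφ
  have hφa : ∀ x, φ x = (g x : ℂ) := fun x => rfl
  have h1 := DFunLike.congr_fun (Lp.fourier_toTemperedDistribution_eq (hf2.toLp f)) φ
  rw [TemperedDistribution.fourier_apply, Lp.toTemperedDistribution_apply,
    Lp.toTemperedDistribution_apply] at h1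
  have h2 : ∫ x, (𝓕 φ) x • f x = ∫ x, φ x • 𝓕 f x := by
    simpa using! (VectorFourier.integral_fourierIntegral_smul_eq_flip (L := innerₗ ℝ)
      Real.continuous_fourierChar continuous_inner φ.integrable hf)
  have h3 : ∫ x, (𝓕 φ) x • (hf2.toLp f) x = ∫ x, (𝓕 φ) x • f x := by
    refine integral_congr_ae ?_
    filter_upwards [hf2.coeFn_toLp] with x hx
    rw [hx]
  rw [h3, h2] at h1
  simp only [hφa] at h1
  simpa using h1.symm

/-- Plancherel's theorem for `L¹ ∩ L²` functions. -/
theorem integral_inner_fourier {E : Type*} [NormedAddCommGroup E] [InnerProductSpace ℂ E]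
    [CompleteSpace E] {f g : ℝ → E} (hf : Integrable f) (hf2 : MemLp f 2) (hg : Integrable g)
    (hg2 : MemLp g 2) :
    Integrable (fun w => inner ℂ (𝓕 f w) (𝓕 g w)) ∧
      ∫ w, inner ℂ (𝓕 f w) (𝓕 g w) = ∫ t, inner ℂ (f t) (g t) := by
  have h := Lp.inner_fourier_eq (hf2.toLp f) (hg2.toLp g)
  rw [L2.inner_def, L2.inner_def] at h
  have e1 : (fun w => inner ℂ ((𝓕 (hf2.toLp f) : Lp E 2 (volume : Measure ℝ)) w)
      ((𝓕 (hg2.toLp g) : Lp E 2 (volume : Measure ℝ)) w)) =ᵐ[volume]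
      fun w => inner ℂ (𝓕 f w) (𝓕 g w) := by
    filter_upwards [fourier_toLp_ae_eq hf hf2, fourier_toLp_ae_eq hg hg2] with w h1 h2
    rw [h1, h2]
  have e2 : (fun t => inner ℂ (hf2.toLp f t) (hg2.toLp g t)) =ᵐ[volume]
      fun t => inner ℂ (f t) (g t) := by
    filter_upwards [hf2.coeFn_toLp, hg2.coeFn_toLp] with w h1 h2
    rw [h1, h2]
  rw [integral_congr_ae e1, integral_congr_ae e2] at h
  exact ⟨(L2.integrable_inner _ _).congr e1, h⟩

end Plancherel

/-- The real part of the Fourier transform. -/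
def cosTransform {E : Type*} [NormedAddCommGroup E] [NormedSpace ℝ E] (x : ℝ → E) (ν : ℝ) : E :=
  ∫ t, Real.cos (2 * Real.pi * ν * t) • x t

/-- The imaginary part of the Fourier transform. -/
def sinTransform {E : Type*} [NormedAddCommGroup E] [NormedSpace ℝ E] (x : ℝ → E) (ν : ℝ) : E :=
  ∫ t, (-Real.sin (2 * Real.pi * ν * t)) • x t

section

variable {E F : Type*} [NormedAddCommGroup E] [NormedSpace ℝ E] [CompleteSpace E]
  [NormedAddCommGroup F] [NormedSpace ℝ F] [CompleteSpace F]

theorem integrable_cos_smul {μ : Measure ℝ} {x : ℝ → E} (hx : Integrable x μ) (ν : ℝ) :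
    Integrable (fun t => Real.cos (2 * Real.pi * ν * t) • x t) μ :=
  hx.bdd_smul 1 (by fun_prop : Continuous fun t => Real.cos (2 * Real.pi * ν * t)).aestronglyMeasurable
    (Eventually.of_forall fun t => Real.abs_cos_le_one _)

theorem integrable_sin_smul {μ : Measure ℝ} {x : ℝ → E} (hx : Integrable x μ) (ν : ℝ) :
    Integrable (fun t => (-Real.sin (2 * Real.pi * ν * t)) • x t) μ :=
  hx.bdd_smul 1
    (by fun_prop : Continuous fun t => -Real.sin (2 * Real.pi * ν * t)).aestronglyMeasurable
    (Eventually.of_forall fun t => by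
      rw [Real.norm_eq_abs, abs_neg]; exact Real.abs_sin_le_one _)

theorem cosTransform_clm (L : E →L[ℝ] F) {x : ℝ → E} (hx : Integrable x) (ν : ℝ) :
    cosTransform (fun t => L (x t)) ν = L (cosTransform x ν) := by
  unfold cosTransform
  rw [← ContinuousLinearMap.integral_comp_comm _ (integrable_cos_smul hx ν)]
  simp only [map_smul]

theorem sinTransform_clm (L : E →L[ℝ] F) {x : ℝ → E} (hx : Integrable x) (ν : ℝ) :
    sinTransform (fun t => L (x t)) ν = L (sinTransform x ν) := by
  unfold sinTransform
  rw [← ContinuousLinearMap.integral_comp_comm _ (integrable_sin_smul hx ν)]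
  simp only [map_smul]

theorem cosTransform_add {x y : ℝ → E} (hx : Integrable x) (hy : Integrable y) (ν : ℝ) :
    cosTransform (fun t => x t + y t) ν = cosTransform x ν + cosTransform y ν := by
  unfold cosTransform
  rw [← integral_add (integrable_cos_smul hx ν) (integrable_cos_smul hy ν)]
  simp only [smul_add]

theorem sinTransform_add {x y : ℝ → E} (hx : Integrable x) (hy : Integrable y) (ν : ℝ) :
    sinTransform (fun t => x t + y t) ν = sinTransform x ν + sinTransform y ν := by
  unfold sinTransform
  rw [← integral_add (integrable_sin_smul hx ν) (integrable_sin_smul hy ν)]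
  simp only [smul_add]

end

section

open FourierTransform

/-- Plancherel's theorem in a real Hilbert space, provided a complexification is given. -/
theorem integral_inner_transform_of_complexification {E : Type*} [NormedAddCommGroup E]
    [InnerProductSpace ℂ E] [CompleteSpace E] (J : H → E) (hadd : ∀ x y, J (x + y) = J x + J y)
    (hsmul : ∀ (r : ℝ) x, J (r • x) = (r : ℂ) • J x)
    (hinner : ∀ x y, inner ℂ (J x) (J y) = ((⟪x, y⟫ : ℝ) : ℂ))
    {x y : ℝ → H} (hx : Integrable x) (hx2 : MemLp x 2) (hy : Integrable y) (hy2 : MemLp y 2) :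
    Integrable (fun ν => ⟪cosTransform x ν, cosTransform y ν⟫ +
        ⟪sinTransform x ν, sinTransform y ν⟫) ∧
      ∫ ν, (⟪cosTransform x ν, cosTransform y ν⟫ + ⟪sinTransform x ν, sinTransform y ν⟫) =
        ∫ t, ⟪x t, y t⟫ := by
  have hnorm : ∀ x, ‖J x‖ = ‖x‖ := fun x => by
    have h := hinner x x
    rw [inner_self_eq_norm_sq_to_K, real_inner_self_eq_norm_sq] at h
    have h' : ‖J x‖ ^ 2 = ‖x‖ ^ 2 := by
      apply Complex.ofReal_injective
      rw [← h, Complex.ofReal_pow]; rfl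
    exact (sq_eq_sq₀ (norm_nonneg _) (norm_nonneg _)).1 h'
  set L : H →L[ℝ] E := LinearMap.mkContinuous
    { toFun := J, map_add' := hadd, map_smul' := fun r x => by
        rw [hsmul, RingHom.id_apply]; exact Complex.coe_smul _ _ } 1
    (fun x => by rw [one_mul]; exact (hnorm x).le) with hL
  have hLJ : ∀ x, L x = J x := fun x => rfl
  -- The minus sign in `sinTransform` matches the kernel `exp (-2πiνt)`, so the Fourier transform is
  -- `cosTransform + i sinTransform`.
  have hf : ∀ {x : ℝ → H}, Integrable x → ∀ ν, 𝓕 (fun t => L (x t)) ν =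
      J (cosTransform x ν) + Complex.I • J (sinTransform x ν) := by
    intro x hx ν
    rw [Real.fourier_real_eq_integral_exp_smul, ← hLJ, ← hLJ, ← cosTransform_clm L hx,
      ← sinTransform_clm L hx]
    unfold cosTransform sinTransform
    have hLx := L.integrable_comp hx
    have hs : Integrable (fun t => Complex.I • (-Real.sin (2 * Real.pi * ν * t)) • L (x t)) :=
      (integrable_sin_smul hLx ν).smul Complex.I
    rw [← integral_smul, ← integral_add (integrable_cos_smul hLx ν) hs]
    congr 1; ext t
    rw [Complex.exp_mul_I, add_smul, ← Complex.ofReal_cos, ← Complex.ofReal_sin]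
    have e1 : Real.cos (-2 * Real.pi * t * ν) = Real.cos (2 * Real.pi * ν * t) := by
      rw [← Real.cos_neg]; congr 1; ring
    have e2 : Real.sin (-2 * Real.pi * t * ν) = -Real.sin (2 * Real.pi * ν * t) := by
      rw [← Real.sin_neg]; congr 1; ring
    rw [e1, e2, ← Complex.coe_smul, ← Complex.coe_smul, smul_smul, mul_comm Complex.I]
  obtain ⟨hi, he⟩ := integral_inner_fourier (L.integrable_comp hx) (L.comp_memLp' hx2)
    (L.integrable_comp hy) (L.comp_memLp' hy2)
  have hre : ∀ ν, (inner ℂ (𝓕 (fun t => L (x t)) ν) (𝓕 (fun t => L (y t)) ν)).re =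
      ⟪cosTransform x ν, cosTransform y ν⟫ + ⟪sinTransform x ν, sinTransform y ν⟫ := by
    intro ν
    rw [hf hx, hf hy]
    simp only [inner_add_left, inner_add_right, inner_smul_left, inner_smul_right, hinner]
    simp
  have e3 : ∀ t, inner ℂ (L (x t)) (L (y t)) = ((⟪x t, y t⟫ : ℝ) : ℂ) := fun t => hinner _ _
  constructor
  · exact hi.re.congr (Eventually.of_forall fun ν => hre ν)
  · have := congrArg Complex.re he
    simp only [e3] at this
    rw [integral_complex_ofReal, Complex.ofReal_re] at this
    rw [← this, ← Complex.reCLM_apply, ← ContinuousLinearMap.integral_comp_comm _ hi]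
    congr 1; ext ν
    exact (hre ν).symm

/-- Plancherel's theorem in a real Hilbert space. -/
theorem integral_inner_transform {x y : ℝ → H} (hx : Integrable x) (hx2 : MemLp x 2)
    (hy : Integrable y) (hy2 : MemLp y 2) :
    Integrable (fun ν => ⟪cosTransform x ν, cosTransform y ν⟫ +
        ⟪sinTransform x ν, sinTransform y ν⟫) ∧
      ∫ ν, (⟪cosTransform x ν, cosTransform y ν⟫ + ⟪sinTransform x ν, sinTransform y ν⟫) =
        ∫ t, ⟪x t, y t⟫ := by
  -- The complexification is `ℓ²(w; ℂ)` for a Hilbert basis indexed by `w`: real coordinates are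
  -- read as complex ones.
  obtain ⟨w, b, -⟩ := exists_hilbertBasis ℝ H
  have hmem : ∀ x : H, Memℓp (fun i : w => ((b.repr x i : ℝ) : ℂ)) 2 := by
    intro x
    have := lp.memℓp (b.repr x)
    refine memℓp_gen ?_
    have h2 := this.summable (by norm_num)
    simpa using h2
  refine integral_inner_transform_of_complexification
    (E := lp (fun _ : w => ℂ) 2) (fun x => ⟨fun i => ((b.repr x i : ℝ) : ℂ), hmem x⟩)
    (fun x y => ?_) (fun r x => ?_) (fun x y => ?_) hx hx2 hy hy2
  · ext i
    change ((b.repr (x + y) i : ℝ) : ℂ) = (b.repr x i : ℝ) + (b.repr y i : ℝ)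
    simp
  · ext i
    change ((b.repr (r • x) i : ℝ) : ℂ) = (r : ℂ) * (b.repr x i : ℝ)
    simp
  · rw [lp.inner_eq_tsum, ← b.repr.inner_map_map x y, lp.inner_eq_tsum, Complex.ofReal_tsum]
    simp

end

/-! ### Convolutions with the semigroup, their Laplace transforms, and the duality pairing. -/

/-- Fubini's theorem on a triangle. -/
theorem integral_triangle {E : Type*} [NormedAddCommGroup E] [NormedSpace ℝ E] {k : ℝ → ℝ → E}
    {T : ℝ} (hT : 0 ≤ T) (hk : Integrable (Function.uncurry k)
      ((volume.restrict (Ioc 0 T)).prod (volume.restrict (Ioc 0 T)))) :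
    IntervalIntegrable (fun t => ∫ s in (0 : ℝ)..t, k s t) volume 0 T ∧
    IntervalIntegrable (fun s => ∫ t in s..T, k s t) volume 0 T ∧
    ∫ t in (0 : ℝ)..T, ∫ s in (0 : ℝ)..t, k s t = ∫ s in (0 : ℝ)..T, ∫ t in s..T, k s t := by
  set μ := volume.restrict (Ioc (0 : ℝ) T) with hμ
  set k' : ℝ × ℝ → E := indicator {p : ℝ × ℝ | p.1 ≤ p.2} (Function.uncurry k) with hk'
  have hk'i : Integrable k' (μ.prod μ) :=
    hk.indicator (measurableSet_le measurable_fst measurable_snd)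
  have e1 : ∀ t ∈ Ioc (0 : ℝ) T, ∫ s, k' (s, t) ∂μ = ∫ s in (0 : ℝ)..t, k s t := by
    intro t ht
    have : (fun s => k' (s, t)) = indicator (Iic t) (fun s => k s t) := by
      ext s; simp [hk', indicator_apply]
    rw [this, hμ, setIntegral_indicator measurableSet_Iic, intervalIntegral.integral_of_le ht.1.le,
      Ioc_inter_Iic, min_eq_right ht.2]
  have e2 : ∀ s ∈ Ioc (0 : ℝ) T, ∫ t, k' (s, t) ∂μ = ∫ t in s..T, k s t := by
    intro s hs
    have : (fun t => k' (s, t)) = indicator (Ici s) (fun t => k s t) := by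
      ext t; simp [hk', indicator_apply]
    have h2 : Ioc 0 T ∩ Ici s = Icc s T := by
      ext t; simp only [mem_inter_iff, mem_Ioc, mem_Ici, mem_Icc]
      exact ⟨fun h => ⟨h.2, h.1.2⟩, fun h => ⟨⟨hs.1.trans_le h.1, h.2⟩, h.1⟩⟩
    rw [this, hμ, setIntegral_indicator measurableSet_Ici, h2, integral_Icc_eq_integral_Ioc,
      intervalIntegral.integral_of_le hs.2]
  refine ⟨?_, ?_, ?_⟩
  · rw [intervalIntegrable_iff_integrableOn_Ioc_of_le hT]
    exact (hk'i.integral_prod_right).congr ((ae_restrict_iff' measurableSet_Ioc).2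
      (Eventually.of_forall e1))
  · rw [intervalIntegrable_iff_integrableOn_Ioc_of_le hT]
    exact (hk'i.integral_prod_left).congr ((ae_restrict_iff' measurableSet_Ioc).2
      (Eventually.of_forall e2))
  · rw [intervalIntegral.integral_of_le hT, intervalIntegral.integral_of_le hT,
      ← setIntegral_congr_fun measurableSet_Ioc e1, ← setIntegral_congr_fun measurableSet_Ioc e2]
    exact integral_integral_swap (f := fun t s => k' (s, t)) hk'i.swap

namespace IsC0Semigroup

theorem aestronglyMeasurable_comp (hG : IsC0Semigroup G) {α : Type*} [MeasurableSpace α]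
    {μ : Measure α} {φ : α → ℝ} {g : α → H} (hφ : AEStronglyMeasurable φ μ)
    (hg : AEStronglyMeasurable g μ) :
    AEStronglyMeasurable (fun a => G (max (φ a) 0) (g a)) μ :=
  hG.continuous_max.comp_aestronglyMeasurable (hφ.prodMk hg)

theorem integrableOn_comp (hG : IsC0Semigroup G) {S : Set ℝ} (hS : MeasurableSet S) {φ : ℝ → ℝ}
    (hφ : Continuous φ) {T : ℝ} (hφT : ∀ t ∈ S, φ t ∈ Icc 0 T) {g : ℝ → H}
    (hg : IntegrableOn g S) : IntegrableOn (fun t => G (φ t) (g t)) S := by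
  obtain ⟨M, hM, hb⟩ := hG.exists_norm_le T
  have hm : AEStronglyMeasurable (fun t => G (φ t) (g t)) (volume.restrict S) := by
    refine (hG.aestronglyMeasurable_comp hφ.aestronglyMeasurable hg.1).congr ?_
    refine (ae_restrict_iff' hS).2 (Eventually.of_forall fun t ht => ?_)
    simp only [max_eq_left (hφT t ht).1]
  refine Integrable.mono' (hg.norm.const_mul M) hm
    ((ae_restrict_iff' hS).2 (Eventually.of_forall fun t ht => ?_))
  exact (G (φ t)).le_of_opNorm_le (hb _ (hφT t ht)) _

theorem intervalIntegrable_conv (hG : IsC0Semigroup G) {g : ℝ → H} {T : ℝ} (hT : 0 ≤ T)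
    (hg : IntervalIntegrable g volume 0 T) :
    IntervalIntegrable (fun s => G (T - s) (g s)) volume 0 T := by
  rw [intervalIntegrable_iff_integrableOn_Ioc_of_le hT] at hg ⊢
  exact hG.integrableOn_comp measurableSet_Ioc (φ := fun s => T - s) (by fun_prop) (T := T)
    (fun s hs => ⟨by linarith [hs.2], by linarith [hs.1]⟩) hg

/-- Fubini's theorem for the convolution with the semigroup. -/
theorem conv_fubini (hG : IsC0Semigroup G) {c : ℝ → ℝ} (hc : Continuous c) {g : ℝ → H} {T : ℝ}
    (hT : 0 ≤ T) (hg : IntervalIntegrable g volume 0 T) :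
    IntervalIntegrable (fun t => c t • ∫ s in (0 : ℝ)..t, G (t - s) (g s)) volume 0 T ∧
    IntervalIntegrable (fun s => ∫ t in s..T, c t • G (t - s) (g s)) volume 0 T ∧
    ∫ t in (0 : ℝ)..T, c t • ∫ s in (0 : ℝ)..t, G (t - s) (g s) =
      ∫ s in (0 : ℝ)..T, ∫ t in s..T, c t • G (t - s) (g s) := by
  rw [intervalIntegrable_iff_integrableOn_Ioc_of_le hT] at hg
  obtain ⟨M, hM, hb⟩ := hG.exists_norm_le T
  obtain ⟨K, hK⟩ := (isCompact_Icc (a := (0 : ℝ)) (b := T)).exists_bound_of_continuousOn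
    hc.continuousOn
  have hK0 : 0 ≤ K := (norm_nonneg _).trans (hK 0 ⟨le_rfl, hT⟩)
  -- Truncating `t - s` at zero extends the kernel measurably from the triangle `s ≤ t` to the
  -- square; the added values never enter the integrals.
  have hi : Integrable (Function.uncurry fun s t => c t • G (max (t - s) 0) (g s))
      ((volume.restrict (Ioc 0 T)).prod (volume.restrict (Ioc 0 T))) := by
    have hm : AEStronglyMeasurable (fun p : ℝ × ℝ => c p.2 • G (max (p.2 - p.1) 0) (g p.1))
        ((volume.restrict (Ioc 0 T)).prod (volume.restrict (Ioc 0 T))) := by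
      refine AEStronglyMeasurable.smul
        (by fun_prop : Continuous fun p : ℝ × ℝ => c p.2).aestronglyMeasurable ?_
      exact hG.aestronglyMeasurable_comp
        (by fun_prop : Continuous fun p : ℝ × ℝ => p.2 - p.1).aestronglyMeasurable hg.1.comp_fst
    refine Integrable.mono' ((hg.norm.const_mul (K * M)).comp_fst _) hm ?_
    rw [Measure.prod_restrict]
    refine (ae_restrict_iff' (measurableSet_Ioc.prod measurableSet_Ioc)).2
      (Eventually.of_forall fun p hp => ?_)
    simp only [Function.uncurry]
    rw [norm_smul, mul_assoc]
    refine mul_le_mul (hK _ ⟨hp.2.1.le, hp.2.2⟩) ((G _).le_of_opNorm_le (hb _ ⟨le_max_right _ _, ?_⟩) _)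
      (norm_nonneg _) hK0
    exact max_le (by linarith [hp.1.1, hp.2.2]) hT
  have e1 : ∀ t ∈ Ioc (0 : ℝ) T, ∫ s in (0 : ℝ)..t, c t • G (max (t - s) 0) (g s) =
      c t • ∫ s in (0 : ℝ)..t, G (t - s) (g s) := by
    intro t ht
    rw [← intervalIntegral.integral_smul]
    refine intervalIntegral.integral_congr fun s hs => ?_
    rw [uIcc_of_le ht.1.le] at hs
    simp only [max_eq_left (sub_nonneg.2 hs.2)]
  have e2 : ∀ s ∈ Ioc (0 : ℝ) T, ∫ t in s..T, c t • G (max (t - s) 0) (g s) =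
      ∫ t in s..T, c t • G (t - s) (g s) := by
    intro s hs
    refine intervalIntegral.integral_congr fun t ht => ?_
    rw [uIcc_of_le hs.2] at ht
    simp only [max_eq_left (sub_nonneg.2 ht.1)]
  obtain ⟨h1, h2, h3⟩ := integral_triangle hT hi
  refine ⟨h1.congr ?_, h2.congr ?_, ?_⟩
  · rw [uIoc_of_le hT]; exact e1
  · rw [uIoc_of_le hT]; exact e2
  · rw [intervalIntegral.integral_of_le hT, intervalIntegral.integral_of_le hT] at h3 ⊢
    rw [setIntegral_congr_fun measurableSet_Ioc e1, setIntegral_congr_fun measurableSet_Ioc e2] at h3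
    exact h3

/-- The weighted integral of a mild solution on `[0, T]` lies in the domain of the generator. -/
theorem conv_mem_graph (hG : IsC0Semigroup G) {A : H →ₗ.[ℝ] H} (hA : IsGenerator A G)
    {c c' : ℝ → ℝ} (hc : ∀ t, HasDerivAt c (c' t) t) (hc' : Continuous c') {g : ℝ → H} {T : ℝ}
    (hT : 0 ≤ T) (hg : IntervalIntegrable g volume 0 T) :
    (∫ t in (0 : ℝ)..T, c t • ∫ s in (0 : ℝ)..t, G (t - s) (g s),
      c T • (∫ s in (0 : ℝ)..T, G (T - s) (g s)) - (∫ s in (0 : ℝ)..T, c s • g s) -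
        ∫ t in (0 : ℝ)..T, c' t • ∫ s in (0 : ℝ)..t, G (t - s) (g s)) ∈ A.graph := by
  have hcc : Continuous c := continuous_iff_continuousAt.2 fun t => (hc t).continuousAt
  obtain ⟨-, i1, e1⟩ := hG.conv_fubini hcc hT hg
  obtain ⟨-, i2, e2⟩ := hG.conv_fubini hc' hT hg
  have i3 := hG.intervalIntegrable_conv hT hg
  have i3' : IntervalIntegrable (fun s => c T • G (T - s) (g s)) volume 0 T := i3.smul (c T)
  have i4 : IntervalIntegrable (fun s => c s • g s) volume 0 T := hg.continuousOn_smul hcc.continuousOn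
  rw [e1, e2, ← intervalIntegral.integral_smul,
    ← intervalIntegral.integral_sub i3' i4,
    ← intervalIntegral.integral_sub (i3'.sub i4) i2]
  refine hG.intervalIntegral_mem_graph hA hT i1 ((i3'.sub i4).sub i2) fun s hs => ?_
  -- After Fubini, for fixed `s` the inner integral runs along the orbit of `g s`, so integration by
  -- parts applies with the weight delayed by `s`.
  have := hG.weightedIntegral_mem_graph hA (c := fun r => c (r + s)) (c' := fun r => c' (r + s))
    (fun t => (hc (t + s)).comp_add_const t s) (by fun_prop) (g s) (sub_nonneg.2 hs.2)
  have sub : ∀ d : ℝ → ℝ, ∫ r in (0 : ℝ)..(T - s), d (r + s) • G r (g s) =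
      ∫ t in s..T, d t • G (t - s) (g s) := by
    intro d
    have := intervalIntegral.integral_comp_add_right (a := 0) (b := T - s)
      (fun t => d t • G (t - s) (g s)) s
    simpa using this
  rw [sub, sub] at this
  simpa using this

end IsC0Semigroup

/-- An integrable function need not vanish at infinity, but `{‖f‖ ≥ 1 / (n + 1)}` has finite measure
and cannot contain `(n, ∞)`. Such sequences are used to remove boundary terms. -/
theorem exists_seq_tendsto_zero {E : Type*} [NormedAddCommGroup E] {f : ℝ → E}
    (hf : IntegrableOn f (Ioi 0)) :
    ∃ u : ℕ → ℝ, (∀ n, 0 ≤ u n) ∧ Tendsto u atTop atTop ∧ Tendsto (fun n => f (u n)) atTop (𝓝 0) := by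
  have hex : ∀ n : ℕ, ∃ t : ℝ, (n : ℝ) < t ∧ ‖f t‖ ≤ 1 / ((n : ℝ) + 1) := by
    intro n
    by_contra! hcon
    have hn : (0 : ℝ) < 1 / ((n : ℝ) + 1) := by positivity
    have h1 := hf.measure_norm_ge_lt_top hn
    have h2 : Ioi (n : ℝ) ⊆ {t | 1 / ((n : ℝ) + 1) ≤ ‖f t‖} := fun t ht => (hcon t ht).le
    have h3 : volume.restrict (Ioi (0 : ℝ)) (Ioi (n : ℝ)) = ⊤ := by
      rw [Measure.restrict_apply measurableSet_Ioi, Ioi_inter_Ioi, Real.volume_Ioi]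
    exact absurd ((measure_mono h2).trans_lt h1) (by rw [h3]; exact lt_irrefl _)
  choose u hu hf' using hex
  refine ⟨u, fun n => (Nat.cast_nonneg n).trans (hu n).le, ?_, ?_⟩
  · exact tendsto_atTop_mono (fun n => (hu n).le) tendsto_natCast_atTop_atTop
  · exact squeeze_zero_norm hf' tendsto_one_div_add_atTop_nhds_zero_nat

/-- The weighted integral of a mild solution over the half-line lies in the domain of the
generator. -/
theorem IsC0Semigroup.laplace_mem_graph (hG : IsC0Semigroup G) {A : H →ₗ.[ℝ] H}
    (hA : IsGenerator A G) {c c' b : ℝ → ℝ} (hc : ∀ t, HasDerivAt c (c' t) t)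
    (hc' : Continuous c') (hcb : ∀ t, |c t| ≤ |b t|) {w g : ℝ → H}
    (hw : ∀ᵐ t ∂halfLine, w t = ∫ s in (0 : ℝ)..t, G (t - s) (g s))
    (hg : ∀ T, 0 ≤ T → IntervalIntegrable g volume 0 T)
    (h0 : IntegrableOn (fun t => b t • w t) (Ioi 0))
    (h1 : IntegrableOn (fun t => c t • w t) (Ioi 0))
    (h2 : IntegrableOn (fun t => c' t • w t) (Ioi 0))
    (h3 : IntegrableOn (fun t => c t • g t) (Ioi 0)) :
    (∫ t in Ioi 0, c t • w t, -(∫ t in Ioi 0, c t • g t) - ∫ t in Ioi 0, c' t • w t) ∈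
      A.graph := by
  set y : ℝ → H := fun t => ∫ s in (0 : ℝ)..t, G (t - s) (g s) with hy
  have hcongr : ∀ d : ℝ → ℝ, (fun t => d t • w t) =ᵐ[halfLine] fun t => d t • y t := by
    intro d
    filter_upwards [hw] with t ht
    rw [ht]
  have h0' : IntegrableOn (fun t => b t • y t) (Ioi 0) := Integrable.congr h0 (hcongr b)
  have h1' : IntegrableOn (fun t => c t • y t) (Ioi 0) := Integrable.congr h1 (hcongr c)
  have h2' : IntegrableOn (fun t => c' t • y t) (Ioi 0) := Integrable.congr h2 (hcongr c')
  rw [integral_congr_ae (hcongr c), integral_congr_ae (hcongr c')]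
  -- The boundary term `c(T) y(T)` tends to zero along a sequence of times; closedness of the graph
  -- carries the finite-time formula to the limit.
  obtain ⟨u, hu0, hu, hlim⟩ := exists_seq_tendsto_zero h0'
  have hlim' : Tendsto (fun n => c (u n) • y (u n)) atTop (𝓝 0) := by
    refine squeeze_zero_norm (fun n => ?_) (tendsto_norm_zero.comp hlim)
    simp only [Function.comp, norm_smul, Real.norm_eq_abs]
    exact mul_le_mul_of_nonneg_right (hcb _) (norm_nonneg _)
  have l1 := intervalIntegral_tendsto_integral_Ioi 0 h1' hu
  have l2 := intervalIntegral_tendsto_integral_Ioi 0 h2' hu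
  have l3 := intervalIntegral_tendsto_integral_Ioi 0 h3 hu
  have l4 := (hlim'.sub l3).sub l2
  rw [zero_sub] at l4
  exact hG.mem_graph_of_tendsto hA l1 l4 (Eventually.of_forall fun n =>
    hG.conv_mem_graph hA hc hc' (hu0 n) (hg _ (hu0 n)))

/-- The pairing of a mild solution of `v' = A v + g` with a mild solution of `η' = -A* η + h`. -/
theorem IsC0Semigroup.pairing (hG : IsC0Semigroup G) {T : ℝ} (hT : 0 ≤ T) {v η g h : ℝ → H}
    (hg : IntervalIntegrable g volume 0 T) (hh : IntervalIntegrable h volume 0 T)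
    (hv : ∀ t ∈ Icc 0 T, v t = G t (v 0) + ∫ s in (0 : ℝ)..t, G (t - s) (g s))
    (hη : ∀ s ∈ Icc 0 T, η s = ContinuousLinearMap.adjoint (G (T - s)) (η T) -
      ∫ τ in s..T, ContinuousLinearMap.adjoint (G (τ - s)) (h τ)) :
    IntervalIntegrable (fun t => ⟪h t, v t⟫ + ⟪η t, g t⟫) volume 0 T ∧
    ∫ t in (0 : ℝ)..T, (⟪h t, v t⟫ + ⟪η t, g t⟫) = ⟪η T, v T⟫ - ⟪η 0, v 0⟫ := by
  have hG' := hG.adjoint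
  have hgo := (intervalIntegrable_iff_integrableOn_Ioc_of_le hT).1 hg
  have hho := (intervalIntegrable_iff_integrableOn_Ioc_of_le hT).1 hh
  obtain ⟨M, hM, hb⟩ := hG.exists_norm_le T
  have hi : Integrable (Function.uncurry fun s t => ⟪h t, G (max (t - s) 0) (g s)⟫)
      ((volume.restrict (Ioc 0 T)).prod (volume.restrict (Ioc 0 T))) := by
    have hm : AEStronglyMeasurable (fun p : ℝ × ℝ => ⟪h p.2, G (max (p.2 - p.1) 0) (g p.1)⟫)
        ((volume.restrict (Ioc 0 T)).prod (volume.restrict (Ioc 0 T))) := by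
      refine AEStronglyMeasurable.inner hho.1.comp_snd ?_
      exact hG.aestronglyMeasurable_comp
        (by fun_prop : Continuous fun p : ℝ × ℝ => p.2 - p.1).aestronglyMeasurable hgo.1.comp_fst
    refine Integrable.mono' ((hgo.norm.const_mul M).mul_prod hho.norm) hm ?_
    rw [Measure.prod_restrict]
    refine (ae_restrict_iff' (measurableSet_Ioc.prod measurableSet_Ioc)).2
      (Eventually.of_forall fun p hp => ?_)
    refine (norm_inner_le_norm _ _).trans ?_
    rw [mul_comm]
    gcongr
    exact (G _).le_of_opNorm_le (hb _ ⟨le_max_right _ _,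
      max_le (by linarith [hp.1.1, hp.2.2]) hT⟩) _
  obtain ⟨j1, j2, j3⟩ := integral_triangle hT hi
  have e1 : ∀ t ∈ Ioc (0 : ℝ) T, ∫ s in (0 : ℝ)..t, ⟪h t, G (max (t - s) 0) (g s)⟫ =
      ⟪h t, ∫ s in (0 : ℝ)..t, G (t - s) (g s)⟫ := by
    intro t ht
    have hgt := hG.intervalIntegrable_conv ht.1.le (hg.mono_set (by
      rw [uIcc_of_le ht.1.le, uIcc_of_le hT]; exact Icc_subset_Icc_right ht.2))
    have := ContinuousLinearMap.intervalIntegral_comp_comm (innerSL ℝ (h t)) hgt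
    rw [innerSL_apply_apply] at this
    rw [← this]
    refine intervalIntegral.integral_congr fun s hs => ?_
    rw [uIcc_of_le ht.1.le] at hs
    simp only [max_eq_left (sub_nonneg.2 hs.2), innerSL_apply_apply]
  have hadj : ∀ s ∈ Icc (0 : ℝ) T, IntervalIntegrable
      (fun τ => ContinuousLinearMap.adjoint (G (τ - s)) (h τ)) volume s T := by
    intro s hs
    rw [intervalIntegrable_iff_integrableOn_Ioc_of_le hs.2]
    exact hG'.integrableOn_comp measurableSet_Ioc (φ := fun τ => τ - s) (by fun_prop) (T := T)
      (fun τ hτ => ⟨by linarith [hτ.1], by linarith [hs.1, hτ.2]⟩)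
      (hho.mono_set (Ioc_subset_Ioc_left hs.1))
  have e2 : ∀ s ∈ Ioc (0 : ℝ) T, ∫ t in s..T, ⟪h t, G (max (t - s) 0) (g s)⟫ =
      ⟪∫ τ in s..T, ContinuousLinearMap.adjoint (G (τ - s)) (h τ), g s⟫ := by
    intro s hs
    have := ContinuousLinearMap.intervalIntegral_comp_comm (innerSL ℝ (g s))
      (hadj s ⟨hs.1.le, hs.2⟩)
    rw [innerSL_apply_apply, real_inner_comm] at this
    rw [← this]
    refine intervalIntegral.integral_congr fun t ht => ?_
    rw [uIcc_of_le hs.2] at ht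
    simp only [max_eq_left (sub_nonneg.2 ht.1), innerSL_apply_apply]
    rw [ContinuousLinearMap.adjoint_inner_right, real_inner_comm]
  have k1 : IntervalIntegrable (fun t => ⟪h t, ∫ s in (0 : ℝ)..t, G (t - s) (g s)⟫) volume 0 T :=
    j1.congr (by rw [uIoc_of_le hT]; exact e1)
  have k2 : IntervalIntegrable
      (fun s => ⟪∫ τ in s..T, ContinuousLinearMap.adjoint (G (τ - s)) (h τ), g s⟫) volume 0 T :=
    j2.congr (by rw [uIoc_of_le hT]; exact e2)
  have k3 : ∫ t in (0 : ℝ)..T, ⟪h t, ∫ s in (0 : ℝ)..t, G (t - s) (g s)⟫ =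
      ∫ s in (0 : ℝ)..T, ⟪∫ τ in s..T, ContinuousLinearMap.adjoint (G (τ - s)) (h τ), g s⟫ := by
    rw [intervalIntegral.integral_of_le hT, intervalIntegral.integral_of_le hT] at j3 ⊢
    rw [setIntegral_congr_fun measurableSet_Ioc e1,
      setIntegral_congr_fun measurableSet_Ioc e2] at j3
    exact j3
  have hgT := hG.intervalIntegrable_conv hT hg
  have m1 : IntervalIntegrable (fun s => ⟪η T, G (T - s) (g s)⟫) volume 0 T :=
    ⟨(innerSL ℝ (η T)).integrable_comp hgT.1, (innerSL ℝ (η T)).integrable_comp hgT.2⟩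
  have m2 : ∫ s in (0 : ℝ)..T, ⟪η T, G (T - s) (g s)⟫ =
      ⟪η T, ∫ s in (0 : ℝ)..T, G (T - s) (g s)⟫ :=
    ContinuousLinearMap.intervalIntegral_comp_comm (innerSL ℝ (η T)) hgT
  have had0 := hadj 0 ⟨le_rfl, hT⟩
  simp only [sub_zero] at had0
  have n0 : ∀ t, ⟪v 0, ContinuousLinearMap.adjoint (G t) (h t)⟫ = ⟪h t, G t (v 0)⟫ := fun t => by
    rw [ContinuousLinearMap.adjoint_inner_right, real_inner_comm]
  have n1 : IntervalIntegrable (fun t => ⟪h t, G t (v 0)⟫) volume 0 T := by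
    have : IntervalIntegrable (fun t => innerSL ℝ (v 0) (ContinuousLinearMap.adjoint (G t) (h t)))
        volume 0 T :=
      ⟨(innerSL ℝ (v 0)).integrable_comp had0.1, (innerSL ℝ (v 0)).integrable_comp had0.2⟩
    simpa only [innerSL_apply_apply, n0] using this
  have n2 : ∫ t in (0 : ℝ)..T, ⟪h t, G t (v 0)⟫ =
      ⟪v 0, ∫ t in (0 : ℝ)..T, ContinuousLinearMap.adjoint (G t) (h t)⟫ := by
    have := ContinuousLinearMap.intervalIntegral_comp_comm (innerSL ℝ (v 0)) had0
    simpa only [innerSL_apply_apply, n0] using this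
  -- Formally the integrand is `d/dt ⟨η, v⟩`, but mild solutions need not be differentiable.
  -- Inserting both Cauchy formulas leaves two double integrals, equal by Fubini (`k3`) and of
  -- opposite signs, and boundary terms.
  have hfun : ∀ t ∈ Ioc (0 : ℝ) T,
      ⟪h t, G t (v 0)⟫ + ⟪h t, ∫ s in (0 : ℝ)..t, G (t - s) (g s)⟫ + (⟪η T, G (T - t) (g t)⟫ -
        ⟪∫ τ in t..T, ContinuousLinearMap.adjoint (G (τ - t)) (h τ), g t⟫) =
      ⟪h t, v t⟫ + ⟪η t, g t⟫ := by
    intro t ht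
    have ht' : t ∈ Icc 0 T := ⟨ht.1.le, ht.2⟩
    rw [hv t ht', hη t ht', inner_add_right, inner_sub_left,
      ContinuousLinearMap.adjoint_inner_left]
  constructor
  · exact ((n1.add k1).add (m1.sub k2)).congr (by rw [uIoc_of_le hT]; exact hfun)
  · have hT1 := hv T ⟨hT, le_rfl⟩
    have hη0 := hη 0 ⟨le_rfl, hT⟩
    simp only [sub_zero] at hη0
    rw [intervalIntegral.integral_of_le hT, ← setIntegral_congr_fun measurableSet_Ioc hfun,
      ← intervalIntegral.integral_of_le hT, intervalIntegral.integral_add (n1.add k1) (m1.sub k2),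
      intervalIntegral.integral_add n1 k1, intervalIntegral.integral_sub m1 k2, k3, m2, n2]
    rw [hT1, hη0, inner_add_right, inner_sub_left, ContinuousLinearMap.adjoint_inner_left,
      real_inner_comm (v 0)]
    ring

/-! ### Coercivity of the cost, from weighted forced trajectories to processes. -/

theorem continuous_quadForm :
    Continuous fun p : H × U => quadForm F₁ F₂ F₃ p.1 p.2 := by
  unfold quadForm
  fun_prop

theorem integrable_norm_sq {E : Type*} [NormedAddCommGroup E] {μ : Measure ℝ} {x : ℝ → E}
    (hx : MemLp x 2 μ) : Integrable (fun t => ‖x t‖ ^ 2) μ :=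
  (memLp_two_iff_integrable_sq_norm hx.1).1 hx

theorem integrable_quadForm {μ : Measure ℝ} {x : ℝ → H} {y : ℝ → U} (hx : MemLp x 2 μ)
    (hy : MemLp y 2 μ) : Integrable (fun t => quadForm F₁ F₂ F₃ (x t) (y t)) μ := by
  refine Integrable.mono' (((integrable_norm_sq hx).add (integrable_norm_sq hy)).const_mul
    (2 * formBound F₁ F₂ F₃)) ?_ (Eventually.of_forall fun t => ?_)
  · exact continuous_quadForm.comp_aestronglyMeasurable (hx.1.prodMk hy.1)
  · refine (abs_quadForm_le (x t) (y t)).trans ?_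
    simp only [Pi.add_apply]
    have := formBound_pos (F₁ := F₁) (F₂ := F₂) (F₃ := F₃)
    rw [mul_comm 2, mul_assoc]
    gcongr
    linarith [sq_nonneg (‖x t‖ - ‖y t‖)]

theorem integrable_inner {E : Type*} [NormedAddCommGroup E] [InnerProductSpace ℝ E]
    {μ : Measure ℝ} {x y : ℝ → E} (hx : MemLp x 2 μ) (hy : MemLp y 2 μ) :
    Integrable (fun t => ⟪x t, y t⟫) μ := by
  refine Integrable.mono' ((integrable_norm_sq hx).add (integrable_norm_sq hy))
    (hx.1.inner hy.1) (Eventually.of_forall fun t => (norm_inner_le_norm _ _).trans ?_)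
  simp only [Pi.add_apply]
  nlinarith [sq_nonneg (‖x t‖ - ‖y t‖), sq_nonneg (‖x t‖ + ‖y t‖)]

/-- Plancherel's theorem for the quadratic form. -/
theorem integral_quadForm_transform {x : ℝ → H} {y : ℝ → U} (hx : Integrable x)
    (hx2 : MemLp x 2) (hy : Integrable y) (hy2 : MemLp y 2) :
    Integrable (fun ν => quadForm F₁ F₂ F₃ (cosTransform x ν) (cosTransform y ν) +
        quadForm F₁ F₂ F₃ (sinTransform x ν) (sinTransform y ν)) ∧
      ∫ ν, (quadForm F₁ F₂ F₃ (cosTransform x ν) (cosTransform y ν) +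
        quadForm F₁ F₂ F₃ (sinTransform x ν) (sinTransform y ν)) =
        ∫ t, quadForm F₁ F₂ F₃ (x t) (y t) := by
  obtain ⟨i1, e1⟩ := integral_inner_transform (F₁.integrable_comp hx) (F₁.comp_memLp' hx2) hx hx2
  obtain ⟨i2, e2⟩ := integral_inner_transform (F₂.integrable_comp hx) (F₂.comp_memLp' hx2) hy hy2
  obtain ⟨i3, e3⟩ := integral_inner_transform ((F₃ : U →L[ℝ] U).integrable_comp hy)
    ((F₃ : U →L[ℝ] U).comp_memLp' hy2) hy hy2
  simp only [cosTransform_clm _ hx, sinTransform_clm _ hx, cosTransform_clm _ hy,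
    sinTransform_clm _ hy] at i1 e1 i2 e2 i3 e3
  have hfun : ∀ ν, (⟪F₁ (cosTransform x ν), cosTransform x ν⟫ +
        ⟪F₁ (sinTransform x ν), sinTransform x ν⟫) +
      2 * (⟪F₂ (cosTransform x ν), cosTransform y ν⟫ +
        ⟪F₂ (sinTransform x ν), sinTransform y ν⟫) +
      (⟪(F₃ : U →L[ℝ] U) (cosTransform y ν), cosTransform y ν⟫ +
        ⟪(F₃ : U →L[ℝ] U) (sinTransform y ν), sinTransform y ν⟫) =
      quadForm F₁ F₂ F₃ (cosTransform x ν) (cosTransform y ν) +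
        quadForm F₁ F₂ F₃ (sinTransform x ν) (sinTransform y ν) := by
    intro ν
    simp only [quadForm, ContinuousLinearEquiv.coe_coe]; ring
  constructor
  · exact ((i1.add (i2.const_mul 2)).add i3).congr (Eventually.of_forall hfun)
  · have m1 : Integrable (fun t => ⟪F₁ (x t), x t⟫) := integrable_inner (F₁.comp_memLp' hx2) hx2
    have m2 : Integrable (fun t => ⟪F₂ (x t), y t⟫) := integrable_inner (F₂.comp_memLp' hx2) hy2
    have m3 : Integrable (fun t => ⟪(F₃ : U →L[ℝ] U) (y t), y t⟫) :=
      integrable_inner ((F₃ : U →L[ℝ] U).comp_memLp' hy2) hy2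
    have s1 := integral_add (i1.add (i2.const_mul 2)) i3
    have s2 := integral_add (m1.add (m2.const_mul 2)) m3
    simp only [Pi.add_apply] at s1 s2
    rw [integral_add i1 (i2.const_mul 2), integral_const_mul, e1, e2, e3] at s1
    rw [integral_add m1 (m2.const_mul 2), integral_const_mul] at s2
    rw [← integral_congr_ae (Eventually.of_forall hfun), s1, ← s2]
    rfl

theorem integral_norm_sq_transform {x : ℝ → H} (hx : Integrable x) (hx2 : MemLp x 2) :
    Integrable (fun ν => ‖cosTransform x ν‖ ^ 2 + ‖sinTransform x ν‖ ^ 2) ∧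
      ∫ ν, (‖cosTransform x ν‖ ^ 2 + ‖sinTransform x ν‖ ^ 2) = ∫ t, ‖x t‖ ^ 2 := by
  simpa only [real_inner_self_eq_norm_sq] using integral_inner_transform hx hx2 hx hx2

theorem integral_smul_indicator {E : Type*} [NormedAddCommGroup E] [NormedSpace ℝ E] (c : ℝ → ℝ)
    (x : ℝ → E) : ∫ t, c t • (Ioi (0 : ℝ)).indicator x t = ∫ t, c t • x t ∂halfLine := by
  rw [← integral_indicator measurableSet_Ioi]
  congr 1; ext t
  by_cases ht : t ∈ Ioi (0 : ℝ)
  · rw [indicator_of_mem ht, indicator_of_mem ht]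
  · rw [indicator_of_notMem ht, indicator_of_notMem ht, smul_zero]

theorem integral_norm_sq_indicator {E : Type*} [NormedAddCommGroup E] (x : ℝ → E) :
    ∫ t, ‖(Ioi (0 : ℝ)).indicator x t‖ ^ 2 = ∫ t, ‖x t‖ ^ 2 ∂halfLine := by
  rw [← integral_indicator measurableSet_Ioi]
  congr 1; ext t
  by_cases ht : t ∈ Ioi (0 : ℝ)
  · rw [indicator_of_mem ht, indicator_of_mem ht]
  · rw [indicator_of_notMem ht, indicator_of_notMem ht, norm_zero, zero_pow two_ne_zero]

/-- The Fourier transform of an exponentially weighted mild solution solves the resolvent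
equation. -/
theorem transform_mem_graph (hG : IsC0Semigroup G) {A : H →ₗ.[ℝ] H} (hA : IsGenerator A G)
    {a : ℝ} {w g : ℝ → H}
    (hw : ∀ᵐ t ∂halfLine, w t = ∫ s in (0 : ℝ)..t, G (t - s) (g s))
    (hg : ∀ T, 0 ≤ T → IntervalIntegrable g volume 0 T)
    (hw1 : Integrable (fun t => Real.exp (-a * t) • w t) halfLine)
    (hg1 : Integrable (fun t => Real.exp (-a * t) • g t) halfLine) (ν : ℝ) :
    let V := (Ioi (0 : ℝ)).indicator fun t => Real.exp (-a * t) • w t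
    let Γ := (Ioi (0 : ℝ)).indicator fun t => Real.exp (-a * t) • g t
    (cosTransform V ν, -cosTransform Γ ν + a • cosTransform V ν -
        (2 * Real.pi * ν) • sinTransform V ν) ∈ A.graph ∧
      (sinTransform V ν, -sinTransform Γ ν + a • sinTransform V ν +
        (2 * Real.pi * ν) • cosTransform V ν) ∈ A.graph := by
  intro V Γ
  set ω := 2 * Real.pi * ν with hω
  -- `c₁ + i c₂ = exp (-(a + iω) t)`; the derivatives `d₁`, `d₂` are the two components of
  -- multiplication by `-(a + iω)`.
  set c₁ : ℝ → ℝ := fun t => Real.cos (ω * t) * Real.exp (-a * t) with hc₁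
  set c₂ : ℝ → ℝ := fun t => -Real.sin (ω * t) * Real.exp (-a * t) with hc₂
  have hexp : ∀ t, HasDerivAt (fun t => Real.exp (-a * t)) (-a * Real.exp (-a * t)) t := fun t => by
    have := ((hasDerivAt_id t).const_mul (-a)).exp
    convert! this using 1
    simp; ring
  have hcos : ∀ t, HasDerivAt (fun t => Real.cos (ω * t)) (-ω * Real.sin (ω * t)) t := fun t => by
    have := ((hasDerivAt_id t).const_mul ω).cos
    convert! this using 1
    simp; ring
  have hsin : ∀ t, HasDerivAt (fun t => Real.sin (ω * t)) (ω * Real.cos (ω * t)) t := fun t => by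
    have := ((hasDerivAt_id t).const_mul ω).sin
    convert! this using 1
    simp; ring
  have d₁ : ∀ t, HasDerivAt c₁ (-a * c₁ t + ω * c₂ t) t := fun t => by
    refine ((hcos t).mul (hexp t)).congr_deriv ?_
    simp only [hc₁, hc₂]; ring
  have d₂ : ∀ t, HasDerivAt c₂ (-a * c₂ t - ω * c₁ t) t := fun t => by
    refine ((hsin t).fun_neg.mul (hexp t)).congr_deriv ?_
    simp only [hc₁, hc₂]; ring
  have k₁ : Continuous c₁ := continuous_iff_continuousAt.2 fun t => (d₁ t).continuousAt
  have k₂ : Continuous c₂ := continuous_iff_continuousAt.2 fun t => (d₂ t).continuousAt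
  have b₁ : ∀ t, |c₁ t| ≤ |Real.exp (-a * t)| := fun t => by
    rw [abs_mul]
    exact mul_le_of_le_one_left (abs_nonneg _) (Real.abs_cos_le_one _)
  have b₂ : ∀ t, |c₂ t| ≤ |Real.exp (-a * t)| := fun t => by
    rw [abs_mul, abs_neg]
    exact mul_le_of_le_one_left (abs_nonneg _) (Real.abs_sin_le_one _)
  have i₁ : ∀ {x : ℝ → H}, Integrable (fun t => Real.exp (-a * t) • x t) halfLine →
      Integrable (fun t => c₁ t • x t) halfLine := fun hx => by
    simpa only [smul_smul] using integrable_cos_smul hx ν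
  have i₂ : ∀ {x : ℝ → H}, Integrable (fun t => Real.exp (-a * t) • x t) halfLine →
      Integrable (fun t => c₂ t • x t) halfLine := fun hx => by
    simpa only [smul_smul] using integrable_sin_smul hx ν
  have e₁ : ∀ x : ℝ → H, cosTransform ((Ioi (0 : ℝ)).indicator fun t => Real.exp (-a * t) • x t) ν =
      ∫ t, c₁ t • x t ∂halfLine := fun x => by
    unfold cosTransform
    rw [integral_smul_indicator]
    simp only [smul_smul, hc₁, hω]
  have e₂ : ∀ x : ℝ → H, sinTransform ((Ioi (0 : ℝ)).indicator fun t => Real.exp (-a * t) • x t) ν =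
      ∫ t, c₂ t • x t ∂halfLine := fun x => by
    unfold sinTransform
    rw [integral_smul_indicator]
    simp only [smul_smul, hc₂, hω]
  have j₁ : Integrable (fun t => (-a * c₁ t + ω * c₂ t) • w t) halfLine := by
    simpa only [add_smul, mul_smul, Pi.add_def, Pi.smul_def] using
      ((i₁ hw1).smul (-a)).add ((i₂ hw1).smul ω)
  have j₂ : Integrable (fun t => (-a * c₂ t - ω * c₁ t) • w t) halfLine := by
    simpa only [sub_smul, mul_smul, Pi.sub_def, Pi.smul_def] using
      ((i₂ hw1).smul (-a)).sub ((i₁ hw1).smul ω)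
  have r₁ := hG.laplace_mem_graph hA d₁ (by fun_prop) b₁ hw hg hw1 (i₁ hw1) j₁ (i₁ hg1)
  have r₂ := hG.laplace_mem_graph hA d₂ (by fun_prop) b₂ hw hg hw1 (i₂ hw1) j₂ (i₂ hg1)
  have lin : ∀ (p q : ℝ) (c d : ℝ → ℝ), Integrable (fun t => c t • w t) halfLine →
      Integrable (fun t => d t • w t) halfLine → ∫ t, (p * c t + q * d t) • w t ∂halfLine =
        p • (∫ t, c t • w t ∂halfLine) + q • ∫ t, d t • w t ∂halfLine := by
    intro p q c d hc hd
    have h := integral_add (hc.smul p) (hd.smul q)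
    simp only [Pi.smul_apply] at h
    rw [← integral_smul, ← integral_smul, ← h]
    simp only [add_smul, mul_smul]
  have s₁ := lin (-a) ω c₁ c₂ (i₁ hw1) (i₂ hw1)
  have s₂ := lin (-a) (-ω) c₂ c₁ (i₂ hw1) (i₁ hw1)
  simp only [neg_mul ω, ← sub_eq_add_neg] at s₂
  rw [s₁] at r₁
  rw [s₂] at r₂
  simp only [V, Γ, e₁, e₂]
  constructor
  · convert r₁ using 2; module
  · convert r₂ using 2; module

/-- Coercivity for exponentially weighted, forced mild solutions with zero initial value. -/
theorem FrequencyCondition.forced_coercive (hG : IsC0Semigroup G) {A : H →ₗ.[ℝ] H}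
    (hA : IsGenerator A G) {j : ℕ} (hd : HasExponentialDichotomy G j)
    (hfreq : FrequencyCondition A B F₁ F₂ F₃) :
    ∃ δ C a₀ : ℝ, 0 < δ ∧ 0 < C ∧ 0 < a₀ ∧ ∀ a : ℝ, 0 < a → a ≤ a₀ →
      ∀ (w f : ℝ → H) (ξ : ℝ → U),
      (∀ᵐ t ∂halfLine, w t = ∫ s in (0 : ℝ)..t, G (t - s) (B (ξ s) + f s)) →
      (∀ T, 0 ≤ T → IntervalIntegrable (fun s => B (ξ s) + f s) volume 0 T) →
      Integrable (fun t => Real.exp (-a * t) • w t) halfLine →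
      MemLp (fun t => Real.exp (-a * t) • w t) 2 halfLine →
      Integrable (fun t => Real.exp (-a * t) • f t) halfLine →
      MemLp (fun t => Real.exp (-a * t) • f t) 2 halfLine →
      Integrable (fun t => Real.exp (-a * t) • ξ t) halfLine →
      MemLp (fun t => Real.exp (-a * t) • ξ t) 2 halfLine →
      δ * ∫ t, (‖Real.exp (-a * t) • w t‖ ^ 2 + ‖Real.exp (-a * t) • ξ t‖ ^ 2) ∂halfLine ≤
        (∫ t, quadForm F₁ F₂ F₃ (Real.exp (-a * t) • w t) (Real.exp (-a * t) • ξ t) ∂halfLine) +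
          C * ∫ t, ‖Real.exp (-a * t) • f t‖ ^ 2 ∂halfLine := by
  obtain ⟨δ, C, hδ, hC, hrob⟩ := hfreq.robust hG hA hd
  -- The weight replaces `A` by `A - a`. The extra term `-a v` is counted as forcing and costs `2 C
  -- a² ‖v‖²`, which for `a ≤ √(δ / (4 C))` is at most half of the coercivity.
  refine ⟨δ / 2, 2 * C, Real.sqrt (δ / (4 * C)), by positivity, by positivity,
    Real.sqrt_pos.2 (by positivity), ?_⟩
  intro a ha ha₀ w f ξ hw hg hw1 hw2 hf1 hf2 hξ1 hξ2
  have ha2 : 2 * C * a ^ 2 ≤ δ / 2 := by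
    have : a ^ 2 ≤ δ / (4 * C) := by
      rw [← Real.sq_sqrt (by positivity : 0 ≤ δ / (4 * C))]; gcongr
    calc 2 * C * a ^ 2 ≤ 2 * C * (δ / (4 * C)) := by gcongr
      _ = δ / 2 := by field_simp; ring
  set V := (Ioi (0 : ℝ)).indicator fun t => Real.exp (-a * t) • w t with hV
  set Φ := (Ioi (0 : ℝ)).indicator fun t => Real.exp (-a * t) • f t with hΦ
  set Ξ := (Ioi (0 : ℝ)).indicator fun t => Real.exp (-a * t) • ξ t with hΞ
  have hV1 : Integrable V := (integrable_indicator_iff measurableSet_Ioi).2 hw1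
  have hΦ1 : Integrable Φ := (integrable_indicator_iff measurableSet_Ioi).2 hf1
  have hΞ1 : Integrable Ξ := (integrable_indicator_iff measurableSet_Ioi).2 hξ1
  have hV2 : MemLp V 2 := (memLp_indicator_iff_restrict measurableSet_Ioi).2 hw2
  have hΦ2 : MemLp Φ 2 := (memLp_indicator_iff_restrict measurableSet_Ioi).2 hf2
  have hΞ2 : MemLp Ξ 2 := (memLp_indicator_iff_restrict measurableSet_Ioi).2 hξ2
  have hg1 : Integrable (fun t => Real.exp (-a * t) • (B (ξ t) + f t)) halfLine := by
    refine ((B.integrable_comp hξ1).add hf1).congr (Eventually.of_forall fun t => ?_)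
    simp only [Pi.add_apply, map_smul, smul_add]
  have hΓ : ((Ioi (0 : ℝ)).indicator fun t => Real.exp (-a * t) • (B (ξ t) + f t)) =
      fun t => B (Ξ t) + Φ t := by
    ext t
    by_cases ht : t ∈ Ioi (0 : ℝ)
    · simp only [hΞ, hΦ, indicator_of_mem ht, map_smul, smul_add]
    · simp only [hΞ, hΦ, indicator_of_notMem ht, map_zero, add_zero]
  obtain ⟨iF, eF⟩ := integral_quadForm_transform (F₁ := F₁) (F₂ := F₂) (F₃ := F₃) hV1 hV2 hΞ1 hΞ2
  obtain ⟨iV, eV⟩ := integral_norm_sq_transform hV1 hV2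
  obtain ⟨iΦ, eΦ⟩ := integral_norm_sq_transform hΦ1 hΦ2
  obtain ⟨iΞ, eΞ⟩ := integral_norm_sq_transform hΞ1 hΞ2
  have hpt : ∀ ν, δ / 2 * ((‖cosTransform V ν‖ ^ 2 + ‖sinTransform V ν‖ ^ 2) +
      (‖cosTransform Ξ ν‖ ^ 2 + ‖sinTransform Ξ ν‖ ^ 2)) ≤
      (quadForm F₁ F₂ F₃ (cosTransform V ν) (cosTransform Ξ ν) +
        quadForm F₁ F₂ F₃ (sinTransform V ν) (sinTransform Ξ ν)) +
      2 * C * (‖cosTransform Φ ν‖ ^ 2 + ‖sinTransform Φ ν‖ ^ 2) := by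
    intro ν
    obtain ⟨m₁, m₂⟩ := transform_mem_graph hG hA hw hg hw1 hg1 ν
    have hBΞ := B.integrable_comp hΞ1
    simp only [hΓ, cosTransform_add hBΞ hΦ1, sinTransform_add hBΞ hΦ1, cosTransform_clm B hΞ1,
      sinTransform_clm B hΞ1, ← hV] at m₁ m₂
    have := hrob (2 * Real.pi * ν) (cosTransform Ξ ν) (sinTransform Ξ ν)
      (cosTransform Φ ν - a • cosTransform V ν) (sinTransform Φ ν - a • sinTransform V ν)
      _ _ _ _ m₁ m₂ (by abel) (by abel)
    have sq : ∀ x y : H, ‖x - a • y‖ ^ 2 ≤ 2 * ‖x‖ ^ 2 + 2 * a ^ 2 * ‖y‖ ^ 2 := by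
      intro x y
      have h1 : ‖x - a • y‖ ≤ ‖x‖ + a * ‖y‖ := by
        refine (norm_sub_le _ _).trans ?_
        rw [norm_smul, Real.norm_of_nonneg ha.le]
      have h2 : ‖x - a • y‖ ^ 2 ≤ (‖x‖ + a * ‖y‖) ^ 2 := by gcongr
      linarith [sq_nonneg (‖x‖ - a * ‖y‖)]
    have q₁ := mul_le_mul_of_nonneg_left
      (add_le_add (sq (cosTransform Φ ν) (cosTransform V ν))
        (sq (sinTransform Φ ν) (sinTransform V ν))) hC.le
    have q₂ := mul_le_mul_of_nonneg_right ha2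
      (by positivity : 0 ≤ ‖cosTransform V ν‖ ^ 2 + ‖sinTransform V ν‖ ^ 2)
    have q₃ : 0 ≤ δ / 2 * (‖cosTransform Ξ ν‖ ^ 2 + ‖sinTransform Ξ ν‖ ^ 2) := by positivity
    linarith
  have hint := integral_mono ((iV.add iΞ).const_mul (δ / 2)) (iF.add (iΦ.const_mul (2 * C))) hpt
  have backF : ∫ t, quadForm F₁ F₂ F₃ (V t) (Ξ t) =
      ∫ t, quadForm F₁ F₂ F₃ (Real.exp (-a * t) • w t) (Real.exp (-a * t) • ξ t) ∂halfLine := by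
    rw [← integral_indicator measurableSet_Ioi]
    congr 1; ext t
    by_cases ht : t ∈ Ioi (0 : ℝ)
    · rw [hV, hΞ, indicator_of_mem ht, indicator_of_mem ht, indicator_of_mem ht]
    · rw [hV, hΞ, indicator_of_notMem ht, indicator_of_notMem ht, indicator_of_notMem ht]
      simp [quadForm]
  simp only [Pi.add_apply] at hint
  rw [integral_const_mul, integral_add iV iΞ, integral_add iF (iΦ.const_mul _),
    integral_const_mul, eV, eΞ, eF, eΦ, backF, hV, hΞ, hΦ, integral_norm_sq_indicator,
    integral_norm_sq_indicator, integral_norm_sq_indicator] at hint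
  rw [integral_add (integrable_norm_sq hw2) (integrable_norm_sq hξ2)]
  exact hint

/-- A function that is bounded by `K` on `(0, 1]` and vanishes on `(1, ∞)` is in `L¹ ∩ L²`. -/
theorem integrable_of_bounded_support {E : Type*} [NormedAddCommGroup E] {x : ℝ → E} {K : ℝ}
    (hx : AEStronglyMeasurable x halfLine) (h0 : ∀ t, 1 < t → x t = 0)
    (h1 : ∀ t ∈ Ioc (0 : ℝ) 1, ‖x t‖ ≤ K) :
    Integrable x halfLine ∧ MemLp x 2 halfLine ∧ ∫ t, ‖x t‖ ^ 2 ∂halfLine ≤ K ^ 2 := by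
  have hi : ∀ c : ℝ, Integrable ((Ioc (0 : ℝ) 1).indicator fun _ => c) halfLine := fun c => by
    refine (integrable_indicator_iff measurableSet_Ioc).2 ?_
    rw [IntegrableOn, Measure.restrict_restrict measurableSet_Ioc]
    exact integrableOn_const (by
      refine ne_of_lt ((measure_mono inter_subset_left).trans_lt ?_)
      rw [Real.volume_Ioc]; exact ENNReal.ofReal_lt_top)
  have b : ∀ᵐ t ∂halfLine, ‖x t‖ ≤ (Ioc (0 : ℝ) 1).indicator (fun _ => K) t ∧
      ‖x t‖ ^ 2 ≤ (Ioc (0 : ℝ) 1).indicator (fun _ => K ^ 2) t := by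
    refine (ae_restrict_iff' measurableSet_Ioi).2 (Eventually.of_forall fun t ht => ?_)
    by_cases h : t ∈ Ioc (0 : ℝ) 1
    · rw [indicator_of_mem h, indicator_of_mem h]
      have := h1 t h
      exact ⟨this, by gcongr⟩
    · have h2 : 1 < t := by
        by_contra hcon
        exact h ⟨ht, not_lt.1 hcon⟩
      rw [indicator_of_notMem h, indicator_of_notMem h, h0 t h2]
      simp
  have i2 : Integrable (fun t => ‖x t‖ ^ 2) halfLine :=
    (hi (K ^ 2)).mono' (hx.norm.pow 2) (b.mono fun t ht => by
      rw [Real.norm_of_nonneg (by positivity)]; exact ht.2)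
  refine ⟨(hi K).mono' hx (b.mono fun t ht => ht.1),
    (memLp_two_iff_integrable_sq_norm hx).2 i2, ?_⟩
  refine (integral_mono_ae i2 (hi (K ^ 2)) (b.mono fun t ht => ht.2)).trans ?_
  rw [setIntegral_indicator measurableSet_Ioc, inter_eq_right.2 Ioc_subset_Ioi_self]
  simp

/-- By the semigroup law the integrand is the constant `G(t) v₀` for `0 < s ≤ min t 1` and zero
afterwards. -/
theorem IsC0Semigroup.integral_conv_orbit (hG : IsC0Semigroup G) (v₀ : H) {t : ℝ} (ht : 0 ≤ t) :
    ∫ s in (0 : ℝ)..t, G (t - s) ((Ioc (0 : ℝ) 1).indicator (fun s => G (max s 0) v₀) s) =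
      min t 1 • G t v₀ := by
  have h : ∀ s ∈ Ioc (0 : ℝ) t,
      G (t - s) ((Ioc (0 : ℝ) 1).indicator (fun s => G (max s 0) v₀) s) =
        (Iic (1 : ℝ)).indicator (fun _ => G t v₀) s := by
    intro s hs
    by_cases h1 : s ≤ 1
    · rw [indicator_of_mem (show s ∈ Ioc (0 : ℝ) 1 from ⟨hs.1, h1⟩), indicator_of_mem (mem_Iic.2 h1),
        max_eq_left hs.1.le, ← hG.map_add_apply (sub_nonneg.2 hs.2) hs.1.le, sub_add_cancel]
    · rw [indicator_of_notMem (show s ∉ Ioc (0 : ℝ) 1 from fun h => h1 h.2),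
        indicator_of_notMem (show s ∉ Iic (1 : ℝ) from h1), _root_.map_zero]
  rw [intervalIntegral.integral_of_le ht, setIntegral_congr_fun measurableSet_Ioc h,
    setIntegral_indicator measurableSet_Iic, Ioc_inter_Iic, setIntegral_const]
  congr 1
  rw [Measure.real, Real.volume_Ioc, sub_zero, ENNReal.toReal_ofReal (le_min ht zero_le_one)]

/-- Coercivity for exponentially weighted mild solutions. -/
theorem FrequencyCondition.weighted_coercive (hG : IsC0Semigroup G) {A : H →ₗ.[ℝ] H}
    (hA : IsGenerator A G) {j : ℕ} (hd : HasExponentialDichotomy G j)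
    (hfreq : FrequencyCondition A B F₁ F₂ F₃) :
    ∃ δ C a₀ : ℝ, 0 < δ ∧ 0 < C ∧ 0 < a₀ ∧ ∀ a : ℝ, 0 < a → a ≤ a₀ →
      ∀ (v₀ : H) (v : ℝ → H) (ξ : ℝ → U),
      (∀ᵐ t ∂halfLine, v t = G t v₀ + ∫ s in (0 : ℝ)..t, G (t - s) (B (ξ s))) →
      (∀ T, 0 ≤ T → IntervalIntegrable ξ volume 0 T) →
      Integrable (fun t => Real.exp (-a * t) • v t) halfLine →
      MemLp (fun t => Real.exp (-a * t) • v t) 2 halfLine →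
      Integrable (fun t => Real.exp (-a * t) • ξ t) halfLine →
      MemLp (fun t => Real.exp (-a * t) • ξ t) 2 halfLine →
      δ * ∫ t, (‖Real.exp (-a * t) • v t‖ ^ 2 + ‖Real.exp (-a * t) • ξ t‖ ^ 2) ∂halfLine ≤
        (∫ t, quadForm F₁ F₂ F₃ (Real.exp (-a * t) • v t) (Real.exp (-a * t) • ξ t) ∂halfLine) +
          C * ‖v₀‖ ^ 2 := by
  obtain ⟨δ, C, a₀, hδ, hC, ha₀, hco⟩ := hfreq.forced_coercive hG hA hd
  obtain ⟨M, hM, hb⟩ := hG.exists_norm_le 1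
  set L := formBound F₁ F₂ F₃ with hL
  have hLpos : 0 < L := formBound_pos
  set η := δ / (4 * L) with hη
  have hηpos : 0 < η := by positivity
  set D := 2 * L * (1 + 1 / (2 * η)) with hD
  have hDpos : 0 < D := by positivity
  refine ⟨δ / 4, (C + D + δ / 2) * M ^ 2, a₀, by positivity, by positivity, ha₀, ?_⟩
  intro a ha haa v₀ v ξ hv hξi hv1 hv2 hξ1 hξ2
  set e : ℝ → ℝ := fun t => Real.exp (-a * t) with he
  have hecont : Continuous e := by fun_prop
  have he1 : ∀ t ∈ Ioc (0 : ℝ) 1, |e t| ≤ 1 := fun t ht => by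
    rw [abs_of_pos (Real.exp_pos _)]
    exact Real.exp_le_one_iff.2 (by nlinarith [ht.1])
  -- `h(t) = (1 - t)₊ G(t) v₀` carries the initial value and dies at time `1`. Then `v - h` starts
  -- from zero, driven by `B ξ + f` with `f = G(t) v₀` on `(0, 1]`. Unlike the orbit of `v₀`, which
  -- may grow, `f` and `h` have weighted `L₂`-norms at most `M ‖v₀‖`, uniformly in `a`.
  set f : ℝ → H := (Ioc (0 : ℝ) 1).indicator fun s => G (max s 0) v₀ with hf
  set h : ℝ → H := fun t => max (1 - t) 0 • G (max t 0) v₀ with hh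
  have hcorb := hG.continuous_max_apply v₀
  have hhcont : Continuous h :=
    ((continuous_const.sub continuous_id).max continuous_const).smul hcorb
  have horb : ∀ t ∈ Ioc (0 : ℝ) 1, ‖G (max t 0) v₀‖ ≤ M * ‖v₀‖ := fun t ht =>
    (G _).le_of_opNorm_le (hb _ ⟨le_max_right _ _, max_le ht.2 zero_le_one⟩) _
  obtain ⟨hf1, hf2, hf3⟩ := integrable_of_bounded_support (x := fun t => e t • f t)
    (K := M * ‖v₀‖)
    (hecont.aestronglyMeasurable.smul
      (hcorb.aestronglyMeasurable.indicator measurableSet_Ioc))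
    (fun t ht => by
      simp only [hf]
      rw [indicator_of_notMem (fun h => not_lt.2 h.2 ht), smul_zero])
    (fun t ht => by
      simp only [hf]
      rw [indicator_of_mem ht, norm_smul]
      exact (mul_le_of_le_one_left (norm_nonneg _) (he1 t ht)).trans (horb t ht))
  obtain ⟨hh1, hh2, hh3⟩ := integrable_of_bounded_support (x := fun t => e t • h t)
    (K := M * ‖v₀‖) ((hecont.smul hhcont).aestronglyMeasurable)
    (fun t ht => by
      simp only [hh]
      rw [max_eq_right (by linarith), zero_smul, smul_zero])
    (fun t ht => by
      simp only [hh]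
      rw [norm_smul, norm_smul]
      refine (mul_le_of_le_one_left (by positivity) (he1 t ht)).trans ?_
      refine (mul_le_of_le_one_left (norm_nonneg _) ?_).trans (horb t ht)
      rw [Real.norm_of_nonneg (le_max_right _ _)]
      exact max_le (by linarith [ht.1]) zero_le_one)
  have hfi : ∀ T, 0 ≤ T → IntervalIntegrable f volume 0 T := fun T hT => by
    rw [intervalIntegrable_iff_integrableOn_Ioc_of_le hT]
    exact (hcorb.integrableOn_Ioc).indicator measurableSet_Ioc
  have hBξi : ∀ T, 0 ≤ T → IntervalIntegrable (fun s => B (ξ s)) volume 0 T := fun T hT =>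
    ⟨B.integrable_comp (hξi T hT).1, B.integrable_comp (hξi T hT).2⟩
  have hw : ∀ᵐ t ∂halfLine, v t - h t = ∫ s in (0 : ℝ)..t, G (t - s) (B (ξ s) + f s) := by
    filter_upwards [hv, ae_restrict_mem measurableSet_Ioi] with t ht ht0
    have ht0' : (0 : ℝ) ≤ t := le_of_lt ht0
    simp only [map_add]
    rw [intervalIntegral.integral_add (hG.intervalIntegrable_conv ht0' (hBξi t ht0'))
      (hG.intervalIntegrable_conv ht0' (hfi t ht0')), hG.integral_conv_orbit v₀ ht0', ht]
    have hmm : max (1 - t) 0 = 1 - min t 1 := by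
      rcases le_total t 1 with h | h
      · rw [max_eq_left (by linarith), min_eq_left h]
      · rw [max_eq_right (by linarith), min_eq_right h, sub_self]
    simp only [hh, hmm, max_eq_left ht0']
    module
  have hw1 : Integrable (fun t => e t • (v t - h t)) halfLine := by
    simp only [smul_sub]; exact hv1.sub hh1
  have hw2 : MemLp (fun t => e t • (v t - h t)) 2 halfLine := by
    simp only [smul_sub]; exact hv2.sub hh2
  have key := hco a ha haa (fun t => v t - h t) f ξ hw
    (fun T hT => (hBξi T hT).add (hfi T hT)) hw1 hw2 hf1 hf2 hξ1 hξ2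
  have hpt : ∀ t, quadForm F₁ F₂ F₃ (e t • (v t - h t)) (e t • ξ t) ≤
      quadForm F₁ F₂ F₃ (e t • v t) (e t • ξ t) +
        (δ / 2 * (‖e t • (v t - h t)‖ ^ 2 + ‖e t • ξ t‖ ^ 2) + D * ‖e t • h t‖ ^ 2) := by
    intro t
    have := (quadForm_perturb (F₁ := F₁) (F₂ := F₂) (F₃ := F₃) hηpos (e t • ξ t)
      (smul_sub (e t) (v t) (h t))).1
    rw [← hL] at this
    have e1 : 2 * L * (η * (‖e t • (v t - h t)‖ ^ 2 + ‖e t • ξ t‖ ^ 2) +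
        (1 + 1 / (2 * η)) * ‖e t • h t‖ ^ 2) =
        δ / 2 * (‖e t • (v t - h t)‖ ^ 2 + ‖e t • ξ t‖ ^ 2) + D * ‖e t • h t‖ ^ 2 := by
      have : 2 * L * η = δ / 2 := by rw [hη]; field_simp; ring
      rw [← this, hD]; ring
    linarith
  have hpt2 : ∀ t, ‖e t • v t‖ ^ 2 + ‖e t • ξ t‖ ^ 2 ≤
      2 * (‖e t • (v t - h t)‖ ^ 2 + ‖e t • ξ t‖ ^ 2) + 2 * ‖e t • h t‖ ^ 2 := by
    intro t
    have := (quadForm_perturb (F₁ := F₁) (F₂ := F₂) (F₃ := F₃) hηpos (e t • ξ t)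
      (smul_sub (e t) (v t) (h t))).2
    linarith [sq_nonneg ‖e t • ξ t‖]
  have iw := (integrable_norm_sq hw2).add (integrable_norm_sq hξ2)
  have ih := integrable_norm_sq hh2
  have I1 := integral_mono (integrable_quadForm hw2 hξ2)
    ((integrable_quadForm hv2 hξ2).add ((iw.const_mul (δ / 2)).add (ih.const_mul D))) hpt
  have I2 := integral_mono ((integrable_norm_sq hv2).add (integrable_norm_sq hξ2))
    ((iw.const_mul 2).add (ih.const_mul 2)) hpt2
  have s1 := integral_add (integrable_quadForm (F₁ := F₁) (F₂ := F₂) (F₃ := F₃) hv2 hξ2)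
    ((iw.const_mul (δ / 2)).add (ih.const_mul D))
  have s2 := integral_add (iw.const_mul (δ / 2)) (ih.const_mul D)
  have s3 := integral_add (iw.const_mul 2) (ih.const_mul 2)
  simp only [Pi.add_apply, integral_const_mul] at I1 I2 s1 s2 s3
  rw [s1, s2] at I1
  rw [s3] at I2
  have e2 : (M * ‖v₀‖) ^ 2 = M ^ 2 * ‖v₀‖ ^ 2 := by ring
  rw [e2] at hf3 hh3
  have f3 := mul_le_mul_of_nonneg_left hf3 hC.le
  have h3 := mul_le_mul_of_nonneg_left hh3 hDpos.le
  have h4 := mul_le_mul_of_nonneg_left hh3 (by positivity : 0 ≤ δ / 2)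
  have I3 := mul_le_mul_of_nonneg_left I2 (by positivity : 0 ≤ δ / 4)
  simp only [he] at *
  linarith

theorem intervalIntegrable_of_memLp {E : Type*} [NormedAddCommGroup E] {x : ℝ → E}
    (hx : MemLp x 2 halfLine) {T : ℝ} (hT : 0 ≤ T) : IntervalIntegrable x volume 0 T := by
  rw [intervalIntegrable_iff_integrableOn_Ioc_of_le hT]
  have : MemLp x 2 (volume.restrict (Ioc 0 T)) :=
    hx.mono_measure (Measure.restrict_mono Ioc_subset_Ioi_self le_rfl)
  exact this.integrable (by norm_num)

/-- The weight is itself square integrable, so it brings an `L²` function into `L¹ ∩ L²`, where the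
Fourier integral is available. -/
theorem integrable_exp_smul {E : Type*} [NormedAddCommGroup E] [NormedSpace ℝ E] {x : ℝ → E}
    (hx : MemLp x 2 halfLine) {a : ℝ} (ha : 0 < a) :
    Integrable (fun t => Real.exp (-a * t) • x t) halfLine ∧
      MemLp (fun t => Real.exp (-a * t) • x t) 2 halfLine := by
  have hm : AEStronglyMeasurable (fun t => Real.exp (-a * t) • x t) halfLine :=
    (by fun_prop : Continuous fun t => Real.exp (-a * t)).aestronglyMeasurable.smul hx.1
  constructor
  · have h2 : IntegrableOn (fun t => Real.exp (-(2 * a) * t)) (Ioi 0) :=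
      exp_neg_integrableOn_Ioi 0 (by positivity)
    refine Integrable.mono' (h2.add (integrable_norm_sq hx)) hm (Eventually.of_forall fun t => ?_)
    have e : Real.exp (-(2 * a) * t) = Real.exp (-a * t) ^ 2 := by
      rw [← Real.exp_nat_mul]; congr 1; push_cast; ring
    simp only [Pi.add_apply]
    rw [norm_smul, Real.norm_of_nonneg (Real.exp_pos _).le, e]
    nlinarith [sq_nonneg (Real.exp (-a * t) - ‖x t‖), sq_nonneg (Real.exp (-a * t)),
      sq_nonneg ‖x t‖]
  · refine hx.of_le hm ((ae_restrict_iff' measurableSet_Ioi).2 (Eventually.of_forall fun t ht => ?_))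
    rw [norm_smul, Real.norm_of_nonneg (Real.exp_pos _).le]
    refine mul_le_of_le_one_left (norm_nonneg _) (Real.exp_le_one_iff.2 ?_)
    have : (0 : ℝ) < t := ht
    nlinarith

theorem quadForm_smul (r : ℝ) (v : H) (ξ : U) :
    quadForm F₁ F₂ F₃ (r • v) (r • ξ) = r ^ 2 * quadForm F₁ F₂ F₃ v ξ := by
  simp only [quadForm, map_smul, real_inner_smul_left, real_inner_smul_right]
  ring

/-- Dominated convergence removes the weight as `a → 0`. -/
theorem tendsto_integral_exp_sq {φ : ℝ → ℝ} (hφ : Integrable φ halfLine) {a : ℕ → ℝ}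
    (ha : ∀ n, 0 < a n) (hlim : Tendsto a atTop (𝓝 0)) :
    Tendsto (fun n => ∫ t, Real.exp (-a n * t) ^ 2 * φ t ∂halfLine) atTop
      (𝓝 (∫ t, φ t ∂halfLine)) := by
  refine tendsto_integral_of_dominated_convergence (fun t => ‖φ t‖) (fun n => ?_) hφ.norm
    (fun n => (ae_restrict_iff' measurableSet_Ioi).2 (Eventually.of_forall fun t ht => ?_))
    (Eventually.of_forall fun t => ?_)
  · exact (by fun_prop : Continuous fun t => Real.exp (-a n * t) ^ 2).aestronglyMeasurable.mul hφ.1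
  · have ht' : (0 : ℝ) < t := ht
    rw [norm_mul, Real.norm_of_nonneg (by positivity)]
    refine mul_le_of_le_one_left (norm_nonneg _) (pow_le_one₀ (Real.exp_pos _).le
      (Real.exp_le_one_iff.2 ?_))
    nlinarith [ha n]
  · have h1 : Tendsto (fun n => Real.exp (-a n * t) ^ 2 * φ t) atTop
        (𝓝 (Real.exp (-0 * t) ^ 2 * φ t)) :=
      ((Real.continuous_exp.tendsto _).comp ((hlim.neg).mul_const t) |>.pow 2).mul_const _
    simpa using h1

/-- Coercivity of the cost functional on the processes, up to the initial value. -/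
theorem FrequencyCondition.coercive (hG : IsC0Semigroup G) {A : H →ₗ.[ℝ] H}
    (hA : IsGenerator A G) {j : ℕ} (hd : HasExponentialDichotomy G j)
    (hfreq : FrequencyCondition A B F₁ F₂ F₃) :
    ∃ δ C : ℝ, 0 < δ ∧ 0 < C ∧ ∀ (v₀ : H) (v : ℝ → H) (ξ : ℝ → U),
      (∀ᵐ t ∂halfLine, v t = G t v₀ + ∫ s in (0 : ℝ)..t, G (t - s) (B (ξ s))) →
      MemLp v 2 halfLine → MemLp ξ 2 halfLine →
      δ * ∫ t, (‖v t‖ ^ 2 + ‖ξ t‖ ^ 2) ∂halfLine ≤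
        (∫ t, quadForm F₁ F₂ F₃ (v t) (ξ t) ∂halfLine) + C * ‖v₀‖ ^ 2 := by
  obtain ⟨δ, C, a₀, hδ, hC, ha₀, hco⟩ := hfreq.weighted_coercive hG hA hd
  refine ⟨δ, C, hδ, hC, fun v₀ v ξ hv hv2 hξ2 => ?_⟩
  set a : ℕ → ℝ := fun n => a₀ * (1 / ((n : ℝ) + 1)) with ha
  have hapos : ∀ n, 0 < a n := fun n => by positivity
  have hale : ∀ n, a n ≤ a₀ := fun n => by
    refine mul_le_of_le_one_right ha₀.le ?_
    rw [div_le_one (by positivity)]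
    linarith [(Nat.cast_nonneg n : (0 : ℝ) ≤ n)]
  have hlim : Tendsto a atTop (𝓝 0) := by
    rw [← mul_zero a₀]
    exact (tendsto_one_div_add_atTop_nhds_zero_nat (𝕜 := ℝ)).const_mul a₀
  have h : ∀ n, δ * ∫ t, Real.exp (-a n * t) ^ 2 * (‖v t‖ ^ 2 + ‖ξ t‖ ^ 2) ∂halfLine ≤
      (∫ t, Real.exp (-a n * t) ^ 2 * quadForm F₁ F₂ F₃ (v t) (ξ t) ∂halfLine) +
        C * ‖v₀‖ ^ 2 := by
    intro n
    obtain ⟨v1, v2⟩ := integrable_exp_smul hv2 (hapos n)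
    obtain ⟨x1, x2⟩ := integrable_exp_smul hξ2 (hapos n)
    have := hco (a n) (hapos n) (hale n) v₀ v ξ hv
      (fun T hT => intervalIntegrable_of_memLp hξ2 hT) v1 v2 x1 x2
    simp only [quadForm_smul, norm_smul, mul_pow, Real.norm_eq_abs, sq_abs, ← mul_add] at this
    exact this
  exact le_of_tendsto_of_tendsto'
    ((tendsto_integral_exp_sq ((integrable_norm_sq hv2).add (integrable_norm_sq hξ2)) hapos
      hlim).const_mul δ)
    ((tendsto_integral_exp_sq (integrable_quadForm hv2 hξ2) hapos hlim).add_const _) h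

/-! ### The Hamiltonian system as Euler-Lagrange system; its bounded solutions are square
integrable. -/

/-- The symmetric bilinear form that polarizes `quadForm`. -/
def bilinForm (F₁ : H →L[ℝ] H) (F₂ : H →L[ℝ] U) (F₃ : U ≃L[ℝ] U) (v : H) (ξ : U) (w : H) (ζ : U) :
    ℝ :=
  ⟪F₁ v, w⟫ + ⟪F₂ v, ζ⟫ + ⟪F₂ w, ξ⟫ + ⟪F₃ ξ, ζ⟫

theorem bilinForm_self (v : H) (ξ : U) :
    bilinForm F₁ F₂ F₃ v ξ v ξ = quadForm F₁ F₂ F₃ v ξ := by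
  simp only [bilinForm, quadForm]; ring

theorem inner_symm_apply (hF₃ : IsSelfAdjoint (F₃ : U →L[ℝ] U)) (x y : U) :
    ⟪F₃.symm x, y⟫ = ⟪x, F₃.symm y⟫ := by
  have h := hF₃.isSymmetric (F₃.symm x) (F₃.symm y)
  simpa using h.symm

/-- The adjoint state enters through the control `ξ = F₃⁻¹ (B* η - F₂ v)`. In terms of it, this
identity and the next turn the Hamiltonian system into `v' = A v + B ξ`, `η' = -A* η + F₁ v + F₂*
ξ`. -/
theorem R₁_add_R₃ (v η : H) : R₁ B F₂ F₃ v + R₃ B F₃ η =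
    B (F₃.symm (ContinuousLinearMap.adjoint B η - F₂ v)) := by
  simp [R₁, R₃]
  abel

theorem R₂_sub_adjoint_R₁ (hF₃ : IsSelfAdjoint (F₃ : U →L[ℝ] U)) (v η : H) :
    R₂ F₁ F₂ F₃ v - ContinuousLinearMap.adjoint (R₁ B F₂ F₃) η =
      F₁ v + ContinuousLinearMap.adjoint F₂ (F₃.symm (ContinuousLinearMap.adjoint B η - F₂ v)) := by
  have h : ContinuousLinearMap.adjoint (R₁ B F₂ F₃) η =
      -ContinuousLinearMap.adjoint F₂ (F₃.symm (ContinuousLinearMap.adjoint B η)) := by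
    refine ext_inner_right ℝ fun w => ?_
    rw [ContinuousLinearMap.adjoint_inner_left, inner_neg_left,
      ContinuousLinearMap.adjoint_inner_left, inner_symm_apply hF₃,
      ContinuousLinearMap.adjoint_inner_left]
    simp [R₁]
  rw [h]
  simp [R₂]
  abel

theorem feedback_apply (P : H →L[ℝ] H) (v : H) : feedback B F₂ F₃ P v =
    F₃.symm (ContinuousLinearMap.adjoint B (-P v) - F₂ v) := by
  simp [feedback]
  abel

/-- Restarting a mild solution at time `s`. -/
theorem IsC0Semigroup.mild_add (hG : IsC0Semigroup G) {s t : ℝ} (hs : 0 ≤ s) (ht : 0 ≤ t) (x : H)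
    {g : ℝ → H} (hg : IntervalIntegrable g volume 0 (s + t)) :
    G (s + t) x + ∫ τ in (0 : ℝ)..(s + t), G (s + t - τ) (g τ) =
      G t (G s x + ∫ τ in (0 : ℝ)..s, G (s - τ) (g τ)) +
        ∫ τ in (0 : ℝ)..t, G (t - τ) (g (s + τ)) := by
  have hi := hG.intervalIntegrable_conv (add_nonneg hs ht) hg
  have h1 : IntervalIntegrable (fun τ => G (s + t - τ) (g τ)) volume 0 s :=
    hi.mono_set (by
      rw [uIcc_of_le hs, uIcc_of_le (add_nonneg hs ht)]
      exact Icc_subset_Icc_right (by linarith))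
  have h2 : IntervalIntegrable (fun τ => G (s + t - τ) (g τ)) volume s (s + t) :=
    hi.mono_set (by
      rw [uIcc_of_le (by linarith : s ≤ s + t), uIcc_of_le (add_nonneg hs ht)]
      exact Icc_subset_Icc_left hs)
  have h3 : IntervalIntegrable (fun τ => G (s - τ) (g τ)) volume 0 s :=
    hG.intervalIntegrable_conv hs (hg.mono_set (by
      rw [uIcc_of_le hs, uIcc_of_le (add_nonneg hs ht)]
      exact Icc_subset_Icc_right (by linarith)))
  have e1 : ∫ τ in (0 : ℝ)..s, G (s + t - τ) (g τ) = G t (∫ τ in (0 : ℝ)..s, G (s - τ) (g τ)) := by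
    rw [← ContinuousLinearMap.intervalIntegral_comp_comm _ h3]
    refine intervalIntegral.integral_congr fun τ hτ => ?_
    rw [uIcc_of_le hs] at hτ
    rw [← hG.map_add_apply ht (sub_nonneg.2 hτ.2)]
    congr 2; ring
  have e2 : ∫ τ in s..(s + t), G (s + t - τ) (g τ) = ∫ τ in (0 : ℝ)..t, G (t - τ) (g (s + τ)) := by
    have := intervalIntegral.integral_comp_add_left (fun τ => G (s + t - τ) (g τ)) s
      (a := 0) (b := t)
    rw [add_zero] at this
    rw [← this]
    refine intervalIntegral.integral_congr fun τ hτ => ?_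
    congr 2; ring
  rw [← intervalIntegral.integral_add_adjacent_intervals h1 h2, e1, e2, _root_.map_add,
    add_comm s t, hG.map_add_apply ht hs, add_assoc]

namespace IsHamiltonianSolution

variable {v η : ℝ → H}

theorem continuousOn_control (h : IsHamiltonianSolution G B F₁ F₂ F₃ v η) :
    ContinuousOn (fun t => F₃.symm (ContinuousLinearMap.adjoint B (η t) - F₂ (v t))) (Ici 0) :=
  F₃.symm.continuous.comp_continuousOn
    (((ContinuousLinearMap.adjoint B).continuous.comp_continuousOn h.continuousOn_η).sub
      (F₂.continuous.comp_continuousOn h.continuousOn_v))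

/-- The system is autonomous. Consequently the set of initial data of bounded solutions contains
every later point of such a solution. -/
theorem shift (hG : IsC0Semigroup G) (h : IsHamiltonianSolution G B F₁ F₂ F₃ v η) {s : ℝ}
    (hs : 0 ≤ s) :
    IsHamiltonianSolution G B F₁ F₂ F₃ (fun t => v (s + t)) (fun t => η (s + t)) where
  continuousOn_v := h.continuousOn_v.comp (by fun_prop) fun t (ht : 0 ≤ t) => add_nonneg hs ht
  continuousOn_η := h.continuousOn_η.comp (by fun_prop) fun t (ht : 0 ≤ t) => add_nonneg hs ht
  cauchy_v t ht := by
    have hg : IntervalIntegrable (fun τ => R₁ B F₂ F₃ (v τ) + R₃ B F₃ (η τ)) volume 0 (s + t) := by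
      refine ContinuousOn.intervalIntegrable ?_
      rw [uIcc_of_le (add_nonneg hs ht)]
      exact (((R₁ B F₂ F₃).continuous.comp_continuousOn h.continuousOn_v).add
        ((R₃ B F₃).continuous.comp_continuousOn h.continuousOn_η)).mono Icc_subset_Ici_self
    rw [h.cauchy_v _ (add_nonneg hs ht), hG.mild_add hs ht _ hg, ← h.cauchy_v s hs, add_zero]
  cauchy_η r t hr hrt := by
    rw [h.cauchy_η (s + r) (s + t) (add_nonneg hs hr) (by linarith), add_sub_add_left_eq_sub,
      ← intervalIntegral.integral_comp_add_left]
    simp only [add_sub_add_left_eq_sub]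

/-- Pairing a solution of the Hamiltonian system with a controlled trajectory. -/
theorem pairing (hG : IsC0Semigroup G) (hF₃ : IsSelfAdjoint (F₃ : U →L[ℝ] U))
    (h : IsHamiltonianSolution G B F₁ F₂ F₃ v η) {T : ℝ} (hT : 0 ≤ T) {w : ℝ → H} {ζ : ℝ → U}
    (hζ : IntervalIntegrable ζ volume 0 T)
    (hw : ∀ t ∈ Icc 0 T, w t = G t (w 0) + ∫ s in (0 : ℝ)..t, G (t - s) (B (ζ s))) :
    ∫ t in (0 : ℝ)..T, bilinForm F₁ F₂ F₃ (v t)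
      (F₃.symm (ContinuousLinearMap.adjoint B (η t) - F₂ (v t))) (w t) (ζ t) =
      ⟪η T, w T⟫ - ⟪η 0, w 0⟫ := by
  have hh : IntervalIntegrable (fun τ => R₂ F₁ F₂ F₃ (v τ) -
      ContinuousLinearMap.adjoint (R₁ B F₂ F₃) (η τ)) volume 0 T := by
    refine ContinuousOn.intervalIntegrable ?_
    rw [uIcc_of_le hT]
    exact (((R₂ F₁ F₂ F₃).continuous.comp_continuousOn h.continuousOn_v).sub
      ((ContinuousLinearMap.adjoint (R₁ B F₂ F₃)).continuous.comp_continuousOn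
        h.continuousOn_η)).mono Icc_subset_Ici_self
  rw [← (hG.pairing hT ⟨B.integrable_comp hζ.1, B.integrable_comp hζ.2⟩ hh hw
    (fun s hs => h.cauchy_η s T hs.1 hs.2)).2]
  congr 1
  ext t
  -- By the choice of control `B* η = F₃ ξ + F₂ v`, so `⟨F₁ v + F₂* ξ, w⟩ + ⟨B* η, ζ⟩` is the
  -- polarized form.
  rw [R₂_sub_adjoint_R₁ hF₃, inner_add_left, ContinuousLinearMap.adjoint_inner_left,
    ← ContinuousLinearMap.adjoint_inner_left B]
  simp only [bilinForm, ContinuousLinearEquiv.apply_symm_apply, inner_sub_left]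
  rw [real_inner_comm (F₂ (w t))]
  ring

theorem cauchy_control (h : IsHamiltonianSolution G B F₁ F₂ F₃ v η) {t : ℝ} (ht : 0 ≤ t) :
    v t = G t (v 0) + ∫ s in (0 : ℝ)..t, G (t - s)
      (B (F₃.symm (ContinuousLinearMap.adjoint B (η s) - F₂ (v s)))) := by
  rw [h.cauchy_v t ht]
  simp only [R₁_add_R₃]

end IsHamiltonianSolution

theorem integrable_exp_smul_of_bounded {E : Type*} [NormedAddCommGroup E] [NormedSpace ℝ E]
    {x : ℝ → E} (hx : ContinuousOn x (Ici 0)) {K : ℝ} (hK : ∀ t, 0 ≤ t → ‖x t‖ ≤ K) {a : ℝ}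
    (ha : 0 < a) :
    Integrable (fun t => Real.exp (-a * t) • x t) halfLine ∧
      MemLp (fun t => Real.exp (-a * t) • x t) 2 halfLine := by
  have hm : AEStronglyMeasurable (fun t => Real.exp (-a * t) • x t) halfLine :=
    (by fun_prop : Continuous fun t => Real.exp (-a * t)).aestronglyMeasurable.smul
      ((hx.mono Ioi_subset_Ici_self).aestronglyMeasurable measurableSet_Ioi)
  have hi : Integrable (fun t => Real.exp (-a * t) • x t) halfLine := by
    refine Integrable.mono' ((exp_neg_integrableOn_Ioi 0 ha).mul_const K) hm
      ((ae_restrict_iff' measurableSet_Ioi).2 (Eventually.of_forall fun t ht => ?_))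
    rw [norm_smul, Real.norm_of_nonneg (Real.exp_pos _).le]
    exact mul_le_mul_of_nonneg_left (hK t (le_of_lt ht)) (Real.exp_pos _).le
  refine ⟨hi, (memLp_two_iff_integrable_sq_norm hm).2 ?_⟩
  refine Integrable.mono' (hi.norm.const_mul K) (hm.norm.pow 2)
    ((ae_restrict_iff' measurableSet_Ioi).2 (Eventually.of_forall fun t ht => ?_))
  have ht' : (0 : ℝ) < t := ht
  rw [Real.norm_of_nonneg (by positivity), pow_two]
  refine mul_le_mul_of_nonneg_right ?_ (norm_nonneg _)
  rw [norm_smul, Real.norm_of_nonneg (Real.exp_pos _).le]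
  refine (mul_le_of_le_one_left (norm_nonneg _) (Real.exp_le_one_iff.2 ?_)).trans (hK t ht'.le)
  nlinarith

/-- The Laplace transform of the derivative of a bounded function is bounded. -/
theorem integral_exp_mul_le {p q : ℝ → ℝ} (hq : ContinuousOn q (Ici 0))
    (hp : ∀ t, 0 ≤ t → p t = p 0 + ∫ s in (0 : ℝ)..t, q s) {K K' : ℝ}
    (hpK : ∀ t, 0 ≤ t → |p t| ≤ K) (hqK : ∀ t, 0 ≤ t → |q t| ≤ K') {b : ℝ} (hb : 0 < b) :
    ∫ t, Real.exp (-b * t) * q t ∂halfLine ≤ 2 * K := by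
  have hqi : ∀ t, 0 ≤ t → IntervalIntegrable q volume 0 t := fun t ht =>
    ContinuousOn.intervalIntegrable (by rw [uIcc_of_le ht]; exact hq.mono Icc_subset_Ici_self)
  have hpc : ContinuousOn p (Ici 0) := by
    have : ContinuousOn (fun t => p 0 + ∫ s in (0 : ℝ)..t, q s) (Ici 0) := by
      refine continuousOn_const.add fun t ht => ?_
      have h1 : ContinuousOn (fun t => ∫ s in (0 : ℝ)..t, q s) (uIcc 0 (t + 1)) :=
        intervalIntegral.continuousOn_primitive_interval'
          (hqi (t + 1) (add_nonneg ht zero_le_one)) left_mem_uIcc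
      rw [uIcc_of_le (add_nonneg ht zero_le_one)] at h1
      have ht' : (0 : ℝ) ≤ t := ht
      refine (h1 t ⟨ht', by linarith⟩).mono_of_mem_nhdsWithin ?_
      rw [← Ici_inter_Iic]
      exact inter_mem_nhdsWithin _ (Iic_mem_nhds (by linarith))
    exact this.congr fun t ht => hp t ht
  have hd : ∀ t ∈ Ioi (0 : ℝ), HasDerivAt (fun t => Real.exp (-b * t) * p t)
      (Real.exp (-b * t) * q t - b * (Real.exp (-b * t) * p t)) t := by
    intro t ht
    have ht' : (0 : ℝ) < t := ht
    have h1 : HasDerivAt (fun t => ∫ s in (0 : ℝ)..t, q s) (q t) t :=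
      intervalIntegral.integral_hasDerivAt_right (hqi t ht'.le)
        ((hq.mono Ioi_subset_Ici_self).stronglyMeasurableAtFilter isOpen_Ioi t ht)
        (hq.continuousAt (Ici_mem_nhds ht'))
    have h2 : HasDerivAt p (q t) t := (h1.const_add (p 0)).congr_of_eventuallyEq
      (Filter.mem_of_superset (Ici_mem_nhds ht') fun s hs => hp s hs)
    have h3 : HasDerivAt (fun t => Real.exp (-b * t)) (Real.exp (-b * t) * (-b)) t := by
      simpa using ((hasDerivAt_id t).const_mul (-b)).exp
    refine (h3.mul h2).congr_deriv ?_
    ring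
  have ip : Integrable (fun t => Real.exp (-b * t) * p t) halfLine :=
    (integrable_exp_smul_of_bounded hpc hpK hb).1
  have iq : Integrable (fun t => Real.exp (-b * t) * q t) halfLine :=
    (integrable_exp_smul_of_bounded hq hqK hb).1
  have hE : Tendsto (fun t => Real.exp (-b * t)) atTop (𝓝 0) :=
    Real.tendsto_exp_atBot.comp (tendsto_id.const_mul_atTop_of_neg (neg_neg_iff_pos.2 hb))
  have hlim : Tendsto (fun t => Real.exp (-b * t) * p t) atTop (𝓝 0) := by
    have h0 : Tendsto (fun t => Real.exp (-b * t) * K) atTop (𝓝 0) := by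
      simpa using hE.mul_const K
    refine squeeze_zero_norm' ((eventually_ge_atTop 0).mono fun t ht => ?_) h0
    rw [norm_mul, Real.norm_of_nonneg (Real.exp_pos _).le]
    exact mul_le_mul_of_nonneg_left (hpK t ht) (Real.exp_pos _).le
  -- By parts, `∫ exp (-bt) q = -p(0) + b ∫ exp (-bt) p ≤ K + K`. The bound `K'` on `q` serves
  -- integrability alone and does not enter the estimate.
  have hI := integral_Ioi_of_hasDerivAt_of_tendsto (f := fun t => Real.exp (-b * t) * p t)
    (a := 0) (((by fun_prop : Continuous fun t => Real.exp (-b * t)).continuousOn.mul hpc) 0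
      self_mem_Ici) hd (iq.sub (ip.const_mul b)) hlim
  rw [integral_sub iq (ip.const_mul b), integral_const_mul] at hI
  have hE1 : ∫ t in Ioi (0 : ℝ), Real.exp (-b * t) = b⁻¹ := by
    rw [integral_exp_mul_Ioi (by linarith) 0]
    simp [neg_div_neg_eq]
  have hpE : ∫ t, Real.exp (-b * t) * p t ∂halfLine ≤ b⁻¹ * K := by
    rw [← hE1, ← integral_mul_const]
    refine integral_mono_ae ip ((exp_neg_integrableOn_Ioi 0 hb).mul_const K)
      ((ae_restrict_iff' measurableSet_Ioi).2 (Eventually.of_forall fun t ht => ?_))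
    exact mul_le_mul_of_nonneg_left ((le_abs_self _).trans (hpK t (le_of_lt ht)))
      (Real.exp_pos _).le
  have h5 := mul_le_mul_of_nonneg_left hpE hb.le
  rw [mul_inv_cancel_left₀ hb.ne'] at h5
  have h6 := (abs_le.1 (hpK 0 le_rfl)).1
  simp only [mul_zero, Real.exp_zero, one_mul] at hI
  linarith

/-- On `(0, n]` a weight with `a n ≤ 1 / 2` has square at least `1 / 4`, so the unweighted integrals
over `(0, n]` are at most `4 K` for all `n`. -/
theorem memLp_two_of_integral_exp_le {E : Type*} [NormedAddCommGroup E] {x : ℝ → E}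
    (hx : ContinuousOn x (Ici 0)) {a₀ K : ℝ} (ha₀ : 0 < a₀)
    (hi : ∀ a, 0 < a → a ≤ a₀ → Integrable (fun t => Real.exp (-a * t) ^ 2 * ‖x t‖ ^ 2) halfLine)
    (h : ∀ a, 0 < a → a ≤ a₀ → ∫ t, Real.exp (-a * t) ^ 2 * ‖x t‖ ^ 2 ∂halfLine ≤ K) :
    MemLp x 2 halfLine := by
  have hm : AEStronglyMeasurable x halfLine :=
    (hx.mono Ioi_subset_Ici_self).aestronglyMeasurable measurableSet_Ioi
  have hic : ∀ n : ℕ, IntegrableOn (fun t => ‖x t‖ ^ 2) (Ioc 0 (n : ℝ)) := fun n =>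
    (((hx.norm.pow 2).mono Icc_subset_Ici_self).integrableOn_Icc).mono_set Ioc_subset_Icc_self
  refine (memLp_two_iff_integrable_sq_norm hm).2
    (integrableOn_Ioi_of_intervalIntegral_norm_bounded (4 * K) 0 hic tendsto_natCast_atTop_atTop
      (Eventually.of_forall fun n => ?_))
  set a := min a₀ (1 / (2 * ((n : ℝ) + 1))) with ha
  have ha0 : 0 < a := lt_min ha₀ (by positivity)
  have han : a * n ≤ 1 / 2 := by
    have h1 : a ≤ 1 / (2 * ((n : ℝ) + 1)) := min_le_right _ _
    rw [le_div_iff₀ (by positivity)] at h1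
    nlinarith
  have h2 := h a ha0 (min_le_left _ _)
  rw [intervalIntegral.integral_of_le n.cast_nonneg]
  calc ∫ t in Ioc 0 (n : ℝ), ‖‖x t‖ ^ 2‖
      ≤ ∫ t in Ioc 0 (n : ℝ), 4 * (Real.exp (-a * t) ^ 2 * ‖x t‖ ^ 2) := by
        refine setIntegral_mono_on (hic n).norm
          (((hi a ha0 (min_le_left _ _)).mono_measure
            (Measure.restrict_mono Ioc_subset_Ioi_self le_rfl)).const_mul 4) measurableSet_Ioc
          fun t ht => ?_
        have h3 : 1 / 2 ≤ Real.exp (-a * t) := by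
          have := Real.add_one_le_exp (-a * t)
          nlinarith [ht.2]
        rw [Real.norm_of_nonneg (by positivity), ← mul_assoc]
        refine le_mul_of_one_le_left (by positivity) ?_
        nlinarith
    _ = 4 * ∫ t in Ioc 0 (n : ℝ), Real.exp (-a * t) ^ 2 * ‖x t‖ ^ 2 := integral_const_mul _ _
    _ ≤ 4 * ∫ t in Ioi 0, Real.exp (-a * t) ^ 2 * ‖x t‖ ^ 2 := by
        refine mul_le_mul_of_nonneg_left (setIntegral_mono_set (hi a ha0 (min_le_left _ _))
          (Eventually.of_forall fun t => by positivity)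
          (Eventually.of_forall Ioc_subset_Ioi_self)) (by norm_num)
    _ ≤ 4 * K := by linarith

/-- Bounded solutions of the Hamiltonian system are square integrable. -/
theorem IsHamiltonianSolution.memLp (hG : IsC0Semigroup G) {A : H →ₗ.[ℝ] H}
    (hA : IsGenerator A G) {j : ℕ} (hd : HasExponentialDichotomy G j)
    (hF₃ : IsSelfAdjoint (F₃ : U →L[ℝ] U))
    (hfreq : FrequencyCondition A B F₁ F₂ F₃) {v η : ℝ → H}
    (h : IsHamiltonianSolution G B F₁ F₂ F₃ v η) {K : ℝ}
    (hK : ∀ t, 0 ≤ t → ‖v t‖ ≤ K ∧ ‖η t‖ ≤ K) :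
    MemLp v 2 halfLine ∧
      MemLp (fun t => F₃.symm (ContinuousLinearMap.adjoint B (η t) - F₂ (v t))) 2 halfLine := by
  obtain ⟨δ, C, a₀, hδ, hC, ha₀, hco⟩ := hfreq.weighted_coercive hG hA hd
  have hξc := h.continuousOn_control
  have hcau := fun t (ht : 0 ≤ t) => h.cauchy_control ht
  have hξK : ∃ K₁, ∀ t, 0 ≤ t →
      ‖F₃.symm (ContinuousLinearMap.adjoint B (η t) - F₂ (v t))‖ ≤ K₁ := by
    refine ⟨‖(F₃.symm : U →L[ℝ] U)‖ * (‖ContinuousLinearMap.adjoint B‖ * K + ‖F₂‖ * K),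
      fun t ht => ?_⟩
    refine ((F₃.symm : U →L[ℝ] U).le_opNorm _).trans
      (mul_le_mul_of_nonneg_left ((norm_sub_le _ _).trans (add_le_add ?_ ?_)) (norm_nonneg _))
    · exact (ContinuousLinearMap.le_opNorm _ _).trans
        (mul_le_mul_of_nonneg_left (hK t ht).2 (norm_nonneg _))
    · exact (ContinuousLinearMap.le_opNorm _ _).trans
        (mul_le_mul_of_nonneg_left (hK t ht).1 (norm_nonneg _))
  have hpair : ∀ T, 0 ≤ T → ⟪η T, v T⟫ = ⟪η 0, v 0⟫ + ∫ t in (0 : ℝ)..T, quadForm F₁ F₂ F₃ (v t)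
      (F₃.symm (ContinuousLinearMap.adjoint B (η t) - F₂ (v t))) := fun T hT => by
    have := h.pairing hG hF₃ hT (w := v)
      (ContinuousOn.intervalIntegrable (by
        rw [uIcc_of_le hT]; exact hξc.mono Icc_subset_Ici_self))
      (fun t ht => hcau t ht.1)
    simp only [bilinForm_self] at this
    rw [this]; ring
  set ξ : ℝ → U := fun t => F₃.symm (ContinuousLinearMap.adjoint B (η t) - F₂ (v t)) with hξ
  obtain ⟨K₁, hK₁⟩ := hξK
  have hK0 : 0 ≤ K := (norm_nonneg _).trans (hK 0 le_rfl).1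
  have hK10 : 0 ≤ K₁ := (norm_nonneg _).trans (hK₁ 0 le_rfl)
  have hqc : ContinuousOn (fun t => quadForm F₁ F₂ F₃ (v t) (ξ t)) (Ici 0) :=
    continuous_quadForm.comp_continuousOn (h.continuousOn_v.prodMk hξc)
  have key : ∀ a, 0 < a → a ≤ a₀ →
      Integrable (fun t => Real.exp (-a * t) ^ 2 * ‖v t‖ ^ 2) halfLine ∧
      Integrable (fun t => Real.exp (-a * t) ^ 2 * ‖ξ t‖ ^ 2) halfLine ∧
      ∫ t, (Real.exp (-a * t) ^ 2 * ‖v t‖ ^ 2 + Real.exp (-a * t) ^ 2 * ‖ξ t‖ ^ 2) ∂halfLine ≤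
        (2 * (K * K) + C * ‖v 0‖ ^ 2) / δ := by
    intro a ha haa
    obtain ⟨v1, v2⟩ := integrable_exp_smul_of_bounded h.continuousOn_v (fun t ht => (hK t ht).1) ha
    obtain ⟨x1, x2⟩ := integrable_exp_smul_of_bounded hξc hK₁ ha
    have hc := hco a ha haa (v 0) v ξ
      ((ae_restrict_iff' measurableSet_Ioi).2 (Eventually.of_forall fun t ht => hcau t (le_of_lt ht)))
      (fun T hT => ContinuousOn.intervalIntegrable (by
        rw [uIcc_of_le hT]; exact hξc.mono Icc_subset_Ici_self)) v1 v2 x1 x2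
    -- `⟨η, v⟩` is a primitive of `F(v, ξ)` by `hpair` and is bounded by `K²`; hence a bound on the
    -- weighted cost that does not depend on `a`.
    have hb : ∫ t, Real.exp (-(2 * a) * t) * quadForm F₁ F₂ F₃ (v t) (ξ t) ∂halfLine ≤
        2 * (K * K) := by
      refine integral_exp_mul_le (p := fun t => ⟪η t, v t⟫) hqc hpair (fun t ht => ?_)
        (K' := formBound F₁ F₂ F₃ * (K + K₁) ^ 2) (fun t ht => ?_) (by positivity)
      · exact (abs_real_inner_le_norm _ _).trans
          (mul_le_mul (hK t ht).2 (hK t ht).1 (norm_nonneg _) hK0)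
      · refine (abs_quadForm_le _ _).trans (mul_le_mul_of_nonneg_left ?_ formBound_pos.le)
        have := (hK t ht).1
        have := hK₁ t ht
        gcongr
    have e : ∀ t, Real.exp (-(2 * a) * t) = Real.exp (-a * t) ^ 2 := fun t => by
      rw [← Real.exp_nat_mul]; congr 1; push_cast; ring
    have iv := integrable_norm_sq v2
    have ix := integrable_norm_sq x2
    have n1 : ∀ t (y : H), ‖Real.exp (-a * t) • y‖ ^ 2 = Real.exp (-a * t) ^ 2 * ‖y‖ ^ 2 :=
      fun t y => by rw [norm_smul, mul_pow, Real.norm_of_nonneg (Real.exp_pos _).le]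
    have n2 : ∀ t (y : U), ‖Real.exp (-a * t) • y‖ ^ 2 = Real.exp (-a * t) ^ 2 * ‖y‖ ^ 2 :=
      fun t y => by rw [norm_smul, mul_pow, Real.norm_of_nonneg (Real.exp_pos _).le]
    simp only [quadForm_smul, n1, n2, ← e] at hc iv ix ⊢
    refine ⟨iv, ix, ?_⟩
    rw [le_div_iff₀ hδ, mul_comm]
    linarith
  constructor
  · refine memLp_two_of_integral_exp_le h.continuousOn_v ha₀ (fun a ha haa => (key a ha haa).1)
      (fun a ha haa => (integral_mono (key a ha haa).1 ((key a ha haa).1.add (key a ha haa).2.1)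
        fun t => ?_).trans (key a ha haa).2.2)
    simp only [Pi.add_apply]
    exact le_add_of_nonneg_right (by positivity)
  · refine memLp_two_of_integral_exp_le hξc ha₀ (fun a ha haa => (key a ha haa).2.1)
      (fun a ha haa => (integral_mono (key a ha haa).2.1 ((key a ha haa).1.add (key a ha haa).2.1)
        fun t => ?_).trans (key a ha haa).2.2)
    simp only [Pi.add_apply]
    exact le_add_of_nonneg_left (by positivity)

/-! ### Processes, and the stationary ones among them. -/

/-- A square integrable control process on the half-line, with initial state `x`. -/
structure IsProcess (G : ℝ → H →L[ℝ] H) (B : U →L[ℝ] H) (x : H) (v : ℝ → H) (ξ : ℝ → U) :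
    Prop where
  memLp_v : MemLp v 2 halfLine
  memLp_ξ : MemLp ξ 2 halfLine
  cauchy : ∀ᵐ t ∂halfLine, v t = G t x + ∫ s in (0 : ℝ)..t, G (t - s) (B (ξ s))

theorem intervalIntegral_congr_halfLine {E : Type*} [NormedAddCommGroup E] [NormedSpace ℝ E]
    {f g : ℝ → E} {T : ℝ} (hT : 0 ≤ T) (h : ∀ t, 0 < t → t ≤ T → f t = g t) :
    ∫ t in (0 : ℝ)..T, f t = ∫ t in (0 : ℝ)..T, g t := by
  rw [intervalIntegral.integral_of_le hT, intervalIntegral.integral_of_le hT]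
  exact setIntegral_congr_fun measurableSet_Ioc fun t ht => h t ht.1 ht.2

namespace IsProcess

variable {x y : H} {v w : ℝ → H} {ξ ζ : ℝ → U}

theorem intervalIntegrable (h : IsProcess G B x v ξ) {T : ℝ} (hT : 0 ≤ T) :
    IntervalIntegrable (fun t => B (ξ t)) volume 0 T :=
  have := intervalIntegrable_of_memLp h.memLp_ξ hT
  ⟨B.integrable_comp this.1, B.integrable_comp this.2⟩

theorem congr (h : IsProcess G B x v ξ) (hv : v =ᵐ[halfLine] w) (hξ : ξ =ᵐ[halfLine] ζ) :
    IsProcess G B x w ζ where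
  memLp_v := h.memLp_v.ae_eq hv
  memLp_ξ := h.memLp_ξ.ae_eq hξ
  cauchy := by
    filter_upwards [h.cauchy, hv, ae_restrict_mem measurableSet_Ioi] with t ht hvt h0
    rw [← hvt, ht]
    congr 1
    rw [intervalIntegral.integral_of_le (le_of_lt h0), intervalIntegral.integral_of_le (le_of_lt h0)]
    refine integral_congr_ae ?_
    filter_upwards [ae_mono (Measure.restrict_mono Ioc_subset_Ioi_self le_rfl) hξ] with s hs
    rw [hs]

theorem add (hG : IsC0Semigroup G) (h : IsProcess G B x v ξ) (h' : IsProcess G B y w ζ) :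
    IsProcess G B (x + y) (fun t => v t + w t) (fun t => ξ t + ζ t) where
  memLp_v := h.memLp_v.add h'.memLp_v
  memLp_ξ := h.memLp_ξ.add h'.memLp_ξ
  cauchy := by
    filter_upwards [h.cauchy, h'.cauchy, ae_restrict_mem measurableSet_Ioi] with t ht ht' h0
    have h0' : (0 : ℝ) ≤ t := le_of_lt h0
    simp only [_root_.map_add]
    rw [intervalIntegral.integral_add (hG.intervalIntegrable_conv h0' (h.intervalIntegrable h0'))
      (hG.intervalIntegrable_conv h0' (h'.intervalIntegrable h0')), ht, ht']
    abel

theorem smul (h : IsProcess G B x v ξ) (c : ℝ) :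
    IsProcess G B (c • x) (fun t => c • v t) (fun t => c • ξ t) where
  memLp_v := h.memLp_v.const_smul c
  memLp_ξ := h.memLp_ξ.const_smul c
  cauchy := by
    filter_upwards [h.cauchy] with t ht
    simp only [map_smul]
    rw [intervalIntegral.integral_smul, ht, smul_add]

end IsProcess

theorem integrable_bilinForm {v w : ℝ → H} {ξ ζ : ℝ → U} (hv : MemLp v 2 halfLine)
    (hξ : MemLp ξ 2 halfLine) (hw : MemLp w 2 halfLine) (hζ : MemLp ζ 2 halfLine) :
    Integrable (fun t => bilinForm F₁ F₂ F₃ (v t) (ξ t) (w t) (ζ t)) halfLine :=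
  (((integrable_inner (F₁.comp_memLp' hv) hw).add (integrable_inner (F₂.comp_memLp' hv) hζ)).add
    (integrable_inner (F₂.comp_memLp' hw) hξ)).add
      (integrable_inner ((F₃ : U →L[ℝ] U).comp_memLp' hξ) hζ)

/-- The bounded solutions of the Hamiltonian system generate processes that satisfy the
Euler-Lagrange equation. -/
theorem exists_stationary_process (hG : IsC0Semigroup G) {A : H →ₗ.[ℝ] H}
    (hA : IsGenerator A G) {j : ℕ} (hd : HasExponentialDichotomy G j)
    (hF₃ : IsSelfAdjoint (F₃ : U →L[ℝ] U)) (hfreq : FrequencyCondition A B F₁ F₂ F₃)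
    {P : H →L[ℝ] H} (hst : stableSubspace G B F₁ F₂ F₃ = {z : H × H | z.2 = -P z.1}) (x : H) :
    ∃ (v : ℝ → H) (ξ : ℝ → U), IsProcess G B x v ξ ∧ (∀ t, ξ t = feedback B F₂ F₃ P (v t)) ∧
      ∀ (y : H) (w : ℝ → H) (ζ : ℝ → U), IsProcess G B y w ζ →
        ∫ t, bilinForm F₁ F₂ F₃ (v t) (ξ t) (w t) (ζ t) ∂halfLine = ⟪P x, y⟫ := by
  have hx : (x, -P x) ∈ stableSubspace G B F₁ F₂ F₃ := by rw [hst]; rfl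
  obtain ⟨v, η, h, hv0, hη0, K, hK⟩ := hx
  simp only at hv0 hη0
  have hη : ∀ t, 0 ≤ t → η t = -P (v t) := by
    intro t ht
    have : (v t, η t) ∈ stableSubspace G B F₁ F₂ F₃ :=
      ⟨_, _, h.shift hG ht, by simp, by simp, K, fun s hs => hK _ (add_nonneg ht hs)⟩
    rw [hst] at this
    exact this
  have hfb : ∀ t, 0 ≤ t → F₃.symm (ContinuousLinearMap.adjoint B (η t) - F₂ (v t)) =
      feedback B F₂ F₃ P (v t) := fun t ht => by rw [feedback_apply, hη t ht]
  have hvL := (h.memLp hG hA hd hF₃ hfreq hK).1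
  have hξL : MemLp (fun t => feedback B F₂ F₃ P (v t)) 2 halfLine :=
    (feedback B F₂ F₃ P).comp_memLp' hvL
  have hηL : MemLp η 2 halfLine := by
    refine (P.comp_memLp' hvL).neg.ae_eq ?_
    filter_upwards [ae_restrict_mem measurableSet_Ioi] with t ht
    exact (hη t (le_of_lt ht)).symm
  refine ⟨v, fun t => feedback B F₂ F₃ P (v t), ⟨hvL, hξL, ?_⟩, fun t => rfl, ?_⟩
  · filter_upwards [ae_restrict_mem measurableSet_Ioi] with t ht
    rw [← hv0, h.cauchy_control (le_of_lt ht)]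
    congr 1
    exact intervalIntegral_congr_halfLine (le_of_lt ht) fun s hs _ => by rw [hfb s hs.le]
  · intro y w ζ hw
    -- A process satisfies the Cauchy formula only almost everywhere; `w'` is the version that
    -- satisfies it at every time and has the initial value `y`.
    set w' : ℝ → H := fun t => G t y + ∫ s in (0 : ℝ)..t, G (t - s) (B (ζ s)) with hw'
    have hww : w =ᵐ[halfLine] w' := hw.cauchy
    have hw0 : w' 0 = y := by simp [hw', hG.map_zero_apply]
    have hint : Integrable (fun t => bilinForm F₁ F₂ F₃ (v t) (feedback B F₂ F₃ P (v t))
        (w' t) (ζ t)) halfLine :=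
      integrable_bilinForm hvL hξL (hw.memLp_v.ae_eq hww) hw.memLp_ξ
    -- Both `η = -P v` and `w'` are in `L₂`, so `⟨η, w'⟩` is integrable and the boundary term at
    -- infinity vanishes along a sequence of times.
    obtain ⟨u, hu0, hu, hlim⟩ := exists_seq_tendsto_zero
      (integrable_inner hηL (hw.memLp_v.ae_eq hww))
    have hlim' := intervalIntegral_tendsto_integral_Ioi 0 hint hu
    have hT : ∀ n, ∫ t in (0 : ℝ)..u n, bilinForm F₁ F₂ F₃ (v t) (feedback B F₂ F₃ P (v t))
        (w' t) (ζ t) = ⟪η (u n), w' (u n)⟫ + ⟪P x, y⟫ := by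
      intro n
      have := h.pairing hG hF₃ (hu0 n) (w := w') (intervalIntegrable_of_memLp hw.memLp_ξ (hu0 n))
        (fun t _ => by rw [hw0])
      rw [hw0, hη0, inner_neg_left, sub_neg_eq_add] at this
      rw [← this]
      exact intervalIntegral_congr_halfLine (hu0 n) fun s hs _ => by rw [hfb s hs.le]
    simp only [hT] at hlim'
    have hlim2 := hlim.add_const (⟪P x, y⟫)
    rw [zero_add] at hlim2
    rw [← tendsto_nhds_unique hlim' hlim2]
    refine integral_congr_ae ?_
    filter_upwards [hww] with t ht
    rw [ht]

/-! ### Quadratic minimization in the Hilbert space of processes, and the minimizer. -/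

/-- The minimum of a quadratic functional over the fibers of a family of affine subspaces is a
quadratic form. -/
theorem exists_fiberwise_infimum {Z : Type*} [NormedAddCommGroup Z] [InnerProductSpace ℝ Z]
    [CompleteSpace Z] {T : Z →L[ℝ] Z} (hT : IsSelfAdjoint T) (N : Submodule ℝ Z) {c : ℝ}
    (hc : 0 < c) (hN : ∀ n ∈ N, c * ‖n‖ ^ 2 ≤ ⟪T n, n⟫) (Φ : H →L[ℝ] Z) :
    ∃ Q : H →L[ℝ] H, IsSelfAdjoint Q ∧
      (∀ x, ∀ n ∈ N, ⟪x, Q x⟫ ≤ ⟪T (Φ x + n), Φ x + n⟫) ∧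
      ∀ x κ, 0 < κ → ∃ n ∈ N, ⟪T (Φ x + n), Φ x + n⟫ ≤ ⟪x, Q x⟫ + κ := by
  -- `N` is not assumed closed. Coercivity extends to its closure, which is complete, so that
  -- Lax-Milgram applies to the compression of `T`.
  set K := N.topologicalClosure with hK
  have : CompleteSpace K := N.isClosed_topologicalClosure.completeSpace_coe
  have hKc : ∀ n ∈ K, c * ‖n‖ ^ 2 ≤ ⟪T n, n⟫ := by
    intro n hn
    have hcl : IsClosed {n : Z | c * ‖n‖ ^ 2 ≤ ⟪T n, n⟫} :=
      isClosed_le (by fun_prop) (by fun_prop)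
    exact closure_minimal hN hcl hn
  set ι := K.subtypeL with hι
  set S : K →L[ℝ] K := ContinuousLinearMap.adjoint ι ∘L T ∘L ι with hS
  have hco : IsCoercive ((innerSL ℝ) ∘L S) := by
    refine ⟨c, hc, fun u => ?_⟩
    have h : ((innerSL ℝ) ∘L S) u u = ⟪T (u : Z), (u : Z)⟫ := by
      change ⟪S u, u⟫ = _
      rw [hS, ContinuousLinearMap.comp_apply, ContinuousLinearMap.adjoint_inner_left]
      rfl
    rw [h, mul_assoc, ← pow_two]
    exact hKc u u.2
  set E := hco.continuousLinearEquivOfBilin with hE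
  have hES : ∀ u, E u = S u := fun u => ext_inner_right ℝ fun w => by
    rw [hE, IsCoercive.continuousLinearEquivOfBilin_apply]; rfl
  -- `R x` solves `S (R x) = ι* T Φ x`, so `Ψ x = Φ x - R x` is `T`-orthogonal to `K`. It minimizes
  -- over `Φ x + K`, and the minimum is quadratic in `x`.
  set R : H →L[ℝ] K := (E.symm : K →L[ℝ] K) ∘L ContinuousLinearMap.adjoint ι ∘L T ∘L Φ with hR
  set Ψ : H →L[ℝ] Z := Φ - ι ∘L R with hΨ
  have horth : ∀ x, ∀ n ∈ K, ⟪T (Ψ x), n⟫ = 0 := by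
    intro x n hn
    have h1 : S (R x) = ContinuousLinearMap.adjoint ι (T (Φ x)) := by
      rw [← hES, hR]; simp
    have h2 := congrArg (fun z : K => ⟪z, (⟨n, hn⟩ : K)⟫) h1
    simp only [hS, ContinuousLinearMap.comp_apply, ContinuousLinearMap.adjoint_inner_left] at h2
    simp only [hΨ, _root_.sub_apply, map_sub, inner_sub_left,
      ContinuousLinearMap.comp_apply]
    exact sub_eq_zero.2 h2.symm
  have hexp : ∀ x, ∀ n ∈ K, ⟪T (Ψ x + n), Ψ x + n⟫ = ⟪T (Ψ x), Ψ x⟫ + ⟪T n, n⟫ := by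
    intro x n hn
    have h1 := horth x n hn
    have h2 : ⟪T n, Ψ x⟫ = 0 := by
      rw [real_inner_comm, ← h1]; exact (hT.isSymmetric (Ψ x) n).symm
    rw [_root_.map_add, inner_add_left, inner_add_right, inner_add_right, h1, h2]
    ring
  have hQ : ∀ x, ⟪x, (ContinuousLinearMap.adjoint Ψ ∘L T ∘L Ψ) x⟫ = ⟪T (Ψ x), Ψ x⟫ := fun x => by
    rw [ContinuousLinearMap.comp_apply, ContinuousLinearMap.adjoint_inner_right, real_inner_comm]
    rfl
  refine ⟨ContinuousLinearMap.adjoint Ψ ∘L T ∘L Ψ, ?_, fun x n hn => ?_, fun x κ hκ => ?_⟩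
  · simpa using hT.conj_adjoint (ContinuousLinearMap.adjoint Ψ)
  · have hm : (R x : Z) + n ∈ K := K.add_mem (R x).2 (N.le_topologicalClosure hn)
    have h1 : Φ x + n = Ψ x + ((R x : Z) + n) := by
      simp only [hΨ, hι, _root_.sub_apply, ContinuousLinearMap.comp_apply, Submodule.subtypeL_apply]
      abel
    rw [hQ, h1, hexp x _ hm]
    have := hKc _ hm
    have : 0 ≤ c * ‖(R x : Z) + n‖ ^ 2 := by positivity
    linarith
  · have hcont : Continuous fun n : Z => ⟪T (Φ x + n), Φ x + n⟫ := by fun_prop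
    -- The minimizing shift `-R x` lies only in the closure of `N`; an approximation within `N`
    -- costs `κ`.
    have hmem : -(R x : Z) ∈ closure (N : Set Z) := K.neg_mem (R x).2
    have hval : ⟪T (Φ x + -(R x : Z)), Φ x + -(R x : Z)⟫ <
        ⟪x, (ContinuousLinearMap.adjoint Ψ ∘L T ∘L Ψ) x⟫ + κ := by
      have h1 : Φ x + -(R x : Z) = Ψ x := by simp [hΨ, hι, sub_eq_add_neg]
      rw [hQ, h1]
      linarith
    obtain ⟨n, hn, hnN⟩ := mem_closure_iff_nhds.1 hmem _
      ((isOpen_Iio.preimage hcont).mem_nhds hval)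
    exact ⟨n, hnN, le_of_lt hn⟩

/-- The Hilbert space `L₂(0, ∞; H) × L₂(0, ∞; U)`. -/
abbrev ProcessSpace (H U : Type*) [NormedAddCommGroup H] [InnerProductSpace ℝ H]
    [NormedAddCommGroup U] [InnerProductSpace ℝ U] :=
  WithLp 2 (Lp H 2 halfLine × Lp U 2 halfLine)

theorem isProcess_iff_mem_processes {x : H} {p : Lp H 2 halfLine × Lp U 2 halfLine} :
    p ∈ processes G B x ↔ IsProcess G B x p.1 p.2 :=
  ⟨fun h => ⟨Lp.memLp _, Lp.memLp _, h⟩, fun h => h.cauchy⟩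

theorem IsProcess.fst_snd_add (hG : IsC0Semigroup G) {x y : H} {z z' : ProcessSpace H U}
    (h : IsProcess G B x z.fst z.snd) (h' : IsProcess G B y z'.fst z'.snd) :
    IsProcess G B (x + y) (z + z').fst (z + z').snd :=
  (h.add hG h').congr (Lp.coeFn_add _ _).symm (Lp.coeFn_add _ _).symm

theorem IsProcess.fst_snd_smul {x : H} {z : ProcessSpace H U}
    (h : IsProcess G B x z.fst z.snd) (c : ℝ) : IsProcess G B (c • x) (c • z).fst (c • z).snd :=
  (h.smul c).congr (Lp.coeFn_smul _ _).symm (Lp.coeFn_smul _ _).symm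

theorem IsProcess.fst_snd_sub (hG : IsC0Semigroup G) {x y : H} {z z' : ProcessSpace H U}
    (h : IsProcess G B x z.fst z.snd) (h' : IsProcess G B y z'.fst z'.snd) :
    IsProcess G B (x - y) (z - z').fst (z - z').snd := by
  have := h.fst_snd_add hG (h'.fst_snd_smul (-1))
  rwa [neg_one_smul, neg_one_smul, ← sub_eq_add_neg, ← sub_eq_add_neg] at this

/-- The bounded operator that represents the polarization of the cost functional. -/
def costOperator (F₁ : H →L[ℝ] H) (F₂ : H →L[ℝ] U) (F₃ : U ≃L[ℝ] U) :
    ProcessSpace H U →L[ℝ] ProcessSpace H U :=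
  let π₁ := WithLp.fstL 2 ℝ (Lp H 2 halfLine) (Lp U 2 halfLine)
  let π₂ := WithLp.sndL 2 ℝ (Lp H 2 halfLine) (Lp U 2 halfLine)
  let L := F₂.compLpL 2 halfLine ∘L π₁
  ContinuousLinearMap.adjoint π₁ ∘L F₁.compLpL 2 halfLine ∘L π₁ +
    ContinuousLinearMap.adjoint π₂ ∘L L + ContinuousLinearMap.adjoint L ∘L π₂ +
    ContinuousLinearMap.adjoint π₂ ∘L (F₃ : U →L[ℝ] U).compLpL 2 halfLine ∘L π₂

theorem inner_compLpL {E F : Type*} [NormedAddCommGroup E] [InnerProductSpace ℝ E]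
    [NormedAddCommGroup F] [InnerProductSpace ℝ F] (L : E →L[ℝ] F) (f : Lp E 2 halfLine)
    (g : Lp F 2 halfLine) : ⟪L.compLpL 2 halfLine f, g⟫ = ∫ t, ⟪L (f t), g t⟫ ∂halfLine := by
  rw [L2.inner_def]
  refine integral_congr_ae ?_
  filter_upwards [L.coeFn_compLpL f] with t ht
  rw [ht]

theorem integrable_inner_apply {E F : Type*} [NormedAddCommGroup E] [InnerProductSpace ℝ E]
    [NormedAddCommGroup F] [InnerProductSpace ℝ F] (L : E →L[ℝ] F) (f : Lp E 2 halfLine)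
    (g : Lp F 2 halfLine) : Integrable (fun t => ⟪L (f t), g t⟫) halfLine :=
  integrable_inner (L.comp_memLp' (Lp.memLp f)) (Lp.memLp g)

theorem inner_costOperator (z w : ProcessSpace H U) :
    ⟪costOperator F₁ F₂ F₃ z, w⟫ =
      ∫ t, bilinForm F₁ F₂ F₃ (z.fst t) (z.snd t) (w.fst t) (w.snd t) ∂halfLine := by
  have i1 := integrable_inner_apply F₁ z.fst w.fst
  have i2 := integrable_inner_apply F₂ z.fst w.snd
  have i3 := integrable_inner_apply F₂ w.fst z.snd
  have i4 := integrable_inner_apply (F₃ : U →L[ℝ] U) z.snd w.snd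
  have h := integral_add ((i1.add i2).add i3) i4
  have h' := integral_add (i1.add i2) i3
  simp only [Pi.add_apply] at h h'
  rw [h', integral_add i1 i2] at h
  simp only [bilinForm]
  refine Eq.trans ?_ h.symm
  simp only [costOperator, _root_.add_apply, ContinuousLinearMap.comp_apply,
    inner_add_left, ContinuousLinearMap.adjoint_inner_left, WithLp.fstL_apply, WithLp.sndL_apply,
    inner_compLpL]
  rw [real_inner_comm, inner_compLpL]

theorem bilinForm_comm (hF₁ : IsSelfAdjoint F₁) (hF₃ : IsSelfAdjoint (F₃ : U →L[ℝ] U))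
    (v w : H) (ξ ζ : U) : bilinForm F₁ F₂ F₃ v ξ w ζ = bilinForm F₁ F₂ F₃ w ζ v ξ := by
  have h1 : ⟪F₁ w, v⟫ = ⟪F₁ v, w⟫ := by
    rw [real_inner_comm]; exact (hF₁.isSymmetric v w).symm
  have h3 : ⟪F₃ ζ, ξ⟫ = ⟪F₃ ξ, ζ⟫ := by
    rw [real_inner_comm]; exact (hF₃.isSymmetric ξ ζ).symm
  simp only [bilinForm, h1, h3]
  ring

theorem isSelfAdjoint_costOperator (hF₁ : IsSelfAdjoint F₁)
    (hF₃ : IsSelfAdjoint (F₃ : U →L[ℝ] U)) : IsSelfAdjoint (costOperator F₁ F₂ F₃) := by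
  refine ContinuousLinearMap.isSelfAdjoint_iff_isSymmetric.2 fun z w => ?_
  change ⟪costOperator F₁ F₂ F₃ z, w⟫ = ⟪z, costOperator F₁ F₂ F₃ w⟫
  rw [real_inner_comm (costOperator F₁ F₂ F₃ w) z, inner_costOperator, inner_costOperator]
  simp only [bilinForm_comm hF₁ hF₃ (z.fst _)]

theorem costFunctional_eq (p : Lp H 2 halfLine × Lp U 2 halfLine) :
    costFunctional F₁ F₂ F₃ p =
      ⟪costOperator F₁ F₂ F₃ (WithLp.toLp 2 p), WithLp.toLp 2 p⟫ := by
  simp only [inner_costOperator, bilinForm_self]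
  rfl

theorem norm_sq_processSpace (z : ProcessSpace H U) :
    ‖z‖ ^ 2 = ∫ t, (‖z.fst t‖ ^ 2 + ‖z.snd t‖ ^ 2) ∂halfLine := by
  rw [WithLp.prod_norm_sq_eq_of_L2, integral_add (integrable_norm_sq (Lp.memLp _))
    (integrable_norm_sq (Lp.memLp _)), ← real_inner_self_eq_norm_sq, ← real_inner_self_eq_norm_sq,
    L2.inner_def, L2.inner_def]
  simp only [real_inner_self_eq_norm_sq]

/-- The processes with zero initial state. -/
def zeroProcesses (hG : IsC0Semigroup G) (B : U →L[ℝ] H) : Submodule ℝ (ProcessSpace H U) where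
  carrier := {z | IsProcess G B 0 z.fst z.snd}
  add_mem' h h' := by simpa using IsProcess.fst_snd_add hG h h'
  zero_mem' := by
    refine ⟨Lp.memLp _, Lp.memLp _, ?_⟩
    have h1 : ((0 : ProcessSpace H U).fst : ℝ → H) =ᵐ[halfLine] 0 := Lp.coeFn_zero _ _ _
    have h2 : ((0 : ProcessSpace H U).snd : ℝ → U) =ᵐ[halfLine] 0 := Lp.coeFn_zero _ _ _
    exact ((⟨MemLp.zero, MemLp.zero, Eventually.of_forall fun t => by simp⟩ :
      IsProcess G B 0 (0 : ℝ → H) (0 : ℝ → U)).congr h1.symm h2.symm).cauchy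
  smul_mem' c z h := by simpa using IsProcess.fst_snd_smul h c

theorem FrequencyCondition.coercive_costOperator (hG : IsC0Semigroup G) {A : H →ₗ.[ℝ] H}
    (hA : IsGenerator A G) {j : ℕ} (hd : HasExponentialDichotomy G j)
    (hfreq : FrequencyCondition A B F₁ F₂ F₃) :
    ∃ δ C : ℝ, 0 < δ ∧ 0 < C ∧ ∀ (x : H) (z : ProcessSpace H U), IsProcess G B x z.fst z.snd →
      δ * ‖z‖ ^ 2 ≤ ⟪costOperator F₁ F₂ F₃ z, z⟫ + C * ‖x‖ ^ 2 := by
  obtain ⟨δ, C, hδ, hC, h⟩ := hfreq.coercive hG hA hd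
  refine ⟨δ, C, hδ, hC, fun x z hz => ?_⟩
  simp only [norm_sq_processSpace, inner_costOperator, bilinForm_self]
  exact h x _ _ hz.cauchy hz.memLp_v hz.memLp_ξ

/-- The optimal process depends linearly and continuously on the initial state. -/
theorem exists_stationary_map (hG : IsC0Semigroup G) {A : H →ₗ.[ℝ] H}
    (hA : IsGenerator A G) {j : ℕ} (hd : HasExponentialDichotomy G j)
    (hF₃ : IsSelfAdjoint (F₃ : U →L[ℝ] U)) (hfreq : FrequencyCondition A B F₁ F₂ F₃)
    {P : H →L[ℝ] H} (hst : stableSubspace G B F₁ F₂ F₃ = {z : H × H | z.2 = -P z.1}) :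
    ∃ Φ : H →L[ℝ] ProcessSpace H U, ∀ x, IsProcess G B x (Φ x).fst (Φ x).snd ∧
      (∀ᵐ t ∂halfLine, (Φ x).snd t = feedback B F₂ F₃ P ((Φ x).fst t)) ∧
      ∀ (y : H) (z : ProcessSpace H U), IsProcess G B y z.fst z.snd →
        ⟪costOperator F₁ F₂ F₃ (Φ x), z⟫ = ⟪P x, y⟫ := by
  obtain ⟨δ, C, hδ, hC, hco⟩ := hfreq.coercive_costOperator hG hA hd
  have hex : ∀ x, ∃ p : ProcessSpace H U, IsProcess G B x p.fst p.snd ∧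
      (∀ᵐ t ∂halfLine, p.snd t = feedback B F₂ F₃ P (p.fst t)) ∧
      ∀ (y : H) (z : ProcessSpace H U), IsProcess G B y z.fst z.snd →
        ⟪costOperator F₁ F₂ F₃ p, z⟫ = ⟪P x, y⟫ := by
    intro x
    obtain ⟨v, ξ, hp, hfb, hE⟩ := exists_stationary_process hG hA hd hF₃ hfreq hst x
    have hv := hp.memLp_v.coeFn_toLp
    have hξ := hp.memLp_ξ.coeFn_toLp
    refine ⟨WithLp.toLp 2 (hp.memLp_v.toLp v, hp.memLp_ξ.toLp ξ), hp.congr hv.symm hξ.symm, ?_,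
      fun y z hz => ?_⟩
    · filter_upwards [hv, hξ] with t h1 h2
      simp only [WithLp.toLp_fst, WithLp.toLp_snd]
      rw [h1, h2, hfb]
    · rw [inner_costOperator, ← hE y _ _ hz]
      refine integral_congr_ae ?_
      filter_upwards [hv, hξ] with t h1 h2
      simp only [WithLp.toLp_fst, WithLp.toLp_snd]
      rw [h1, h2]
  choose φ hφ hfb hE using hex
  -- A process from `0` with zero cost vanishes by coercivity. The defect of additivity or
  -- homogeneity of `φ` is such a process, since every `φ x` pairs with it to `⟨P x, 0⟩ = 0`. Thus
  -- the chosen `φ` is automatically linear.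
  have hzero : ∀ n : ProcessSpace H U, IsProcess G B 0 n.fst n.snd →
      ⟪costOperator F₁ F₂ F₃ n, n⟫ = 0 → n = 0 := by
    intro n hn h0
    have h1 := hco 0 n hn
    rw [h0, norm_zero] at h1
    have h2 : ‖n‖ ^ 2 ≤ 0 := by nlinarith [sq_nonneg ‖n‖]
    exact norm_eq_zero.1 (pow_eq_zero_iff two_ne_zero |>.1 (le_antisymm h2 (sq_nonneg _)))
  have hadd : ∀ x y, φ (x + y) = φ x + φ y := by
    intro x y
    have hn : IsProcess G B 0 (φ (x + y) - (φ x + φ y)).fst (φ (x + y) - (φ x + φ y)).snd := by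
      simpa using (hφ (x + y)).fst_snd_sub hG ((hφ x).fst_snd_add hG (hφ y))
    refine sub_eq_zero.1 (hzero _ hn ?_)
    rw [map_sub, _root_.map_add, inner_sub_left, inner_add_left, hE _ _ _ hn, hE _ _ _ hn,
      hE _ _ _ hn]
    simp
  have hsmul : ∀ (c : ℝ) x, φ (c • x) = c • φ x := by
    intro c x
    have hn : IsProcess G B 0 (φ (c • x) - c • φ x).fst (φ (c • x) - c • φ x).snd := by
      simpa using (hφ (c • x)).fst_snd_sub hG ((hφ x).fst_snd_smul c)
    refine sub_eq_zero.1 (hzero _ hn ?_)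
    rw [map_sub, map_smul, inner_sub_left, real_inner_smul_left, hE _ _ _ hn, hE _ _ _ hn]
    simp
  have hbd : ∀ x, ‖φ x‖ ≤ Real.sqrt ((‖P‖ + C) / δ) * ‖x‖ := by
    intro x
    have h1 := hco x _ (hφ x)
    rw [hE x x _ (hφ x)] at h1
    have h2 : ⟪P x, x⟫ ≤ ‖P‖ * ‖x‖ * ‖x‖ :=
      (real_inner_le_norm _ _).trans
        (mul_le_mul_of_nonneg_right (P.le_opNorm x) (norm_nonneg _))
    refine le_of_sq_le_sq ?_ (by positivity)
    rw [mul_pow, Real.sq_sqrt (by positivity), div_mul_eq_mul_div, le_div_iff₀ hδ]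
    nlinarith
  let Φ : H →ₗ[ℝ] ProcessSpace H U :=
    { toFun := φ, map_add' := hadd, map_smul' := hsmul }
  exact ⟨Φ.mkContinuous _ hbd, fun x => ⟨hφ x, hfb x, hE x⟩⟩

/-- Another process from `x` differs from `Φ x` by a process `n` from `0`. Stationarity removes the
cross terms, so its cost is that of `Φ x` plus that of `n`, which is at least `δ ‖n‖²`: minimality
and uniqueness at once. -/
theorem exists_minimizer (hG : IsC0Semigroup G) {A : H →ₗ.[ℝ] H}
    (hA : IsGenerator A G) {j : ℕ} (hd : HasExponentialDichotomy G j)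
    (hF₁ : IsSelfAdjoint F₁) (hF₃ : IsSelfAdjoint (F₃ : U →L[ℝ] U))
    (hfreq : FrequencyCondition A B F₁ F₂ F₃)
    {P : H →L[ℝ] H} (hst : stableSubspace G B F₁ F₂ F₃ = {z : H × H | z.2 = -P z.1}) (x : H) :
    ∃ p ∈ processes G B x, IsMinOn (costFunctional F₁ F₂ F₃) (processes G B x) p ∧
      (∀ q ∈ processes G B x,
        IsMinOn (costFunctional F₁ F₂ F₃) (processes G B x) q → q = p) ∧
      costFunctional F₁ F₂ F₃ p = ⟪x, P x⟫ ∧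
      ∀ᵐ t ∂halfLine, p.2 t = feedback B F₂ F₃ P (p.1 t) := by
  obtain ⟨δ, C, hδ, -, hco⟩ := hfreq.coercive_costOperator hG hA hd
  obtain ⟨Φ, hΦ⟩ := exists_stationary_map hG hA hd hF₃ hfreq hst
  obtain ⟨h1, h2, h3⟩ := hΦ x
  have hmem : WithLp.ofLp (Φ x) ∈ processes G B x := isProcess_iff_mem_processes.2 h1
  have hval : costFunctional F₁ F₂ F₃ (WithLp.ofLp (Φ x)) = ⟪x, P x⟫ := by
    rw [costFunctional_eq]
    exact (h3 x _ h1).trans (real_inner_comm _ _)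
  have hlow : ∀ q ∈ processes G B x,
      costFunctional F₁ F₂ F₃ (WithLp.ofLp (Φ x)) + δ * ‖WithLp.toLp 2 q - Φ x‖ ^ 2 ≤
        costFunctional F₁ F₂ F₃ q := by
    intro q hq
    set z : ProcessSpace H U := WithLp.toLp 2 q with hz
    have hzp : IsProcess G B x z.fst z.snd := isProcess_iff_mem_processes.1 hq
    have hn : IsProcess G B 0 (z - Φ x).fst (z - Φ x).snd := by
      simpa using hzp.fst_snd_sub hG h1
    have hc := hco 0 _ hn
    have e1 := h3 0 _ hn
    have e2 : ⟪costOperator F₁ F₂ F₃ (z - Φ x), Φ x⟫ = 0 := by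
      rw [real_inner_comm, ← inner_zero_right (𝕜 := ℝ) (P x), ← e1]
      exact ((isSelfAdjoint_costOperator hF₁ hF₃).isSymmetric _ _).symm
    rw [inner_zero_right] at e1
    have e3 : ⟪costOperator F₁ F₂ F₃ z, z⟫ = ⟪costOperator F₁ F₂ F₃ (Φ x), Φ x⟫ +
        ⟪costOperator F₁ F₂ F₃ (z - Φ x), z - Φ x⟫ := by
      conv_lhs => rw [← add_sub_cancel (Φ x) z]
      rw [_root_.map_add, inner_add_left, inner_add_right, inner_add_right, e1, e2]
      ring
    rw [costFunctional_eq, costFunctional_eq, ← hz, e3, WithLp.toLp_ofLp]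
    simp only [norm_zero] at hc
    linarith
  refine ⟨_, hmem, fun q hq => ?_, fun q hq hmin => ?_, hval, h2⟩
  · have := hlow q hq
    have h0 : 0 ≤ δ * ‖WithLp.toLp 2 q - Φ x‖ ^ 2 := by positivity
    exact (le_add_of_nonneg_right h0).trans this
  · have h4 := hlow q hq
    have h5 : costFunctional F₁ F₂ F₃ q ≤ costFunctional F₁ F₂ F₃ (WithLp.ofLp (Φ x)) := hmin hmem
    have h6 : ‖WithLp.toLp 2 q - Φ x‖ ^ 2 ≤ 0 := by nlinarith [sq_nonneg ‖WithLp.toLp 2 q - Φ x‖]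
    have h7 : WithLp.toLp 2 q - Φ x = 0 :=
      norm_eq_zero.1 (pow_eq_zero_iff two_ne_zero |>.1 (le_antisymm h6 (sq_nonneg _)))
    rw [← sub_eq_zero.1 h7]

/-! ### Concatenation of trajectories and the dissipation inequality. -/

/-- The function that equals `f` on `(0, T]` and `g (· - T)` on `(T, ∞)`. -/
def concat {E : Type*} (T : ℝ) (f g : ℝ → E) (t : ℝ) : E := if t ≤ T then f t else g (t - T)

theorem measurePreserving_sub_halfLine (T : ℝ) :
    MeasurePreserving (fun t : ℝ => t - T) (volume.restrict (Ioi T)) halfLine := by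
  have h := (measurePreserving_sub_right (volume : Measure ℝ) T).restrict_preimage
    (measurableSet_Ioi (a := (0 : ℝ)))
  have e : (fun t : ℝ => t - T) ⁻¹' Ioi 0 = Ioi T := by ext t; simp
  rwa [e] at h

theorem Ioc_union_Ioi_zero {T : ℝ} (hT : 0 ≤ T) : Ioc 0 T ∪ Ioi T = Ioi 0 := Ioc_union_Ioi_eq_Ioi hT

theorem memLp_concat {E : Type*} [NormedAddCommGroup E] {T : ℝ} {f g : ℝ → E}
    (hf : MemLp f 2 (volume.restrict (Ioc 0 T))) (hg : MemLp g 2 halfLine) :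
    MemLp (concat T f g) 2 halfLine := by
  have h1 : MemLp ((Ioc 0 T).indicator f) 2 volume :=
    (memLp_indicator_iff_restrict measurableSet_Ioc).2 hf
  have h2 : MemLp ((Ioi T).indicator fun t => g (t - T)) 2 volume :=
    (memLp_indicator_iff_restrict measurableSet_Ioi).2
      (hg.comp_measurePreserving (measurePreserving_sub_halfLine T))
  refine ((h1.add h2).mono_measure Measure.restrict_le_self).ae_eq ?_
  filter_upwards [ae_restrict_mem measurableSet_Ioi] with t ht
  by_cases h : t ≤ T
  · rw [Pi.add_apply, indicator_of_mem (show t ∈ Ioc 0 T from ⟨ht, h⟩),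
      indicator_of_notMem (show t ∉ Ioi T from not_lt.2 h), concat, if_pos h, add_zero]
  · rw [Pi.add_apply, indicator_of_notMem (show t ∉ Ioc 0 T from fun h' => h h'.2),
      indicator_of_mem (show t ∈ Ioi T from not_le.1 h), concat, if_neg h, zero_add]

/-- Continuing a controlled trajectory on `[0, T]` by a process. -/
theorem IsControlledOn.concat (hG : IsC0Semigroup G) {T : ℝ} (hT : 0 ≤ T) {v w : ℝ → H}
    {ξ ζ : ℝ → U} (h : IsControlledOn G B T v ξ) (h' : IsProcess G B (v T) w ζ) :
    IsProcess G B (v 0) (concat T v w) (concat T ξ ζ) := by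
  have hζ := memLp_concat h.memLp_ξ h'.memLp_ξ
  refine ⟨memLp_concat h.memLp_v h'.memLp_v, hζ, ?_⟩
  have hcau : ∀ t, 0 ≤ t → t ≤ T →
      v t = G t (v 0) + ∫ s in (0 : ℝ)..t, G (t - s) (B (QuadraticRegulator.concat T ξ ζ s)) := by
    intro t ht htT
    rw [h.cauchy t ⟨ht, htT⟩]
    congr 1
    exact intervalIntegral_congr_halfLine ht fun s _ hs => by
      rw [QuadraticRegulator.concat, if_pos (hs.trans htT)]
  have hle : ∀ᵐ t ∂volume, t ∈ Ioc 0 T → QuadraticRegulator.concat T v w t =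
      G t (v 0) + ∫ s in (0 : ℝ)..t, G (t - s) (B (QuadraticRegulator.concat T ξ ζ s)) :=
    Eventually.of_forall fun t ht => by
      rw [← hcau t ht.1.le ht.2, QuadraticRegulator.concat, if_pos ht.2]
  have hgt : ∀ᵐ t ∂(volume.restrict (Ioi T)), QuadraticRegulator.concat T v w t =
      G t (v 0) + ∫ s in (0 : ℝ)..t, G (t - s) (B (QuadraticRegulator.concat T ξ ζ s)) := by
    filter_upwards [(measurePreserving_sub_halfLine T).quasiMeasurePreserving.ae h'.cauchy,
      ae_restrict_mem measurableSet_Ioi] with t ht htT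
    have h0 : 0 ≤ t - T := sub_nonneg.2 (le_of_lt htT)
    have hi := intervalIntegrable_of_memLp hζ (add_nonneg hT h0)
    -- Beyond `T` the Cauchy formula is restarted at `T`, where the first trajectory supplies the
    -- initial state `v T` of the second.
    have hm := hG.mild_add hT h0 (v 0) (g := fun s => B (QuadraticRegulator.concat T ξ ζ s))
      ⟨B.integrable_comp hi.1, B.integrable_comp hi.2⟩
    rw [← hcau T hT le_rfl, add_sub_cancel] at hm
    rw [hm, QuadraticRegulator.concat, if_neg (not_le.2 htT), ht]
    congr 1
    refine intervalIntegral_congr_halfLine h0 fun s hs _ => ?_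
    rw [QuadraticRegulator.concat, if_neg (by linarith), add_sub_cancel_left]
  rw [halfLine, ← Ioc_union_Ioi_zero hT]
  exact ae_restrict_union_iff _ _ _ |>.2 ⟨(ae_restrict_iff' measurableSet_Ioc).2 hle, hgt⟩

theorem integral_concat {T : ℝ} (hT : 0 ≤ T) {v w : ℝ → H}
    {ξ ζ : ℝ → U} (φ : H → U → ℝ)
    (hi : Integrable (fun t => φ (concat T v w t) (concat T ξ ζ t)) halfLine) :
    ∫ t, φ (concat T v w t) (concat T ξ ζ t) ∂halfLine =
      (∫ t in (0 : ℝ)..T, φ (v t) (ξ t)) + ∫ t, φ (w t) (ζ t) ∂halfLine := by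
  have hi' : IntegrableOn (fun t => φ (concat T v w t) (concat T ξ ζ t)) (Ioi 0) := hi
  have h := setIntegral_union (s := Ioc 0 T) (t := Ioi T)
    (Set.disjoint_left.2 fun t h1 h2 => not_lt.2 h1.2 h2)
    measurableSet_Ioi (hi'.mono_set Ioc_subset_Ioi_self)
    (hi'.mono_set (Ioi_subset_Ioi hT))
  rw [Ioc_union_Ioi_zero hT] at h
  rw [halfLine, h, intervalIntegral.integral_of_le hT]
  congr 1
  · refine setIntegral_congr_fun measurableSet_Ioc fun t ht => ?_
    simp only [concat, if_pos ht.2]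
  · rw [← (measurePreserving_sub_halfLine T).integral_comp
      (MeasurableEquiv.subRight T).measurableEmbedding]
    refine setIntegral_congr_fun measurableSet_Ioi fun t ht => ?_
    simp only [concat, if_neg (not_le.2 (mem_Ioi.1 ht))]

/-- One half of Bellman's principle: `Q` is the value form of the cost lowered by `(δ / 2) (|v|² +
|ξ|²)`, and following a trajectory up to `T` and then a nearly optimal process cannot beat the value
at `v 0`. -/
theorem exists_dissipation (hG : IsC0Semigroup G) {A : H →ₗ.[ℝ] H}
    (hA : IsGenerator A G) {j : ℕ} (hd : HasExponentialDichotomy G j)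
    (hF₁ : IsSelfAdjoint F₁) (hF₃ : IsSelfAdjoint (F₃ : U →L[ℝ] U))
    (hfreq : FrequencyCondition A B F₁ F₂ F₃)
    {P : H →L[ℝ] H} (hst : stableSubspace G B F₁ F₂ F₃ = {z : H × H | z.2 = -P z.1}) :
    ∃ (ε : ℝ) (Q : H →L[ℝ] H), 0 < ε ∧ IsSelfAdjoint Q ∧
      ∀ (T : ℝ) (v : ℝ → H) (ξ : ℝ → U), 0 < T → IsControlledOn G B T v ξ →
        ε * ∫ t in (0 : ℝ)..T, (‖v t‖ ^ 2 + ‖ξ t‖ ^ 2) ≤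
          ⟪v T, Q (v T)⟫ - ⟪v 0, Q (v 0)⟫ +
            ∫ t in (0 : ℝ)..T, quadForm F₁ F₂ F₃ (v t) (ξ t) := by
  obtain ⟨δ, C, hδ, -, hco⟩ := hfreq.coercive_costOperator hG hA hd
  obtain ⟨Φ, hΦ⟩ := exists_stationary_map hG hA hd hF₃ hfreq hst
  -- Half of the coercivity is given away to become `ε`; the other half keeps the lowered cost
  -- coercive on processes from `0`.
  set S : ProcessSpace H U →L[ℝ] ProcessSpace H U :=
    costOperator F₁ F₂ F₃ - (δ / 2) • ContinuousLinearMap.id ℝ _ with hS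
  have hSz : ∀ z, ⟪S z, z⟫ = ⟪costOperator F₁ F₂ F₃ z, z⟫ - δ / 2 * ‖z‖ ^ 2 := fun z => by
    simp only [hS, _root_.sub_apply, _root_.smul_apply, ContinuousLinearMap.id_apply,
      inner_sub_left, real_inner_smul_left, real_inner_self_eq_norm_sq]
  have hSs : IsSelfAdjoint S := by
    refine ContinuousLinearMap.isSelfAdjoint_iff_isSymmetric.2 fun a b => ?_
    have h : ⟪costOperator F₁ F₂ F₃ a, b⟫ = ⟪a, costOperator F₁ F₂ F₃ b⟫ :=
      (isSelfAdjoint_costOperator hF₁ hF₃).isSymmetric a b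
    change ⟪S a, b⟫ = ⟪a, S b⟫
    simp only [hS, _root_.sub_apply, _root_.smul_apply, ContinuousLinearMap.id_apply,
      inner_sub_left, inner_sub_right, real_inner_smul_left, real_inner_smul_right, h]
  obtain ⟨Q, hQ, hQ1, hQ2⟩ := exists_fiberwise_infimum hSs (zeroProcesses hG B) (half_pos hδ)
    (fun n hn => by
      have := hco 0 n hn
      rw [hSz]
      simp only [norm_zero] at this
      linarith) Φ
  refine ⟨δ / 2, Q, half_pos hδ, hQ, fun T v ξ hT hc => le_of_forall_pos_le_add fun κ hκ => ?_⟩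
  obtain ⟨n, hn, hκn⟩ := hQ2 (v T) κ hκ
  set z := Φ (v T) + n with hz
  have hzp : IsProcess G B (v T) z.fst z.snd := by
    have := (hΦ (v T)).1.fst_snd_add hG hn
    rwa [add_zero] at this
  have hp := hc.concat hG hT.le hzp
  have e1 := hp.memLp_v.coeFn_toLp
  have e2 := hp.memLp_ξ.coeFn_toLp
  set y : ProcessSpace H U := WithLp.toLp 2 (hp.memLp_v.toLp _, hp.memLp_ξ.toLp _) with hy
  have hyp : IsProcess G B (v 0) y.fst y.snd := hp.congr e1.symm e2.symm
  -- The concatenated process `y` differs from `Φ (v 0)` by a process from `0`, so its lowered cost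
  -- is at least `⟨v 0, Q (v 0)⟩`. Its tail costs at most `⟨v T, Q (v T)⟩ + κ`.
  have hlow := hQ1 (v 0) (y - Φ (v 0)) (by
    have := hyp.fst_snd_sub hG (hΦ (v 0)).1
    rwa [sub_self] at this)
  rw [add_sub_cancel, hSz] at hlow
  rw [hSz] at hκn
  have c1 : ⟪costOperator F₁ F₂ F₃ y, y⟫ =
      (∫ t in (0 : ℝ)..T, quadForm F₁ F₂ F₃ (v t) (ξ t)) + ⟪costOperator F₁ F₂ F₃ z, z⟫ := by
    simp only [inner_costOperator, bilinForm_self]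
    rw [← integral_concat hT.le _ (integrable_quadForm hp.memLp_v hp.memLp_ξ)]
    refine integral_congr_ae ?_
    filter_upwards [e1, e2] with t h1 h2
    simp only [hy, WithLp.toLp_fst, WithLp.toLp_snd]
    rw [h1, h2]
  have c2 : ‖y‖ ^ 2 = (∫ t in (0 : ℝ)..T, (‖v t‖ ^ 2 + ‖ξ t‖ ^ 2)) + ‖z‖ ^ 2 := by
    simp only [norm_sq_processSpace]
    rw [← integral_concat hT.le (fun a b => ‖a‖ ^ 2 + ‖b‖ ^ 2)
      ((integrable_norm_sq hp.memLp_v).add (integrable_norm_sq hp.memLp_ξ))]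
    refine integral_congr_ae ?_
    filter_upwards [e1, e2] with t h1 h2
    simp only [hy, WithLp.toLp_fst, WithLp.toLp_snd]
    rw [h1, h2]
  rw [c1, c2] at hlow
  linarith

end

end QuadraticRegulator

theorem mainTheorem6 {H U : Type*}
    [NormedAddCommGroup H] [InnerProductSpace ℝ H] [CompleteSpace H]
    [NormedAddCommGroup U] [InnerProductSpace ℝ U] [CompleteSpace U]
    (A : H →ₗ.[ℝ] H) (G : ℝ → H →L[ℝ] H) (j : ℕ)
    (hG : QuadraticRegulator.IsC0Semigroup G)
    (hA : QuadraticRegulator.IsGenerator A G)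
    (hdich : QuadraticRegulator.HasExponentialDichotomy G j)
    (B : U →L[ℝ] H) (F₁ : H →L[ℝ] H) (F₂ : H →L[ℝ] U) (F₃ : U ≃L[ℝ] U)
    (hF₁ : IsSelfAdjoint F₁) (hF₃ : IsSelfAdjoint (F₃ : U →L[ℝ] U))
    (hF₃pos : ∃ c : ℝ, 0 < c ∧ ∀ ξ : U, c * ‖ξ‖ ^ 2 ≤ ⟪F₃ ξ, ξ⟫)
    (hfreq : QuadraticRegulator.FrequencyCondition A B F₁ F₂ F₃)
    (P : H →L[ℝ] H) (hP : IsSelfAdjoint P)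
    (hnonosc : QuadraticRegulator.stableSubspace G B F₁ F₂ F₃ = {z : H × H | z.2 = -P z.1}) :
    (∀ v₀ : H, ∃ p ∈ QuadraticRegulator.processes G B v₀,
      IsMinOn (QuadraticRegulator.costFunctional F₁ F₂ F₃)
        (QuadraticRegulator.processes G B v₀) p ∧
      (∀ q ∈ QuadraticRegulator.processes G B v₀,
        IsMinOn (QuadraticRegulator.costFunctional F₁ F₂ F₃)
          (QuadraticRegulator.processes G B v₀) q → q = p) ∧
      QuadraticRegulator.costFunctional F₁ F₂ F₃ p = ⟪v₀, P v₀⟫ ∧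
      ∀ᵐ t ∂QuadraticRegulator.halfLine,
        p.2 t = QuadraticRegulator.feedback B F₂ F₃ P (p.1 t)) ∧
    ∃ (ε : ℝ) (Pε : H →L[ℝ] H), 0 < ε ∧ IsSelfAdjoint Pε ∧
      ∀ (T : ℝ) (v : ℝ → H) (ξ : ℝ → U), 0 < T →
        QuadraticRegulator.IsControlledOn G B T v ξ →
        ε * ∫ t in (0 : ℝ)..T, (‖v t‖ ^ 2 + ‖ξ t‖ ^ 2) ≤
          ⟪v T, Pε (v T)⟫ - ⟪v 0, Pε (v 0)⟫ +
            ∫ t in (0 : ℝ)..T, QuadraticRegulator.quadForm F₁ F₂ F₃ (v t) (ξ t) := by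
  exact ⟨QuadraticRegulator.exists_minimizer hG hA hdich hF₁ hF₃ hfreq hnonosc,
    QuadraticRegulator.exists_dissipation hG hA hdich hF₁ hF₃ hfreq hnonosc⟩
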